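/- **Setting.** Let $\Delta\ge 2$, $q=\Delta+2$, $d=\Delta-1$, $[m]=\{1,\dots,m\}$. For $k\ge1$ let $\mathbb T_k$ be the complete $\Delta$-regular tree with $k$ edge levels (the root has $\Delta$ children, every other non-leaf vertex has $d$ children). Let $\mathbb T^\star_k$ be the complete $d$-ary tree of depth $k$ with one additional hanging edge $r$ attached to its root; $L_0=\{r\}$ and $L_i$ is the set of edges between depths $i-1$ and $i$. Let $\mu_k$ be the uniform distribution on proper $q$-edge-colorings of $\mathbb T_k$; let $\mu^\star_k$ be the uniform distribution on proper edge colorings of $\mathbb T^\star_k$ in which $r$ has a color in $[q-d]=[3]$ and the other edges have colors in $[q]$; let $\mu^{\star,1}_k$ be the same with the color of $r$ fixed to $1$. For a distribution $\mu$ on colorings of an edge set $E$ with support $\Omega(\mu)$, and for $f:\Omega(\mu)\to\mathbb R$ and $S\subseteq E$, let $\mu_S[f](\sigma)$ and $\mathrm{Var}_S[f](\sigma)$ be the mean and variance of $f$ under $\mu$ conditioned on agreeing with $\sigma$ on $E\setminus S$, and write $\mathrm{Var}_e=\mathrm{Var}_{\{e\}}$. **Couplings, paths, congestion.** Write $\mu=\mu^\star_\ell$,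 and for $a\in[q-d]$ let $\mu^{ra}$ be $\mu$ conditioned on $r$ having color $a$. For $a\ne b$ in $[q-d]$ the *flip coupling* $\mathcal C_{ab}$ is the law of $(\sigma,\tau)$, where $\sigma\sim\mu^{ra}$ and $\tau$ is obtained from $\sigma$ by interchanging $a$ and $b$ on the maximal $(a,b)$-alternating path of $\sigma$ that starts at $r$. *Canonical paths* $\Gamma$ with respect to these couplings consist of, for every pair $(\sigma,\tau)$ in the support of some $\mathcal C_{ab}$, a simple path $\gamma^{\sigma,\tau}$ from $\sigma$ to $\tau$ in $\Omega(\mu)$, each step of which recolors exactly one edge. The congestion at level $t\in\{0,\dots,\ell\}$ is $$\xi_t=\max_{a\ne b\in[q-d]}\ \sum_{\substack{(\gamma,\gamma')\in\Omega(\mu)^2\\ \gamma,\gamma'\text{ differ at exactly one edge, which is in }L_t}}\frac{\Pr_{(\sigma,\tau)\sim\mathcal C_{ab}}\left[(\gamma,\gamma')\text{ is a step of }\gamma^{\sigma,\tau}\right]^2}{\mu(\gamma)\,Q(\gamma,\gamma')},$$ where, for $\gamma,\gamma'$ that differ exactly at $e$, $Q(\gamma,\gamma')$ is the conditional probability under $\mu$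 of $\gamma'$ given the colors of $\gamma$ on all edges other than $e$. **Statement.** There are absolute constants $A,B$ such that for every $\Delta\ge2$ and $q=\Delta+2$ there is an odd $\ell\le A\,\Delta^2\log^2\Delta$ with the following properties. 1. Every flip coupling $\mathcal C_{ab}$ is a coupling of $\mu^{ra}$ and $\mu^{rb}$, and there are canonical paths $\Gamma$ with respect to the flip couplings such that $$\xi_\ell\le\frac1{2(\ell+1)},\qquad \xi_j\le q^{\Delta^{B\ell}}\quad\text{for all }0\le j<\ell .$$ 2. There are constants $\alpha_0,\dots,\alpha_\ell$ with $\alpha_\ell=\frac12$ and $\alpha_j\le q^{\Delta^{B\ell}}$ for $j<\ell$ such that root-tensorization holds: for all $f:\Omega(\mu^\star_\ell)\to\mathbb R$, writing $\mu=\mu^\star_\ell$, $$\mathrm{Var}_{\mu}\big[\mu_{\mathbb T^\star_\ell\setminus\{r\}}[f]\big]\le\sum_{i=0}^{\ell}\alpha_i\sum_{e\in L_i}\mu\big[\mathrm{Var}_e[f]\big].$$ 3. There is a constant $\gamma\le q^{\Delta^{B\ell}}$ such that for every $1\le j\le\ell$ and each $\nu\in\{\mu_j,\mu^{\star,1}_j\}$,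 $\mathrm{Var}_\nu[f]\le\gamma\sum_{e}\nu[\mathrm{Var}_e[f]]$ for all $f:\Omega(\nu)\to\mathbb R$, where the sum is over all edges $e$ of the underlying tree. -/

import Mathlib

open scoped BigOperators

noncomputable section

namespace TreeEdgeColoring

/-! ## Uniform distributions on finite sets of colorings -/

/-- The uniform distribution on a finite set `Ω`, as a mass function. -/
def prob {X : Type} (Ω : Finset X) (x : X) : ℝ :=
  open Classical in if x ∈ Ω then 1 / (Ω.card : ℝ) else 0

/-- Expectation of `f` under the uniform distribution on `Ω`. -/
def mean {X : Type} (Ω : Finset X) (f : X → ℝ) : ℝ :=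
  (∑ x ∈ Ω, f x) / (Ω.card : ℝ)

/-- Variance of `f` under the uniform distribution on `Ω`. -/
def variance {X : Type} (Ω : Finset X) (f : X → ℝ) : ℝ :=
  mean Ω (fun x => (f x - mean Ω f) ^ 2)

/-- The set `γ ⊕ γ'` of edges on which two colorings differ. -/
def diffSet {E : Type} {q : ℕ} (γ γ' : E → Fin q) : Set E := {e | γ e ≠ γ' e}

/-- The elements of `Ω` that agree with `σ` outside `S`. The uniform distribution on this set is the
conditional distribution of the uniform distribution on `Ω` given the colors of `σ` off `S`. -/
def condSet {E : Type} {q : ℕ} (Ω : Finset (E → Fin q)) (S : Set E) (σ : E → Fin q) :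
    Finset (E → Fin q) :=
  open Classical in Ω.filter (fun τ => ∀ e, e ∉ S → τ e = σ e)

/-- `μ_S[f](σ)`. -/
def condMean {E : Type} {q : ℕ} (Ω : Finset (E → Fin q)) (S : Set E) (f : (E → Fin q) → ℝ)
    (σ : E → Fin q) : ℝ :=
  mean (condSet Ω S σ) f

/-- `Var_S[f](σ)`. -/
def condVar {E : Type} {q : ℕ} (Ω : Finset (E → Fin q)) (S : Set E) (f : (E → Fin q) → ℝ)
    (σ : E → Fin q) : ℝ :=
  variance (condSet Ω S σ) f

/-- Approximate tensorization of variance with constants `C e`, for the uniform distribution on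
`Ω`. Only the values of `f` on `Ω` matter. -/
def ApproxTensorization {E : Type} [Fintype E] {q : ℕ} (Ω : Finset (E → Fin q)) (C : E → ℝ) :
    Prop :=
  ∀ f : (E → Fin q) → ℝ,
    variance Ω f ≤ ∑ e, C e * mean Ω (condVar Ω {e} f)

/-- Approximate root-tensorization of variance with constants `C e`, for the uniform distribution
on `Ω` and the distinguished edge `r`. -/
def ApproxRootTensorization {E : Type} [Fintype E] {q : ℕ} (Ω : Finset (E → Fin q)) (r : E)
    (C : E → ℝ) : Prop :=
  ∀ f : (E → Fin q) → ℝ,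
    variance Ω (condMean Ω {r}ᶜ f) ≤ ∑ e, C e * mean Ω (condVar Ω {e} f)

/-! ## List edge colorings -/

/-- The line graph of a graph whose edges are indexed by `E` through their endpoints: two distinct
edges are adjacent when they share an endpoint. -/
def lineGraph {E V : Type} (ends : E → Sym2 V) : SimpleGraph E where
  Adj e f := e ≠ f ∧ ∃ v, v ∈ ends e ∧ v ∈ ends f
  symm := ⟨fun _ _ h => ⟨h.1.symm, h.2.imp fun _ hv => ⟨hv.2, hv.1⟩⟩⟩
  loopless := ⟨fun _ h => h.1 rfl⟩

/-- Proper list edge colorings: edge `e` gets a color of `L e`, adjacent edges (in the line graph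
`G`) get different colors. -/
def colorings {E : Type} [Fintype E] [DecidableEq E] {q : ℕ} (G : SimpleGraph E) (L : E → Set (Fin q)) :
    Finset (E → Fin q) :=
  open Classical in
  Finset.univ.filter (fun σ => (∀ e, σ e ∈ L e) ∧ ∀ e f, G.Adj e f → σ e ≠ σ f)

/-- The edges of the maximal `(a, b)`-colored connected set of edges of `σ` that contains `r`
(for a proper coloring of a tree with hanging edge `r` of color `a`, the maximal alternating
`(a, b)`-path that starts at `r`). -/
def altPath {E : Type} {q : ℕ} (G : SimpleGraph E) (a b : Fin q) (r : E) (σ : E → Fin q) : Set E :=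
  {e | Relation.ReflTransGen
    (fun x y => G.Adj x y ∧ (σ x = a ∨ σ x = b) ∧ (σ y = a ∨ σ y = b)) r e}

/-- Interchange the colors `a` and `b` on the maximal alternating `(a, b)`-path containing `r`. -/
def flip {E : Type} {q : ℕ} (G : SimpleGraph E) (a b : Fin q) (r : E) (σ : E → Fin q) :
    E → Fin q :=
  open Classical in fun e => if e ∈ altPath G a b r σ then Equiv.swap a b (σ e) else σ e

/-- The elements of `Ω` in which `r` has color `a`. -/
def pinned {E : Type} {q : ℕ} (Ω : Finset (E → Fin q)) (r : E) (a : Fin q) : Finset (E → Fin q) :=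
  open Classical in Ω.filter (fun σ => σ r = a)

/-! ## Couplings, canonical paths, congestion -/

/-- `C` is a coupling of the uniform distributions on `Ω₁` and `Ω₂`. -/
def IsCoupling {X : Type} [Fintype X] (Ω₁ Ω₂ : Finset X) (C : X → X → ℝ) : Prop :=
  (∀ σ τ, 0 ≤ C σ τ) ∧ (∀ σ, ∑ τ, C σ τ = prob Ω₁ σ) ∧ (∀ τ, ∑ σ, C σ τ = prob Ω₂ τ)

/-- `p` is a simple path from `σ` to `τ` inside `Ω`, each of whose steps recolors exactly one
edge. -/
def IsSimplePath {E : Type} {q : ℕ} (Ω : Finset (E → Fin q)) (σ τ : E → Fin q)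
    (p : List (E → Fin q)) : Prop :=
  p.head? = some σ ∧ p.getLast? = some τ ∧ p.Nodup ∧ (∀ γ ∈ p, γ ∈ Ω) ∧
    p.IsChain (fun γ γ' => (diffSet γ γ').ncard = 1)

/-- Heat-bath Glauber rate from `γ` to `γ'` (for `γ, γ'` that differ at one edge): the conditional
probability of `γ'` given the colors of `γ` off that edge. -/
def glauberRate {E : Type} {q : ℕ} (Ω : Finset (E → Fin q)) (γ γ' : E → Fin q) : ℝ :=
  prob (condSet Ω (diffSet γ γ') γ) γ'

/-- Probability, under the coupling `C`, that the path `Γ σ τ` makes the step from `γ` to `γ'`. -/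
def stepProb {X : Type} [Fintype X] (C : X → X → ℝ) (Γ : X → X → List X) (γ γ' : X) : ℝ :=
  open Classical in ∑ σ, ∑ τ, if [γ, γ'] <:+: Γ σ τ then C σ τ else 0

/-- Expected congestion of the paths `Γ` under the single coupling `C`, over the steps that recolor
one edge of the set `T`. -/
def pairCongestion {E : Type} [Fintype E] [DecidableEq E] {q : ℕ} (Ω : Finset (E → Fin q)) (T : Set E)
    (C : (E → Fin q) → (E → Fin q) → ℝ)
    (Γ : (E → Fin q) → (E → Fin q) → List (E → Fin q)) : ℝ :=
  open Classical in
  ∑ s ∈ (Ω ×ˢ Ω).filter (fun s => ∃ e ∈ T, diffSet s.1 s.2 = {e}),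
    stepProb C Γ s.1 s.2 ^ 2 / (prob Ω s.1 * glauberRate Ω s.1 s.2)

/-! ## The two trees -/

/-- Edges of the tree `T⋆_k`. Vertices below the hanging edge are words over the `Δ - 1` child
labels (`[]` is the root `u`, and `c :: w` is the `c`-th child of `w`), of length at most `k`. Each
edge is indexed by its lower endpoint; `[]` indexes the hanging edge. -/
abbrev StarEdge (Δ k : ℕ) : Type := {w : List (Fin (Δ - 1)) // w.length ≤ k}

instance instFintypeStarEdge (Δ k : ℕ) : Fintype (StarEdge Δ k) :=
  (List.finite_length_le (Fin (Δ - 1)) k).fintype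

/-- Endpoints in `T⋆_k`; `none` is the extra leaf vertex `v` of the hanging edge. -/
def starEnds (Δ k : ℕ) : StarEdge Δ k → Sym2 (Option (List (Fin (Δ - 1))))
  | ⟨[], _⟩ => s(none, some [])
  | ⟨c :: w, _⟩ => s(some w, some (c :: w))

/-- The hanging root edge. -/
def starRoot (Δ k : ℕ) : StarEdge Δ k := ⟨[], Nat.zero_le k⟩

/-- The level of an edge of `T⋆_k`; the hanging edge has level `0`, the leaf edges level `k`. -/
def starLevel {Δ k : ℕ} (e : StarEdge Δ k) : ℕ := e.1.length

/-- The line graph of `T⋆_k`. -/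
def starLine (Δ k : ℕ) : SimpleGraph (StarEdge Δ k) := lineGraph (starEnds Δ k)

/-- Edges of the complete `Δ`-regular tree `T_k`: the lower endpoint of an edge is a word
`w` of length less than `k` below the `i`-th child of the root. -/
abbrev RegEdge (Δ k : ℕ) : Type := Fin Δ × {w : List (Fin (Δ - 1)) // w.length < k}

instance instFintypeRegEdge (Δ k : ℕ) : Fintype (RegEdge Δ k) :=
  open Classical in
  haveI : Fintype {w : List (Fin (Δ - 1)) // w.length < k} :=
    (List.finite_length_lt (Fin (Δ - 1)) k).fintype
  inferInstance

/-- Endpoints in `T_k`; `none` is the root, which has `Δ` children. -/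
def regEnds (Δ k : ℕ) : RegEdge Δ k → Sym2 (Option (Fin Δ × List (Fin (Δ - 1))))
  | (i, ⟨[], _⟩) => s(none, some (i, []))
  | (i, ⟨c :: w, _⟩) => s(some (i, w), some (i, c :: w))

/-- The line graph of `T_k`. -/
def regLine (Δ k : ℕ) : SimpleGraph (RegEdge Δ k) := lineGraph (regEnds Δ k)

/-- The support of `μ_k`: all proper `q`-edge-colorings of `T_k`. -/
def regColorings (Δ q k : ℕ) : Finset (RegEdge Δ k → Fin q) :=
  colorings (regLine Δ k) (fun _ => Set.univ)

/-- The color list `[q - d]`, `d = Δ - 1`, of the hanging edge. -/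
def rootList (Δ q : ℕ) : Set (Fin q) := {c | c.val < q - (Δ - 1)}

/-- The support of `μ⋆_k`: proper colorings of `T⋆_k` whose hanging edge has a color in
`[q - d]`. -/
def starColorings (Δ q k : ℕ) : Finset (StarEdge Δ k → Fin q) :=
  colorings (starLine Δ k) (fun e => {c | e = starRoot Δ k → c ∈ rootList Δ q})

/-- The support of `μ⋆,1_k`: proper colorings of `T⋆_k` whose hanging edge has the first color. -/
def starPinnedColorings (Δ q k : ℕ) : Finset (StarEdge Δ k → Fin q) :=
  colorings (starLine Δ k) (fun e => {c | e = starRoot Δ k → c.val = 0})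

/-! ## Coupling sets and congestion on `T⋆_k` -/

/-- A family of functions of the shape of a coupling set, `C a b σ τ`. -/
abbrev CouplingFamily (Δ q k : ℕ) : Type :=
  Fin q → Fin q → (StarEdge Δ k → Fin q) → (StarEdge Δ k → Fin q) → ℝ

/-- A family of paths `Γ σ τ`. -/
abbrev PathFamily (Δ q k : ℕ) : Type :=
  (StarEdge Δ k → Fin q) → (StarEdge Δ k → Fin q) → List (StarEdge Δ k → Fin q)

/-- For all colors `a ≠ b` in `[q - d]`, `C a b` couples `μ⋆_k` conditioned on the hanging edge
having color `a` with `μ⋆_k` conditioned on the hanging edge having color `b`. -/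
def IsCouplingSet (Δ q k : ℕ) (C : CouplingFamily Δ q k) : Prop :=
  ∀ a ∈ rootList Δ q, ∀ b ∈ rootList Δ q, a ≠ b →
    IsCoupling (pinned (starColorings Δ q k) (starRoot Δ k) a)
      (pinned (starColorings Δ q k) (starRoot Δ k) b) (C a b)

/-- The flip coupling: `σ` is uniform among the colorings with root color `a`, and `τ` is the flip
of `σ`. -/
def flipCoupling (Δ q k : ℕ) : CouplingFamily Δ q k := fun a b σ τ =>
  open Classical in
  if τ = flip (starLine Δ k) a b (starRoot Δ k) σ then
    prob (pinned (starColorings Δ q k) (starRoot Δ k) a) σ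
  else 0

/-- `Γ` is a set of canonical paths with respect to `C`: every pair in the support of one of the
couplings is joined by a simple path. (Values of `Γ` at other pairs play no role.) -/
def IsCanonicalPaths (Δ q k : ℕ) (C : CouplingFamily Δ q k) (Γ : PathFamily Δ q k) : Prop :=
  ∀ a ∈ rootList Δ q, ∀ b ∈ rootList Δ q, a ≠ b → ∀ σ τ, C a b σ τ ≠ 0 →
    IsSimplePath (starColorings Δ q k) σ τ (Γ σ τ)

/-- The congestion `ξ_t` at level `t`: the maximum, over pairs of distinct colors of `[q - d]`, of
the expected congestion over steps that recolor an edge of level `t`. -/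
def congestion (Δ q k : ℕ) (C : CouplingFamily Δ q k) (Γ : PathFamily Δ q k) (t : ℕ) : ℝ :=
  ⨆ p : {p : Fin q × Fin q // p.1 ∈ rootList Δ q ∧ p.2 ∈ rootList Δ q ∧ p.1 ≠ p.2},
    pairCongestion (starColorings Δ q k) {e | starLevel e = t} (C p.1.1 p.1.2) Γ

end TreeEdgeColoring

end

/-! The flip must be realized by single-edge recolorings that rarely touch the leaves. With `q = Δ +
2` and `d = Δ - 1` children, exactly two colors are missing at each internal vertex below an edge.
To give an edge a color held by one of its children, that child is first moved to a missing color,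
which may force a grandchild to move, and so on (`exists_shift`). At each level there are two
missing colors to choose from. The edge is `Bad` if every such chain reaches the leaves. Being bad
for two colors forces two different children to be bad for two colors each, so the probability is
doubly exponentially small in the height (`card_bad_bad`).

An alternating path cannot be flipped by recoloring its edges one by one, since consecutive edges
would clash. Instead the next path edge is parked at a third color, after a chain has cleared that
color below it. The edge above is then recolored, the same preparation is made two edges further
down, the parked edge gets its final color, and the clearing chain is undone (`hasFlipWalk`). At
every moment an initial segment of `2 i` path edges has been flipped, and below it the coloring
differs from the original along at most two downward paths (`Window`). An intermediate coloring
therefore determines its origin up to `q ^ (4 (n + 1))` possibilities, where `n` is the height below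
the segment (`card_window`).

Touching a leaf near path edge `2 i` requires that the path reaches that edge, which costs `occ ^ (2
i)` with `occ = (Δ - 1) / (Δ + 1)`, and that a chain there is bad, which costs `occ` to a power
exponential in `n` (`card_windowBad`). The leaf congestion is at most a polynomial factor times the
sum of (multiplicity)^3 times probability (`pairCongestion_mapCoupling_le`). At depth of order `Δ²
log² Δ`, either `n` is small and the long path is unlikely, or `n` is large and the bad chain is
unlikely (`exponent_le`).

Root-tensorization follows from congestion by telescoping along the paths and applying
Cauchy–Schwarz, once over the steps of a level and once over the `ℓ + 1` levels
(`rootTensorization_of_paths`). The remaining bounds are crude. The congestion at the other levels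
is at most the fourth power of the number of colorings, and the tensorization constant `γ` needs
only connectivity under single-edge recoloring (`approxTensorization_of_connected`), which the same
chains provide (`tree_connected`, `forest_connected`). -/

noncomputable section

set_option linter.unusedSectionVars false

namespace TreeEdgeColoring

/-! ### Colored trees as an inductive type, and tagged walks of single-edge recolorings. -/

/-- Complete `ι`-ary trees of depth `n` with one hanging edge at the root, whose edges are colored
by `C`. -/
inductive CTree (C ι : Type) : ℕ → Type
  | leaf (c : C) : CTree C ι 0
  | node {n : ℕ} (c : C) (s : ι → CTree C ι n) : CTree C ι (n + 1)

namespace CTree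

variable {C ι : Type} {n : ℕ}

/-- The color of the hanging edge. -/
def root : {n : ℕ} → CTree C ι n → C
  | _, leaf c => c
  | _, node c _ => c

/-- Recolor the hanging edge. -/
def setRoot (x : C) : {n : ℕ} → CTree C ι n → CTree C ι n
  | _, leaf _ => leaf x
  | _, node _ s => node x s

/-- Proper edge colorings. -/
def Proper : {n : ℕ} → CTree C ι n → Prop
  | _, leaf _ => True
  | _, node c s => (∀ j, root (s j) ≠ c) ∧ Function.Injective (fun j => root (s j)) ∧
      ∀ j, Proper (s j)

@[simp] lemma root_leaf (c : C) : root (leaf c : CTree C ι 0) = c := rfl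
@[simp] lemma root_node (c : C) (s : ι → CTree C ι n) : root (node c s) = c := rfl
@[simp] lemma setRoot_leaf (x c : C) : setRoot x (leaf c : CTree C ι 0) = leaf x := rfl
@[simp] lemma setRoot_node (x c : C) (s : ι → CTree C ι n) :
    setRoot x (node c s) = node x s := rfl
@[simp] lemma proper_leaf (c : C) : Proper (leaf c : CTree C ι 0) := trivial
lemma proper_node {c : C} {s : ι → CTree C ι n} : Proper (node c s) ↔
    (∀ j, root (s j) ≠ c) ∧ Function.Injective (fun j => root (s j)) ∧ ∀ j, Proper (s j) := Iff.rfl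

@[simp] lemma root_setRoot (x : C) (t : CTree C ι n) : root (setRoot x t) = x := by
  cases t <;> rfl

@[simp] lemma setRoot_setRoot (x y : C) (t : CTree C ι n) :
    setRoot x (setRoot y t) = setRoot x t := by
  cases t <;> rfl

@[simp] lemma setRoot_root (t : CTree C ι n) : setRoot (root t) t = t := by
  cases t <;> rfl

lemma eq_leaf (t : CTree C ι 0) : t = leaf (root t) := by
  cases t; rfl

lemma exists_eq_node (t : CTree C ι (n + 1)) : ∃ s, t = node (root t) s := by
  cases t; exact ⟨_, rfl⟩

variable [DecidableEq ι]

/-- The two colorings differ exactly at one edge, of level `m`. -/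
inductive Recolor : {n : ℕ} → ℕ → CTree C ι n → CTree C ι n → Prop
  | root {n : ℕ} (t : CTree C ι n) (x : C) (h : x ≠ root t) : Recolor 0 t (setRoot x t)
  | kid {n m : ℕ} (c : C) (s : ι → CTree C ι n) (j : ι) (u : CTree C ι n)
      (h : Recolor m (s j) u) : Recolor (m + 1) (node c s) (node c (Function.update s j u))

lemma Recolor.symm {m : ℕ} {t u : CTree C ι n} (h : Recolor m t u) : Recolor m u t := by
  induction h with
  | root t x h =>
    have := Recolor.root (setRoot x t) (CTree.root t) (by simpa using h.symm)
    simpa using this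
  | kid c s j u h ih =>
    have := Recolor.kid c (Function.update s j u) j (s j) (by simpa using ih)
    simpa using this

lemma Recolor.kid_update {m : ℕ} (c : C) (s : ι → CTree C ι n) (j : ι) {u v : CTree C ι n}
    (h : Recolor m u v) :
    Recolor (m + 1) (node c (Function.update s j u)) (node c (Function.update s j v)) := by
  have := Recolor.kid c (Function.update s j u) j v (by simpa using h)
  simpa using this

/-- A move between proper colorings that recolors one edge, with a tag `P` that may depend on the
level of the edge and the two colorings. -/
def Move (P : ℕ → CTree C ι n → CTree C ι n → Prop) (t u : CTree C ι n) : Prop :=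
  Proper t ∧ Proper u ∧ ∃ m, Recolor m t u ∧ P m t u

/-- Walks all of whose moves carry the tag `P`. -/
def Walk (P : ℕ → CTree C ι n → CTree C ι n → Prop) (t u : CTree C ι n) : Prop :=
  Relation.ReflTransGen (Move P) t u

variable {P P' : ℕ → CTree C ι n → CTree C ι n → Prop} {t u v : CTree C ι n}

lemma Walk.refl (P : ℕ → CTree C ι n → CTree C ι n → Prop) (t : CTree C ι n) : Walk P t t :=
  Relation.ReflTransGen.refl

lemma Walk.trans (h : Walk P t u) (h' : Walk P u v) : Walk P t v :=
  Relation.ReflTransGen.trans h h'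

lemma Walk.single {m : ℕ} (ht : Proper t) (hu : Proper u) (h : Recolor m t u) (hP : P m t u) :
    Walk P t u :=
  Relation.ReflTransGen.single ⟨ht, hu, m, h, hP⟩

lemma Walk.mono (h : Walk P t u) (hP : ∀ m x y, P m x y → P' m x y) : Walk P' t u :=
  Relation.ReflTransGen.mono (r := Move P) (p := Move P')
    (fun _ _ ⟨h1, h2, m, h3, h4⟩ => ⟨h1, h2, m, h3, hP _ _ _ h4⟩) _ _ h

lemma Walk.symm (h : Walk P t u) (hP : ∀ m x y, P m x y → P m y x) : Walk P u t := by
  have : Std.Symm (Move P) :=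
    ⟨fun _ _ ⟨h1, h2, m, h3, h4⟩ => ⟨h2, h1, m, h3.symm, hP _ _ _ h4⟩⟩
  exact Std.Symm.symm (r := Relation.ReflTransGen (Move P)) _ _ h

/-- `x` can be the color of the child `j` below a parent edge of color `c`. -/
def Fits (c : C) (s : ι → CTree C ι n) (j : ι) (x : C) : Prop :=
  x ≠ c ∧ ∀ i, i ≠ j → x ≠ root (s i)

/-- The coloring is proper away from the child `j`. -/
def Ctx (c : C) (s : ι → CTree C ι n) (j : ι) : Prop :=
  (∀ i, i ≠ j → Proper (s i) ∧ root (s i) ≠ c) ∧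
    ∀ i i', i ≠ j → i' ≠ j → root (s i) = root (s i') → i = i'

lemma Proper.ctx {c : C} {s : ι → CTree C ι n} (h : Proper (node c s)) (j : ι) : Ctx c s j :=
  ⟨fun i _ => ⟨h.2.2 i, h.1 i⟩, fun _ _ _ _ hi => h.2.1 hi⟩

lemma Proper.fits {c : C} {s : ι → CTree C ι n} (h : Proper (node c s)) (j : ι) :
    Fits c s j (root (s j)) :=
  ⟨h.1 j, fun _ hi he => hi (h.2.1 he).symm⟩

lemma Ctx.proper {c : C} {s : ι → CTree C ι n} {j : ι} (h : Ctx c s j) {u : CTree C ι n}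
    (hu : Proper u) (hf : Fits c s j (root u)) : Proper (node c (Function.update s j u)) := by
  refine ⟨fun i => ?_, fun i i' hi => ?_, fun i => ?_⟩
  · by_cases hij : i = j
    · subst hij; simpa using hf.1
    · simpa [hij] using (h.1 i hij).2
  · by_cases hij : i = j <;> by_cases hij' : i' = j
    · rw [hij, hij']
    · subst hij
      simp only [Function.update_self, ne_eq, hij', not_false_eq_true, Function.update_of_ne] at hi
      exact absurd hi (hf.2 i' hij')
    · subst hij'
      simp only [Function.update_self, ne_eq, hij, not_false_eq_true, Function.update_of_ne] at hi
      exact absurd hi.symm (hf.2 i hij)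
    · simp only [ne_eq, hij, hij', not_false_eq_true, Function.update_of_ne] at hi
      exact h.2 i i' hij hij' hi
  · by_cases hij : i = j
    · subst hij; simpa using hu
    · simpa [hij] using (h.1 i hij).1

/-- Properness at the parent sees a subtree only through its root color. So a walk inside one child
lifts as soon as its tag keeps that color compatible with the parent and the siblings; levels go up
by one. -/
lemma Walk.lift_kid {P' : ℕ → CTree C ι (n + 1) → CTree C ι (n + 1) → Prop} {c : C}
    {s : ι → CTree C ι n} {j : ι} (hw : Walk P u v) (hs : Ctx c s j)
    (hP : ∀ m x y, P m x y → Fits c s j (CTree.root x) ∧ Fits c s j (CTree.root y) ∧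
      P' (m + 1) (node c (Function.update s j x)) (node c (Function.update s j y))) :
    Walk P' (node c (Function.update s j u)) (node c (Function.update s j v)) := by
  refine Relation.ReflTransGen.lift (r := Move P) (p := Move P')
    (fun x => node c (Function.update s j x)) ?_ _ _ hw
  rintro x y ⟨hx, hy, m, hr, hp⟩
  obtain ⟨h1, h2, h3⟩ := hP m x y hp
  exact ⟨hs.proper hx h1, hs.proper hy h2, m + 1, hr.kid_update c s j, h3⟩

/-- The two colorings differ only along one downward path. -/
inductive One : {n : ℕ} → CTree C ι n → CTree C ι n → Prop
  | leaf (c c' : C) : One (leaf c) (leaf c')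
  | node {n : ℕ} (c c' : C) (s : ι → CTree C ι n) (j : ι) (u : CTree C ι n) (h : One (s j) u) :
      One (node c s) (node c' (Function.update s j u))

lemma One.refl [Nonempty ι] : {n : ℕ} → (t : CTree C ι n) → One t t
  | _, .leaf c => One.leaf c c
  | _, .node c s => by
    obtain ⟨j⟩ := ‹Nonempty ι›
    simpa using One.node c c s j (s j) (One.refl (s j))

lemma One.symm {t u : CTree C ι n} (h : One t u) : One u t := by
  induction h with
  | leaf c c' => exact One.leaf c' c
  | node c c' s j u h ih =>
    simpa using One.node c' c (Function.update s j u) j (s j) (by simpa using ih)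

lemma One.kid_update {u v : CTree C ι n} (c c' : C) (s : ι → CTree C ι n) (j : ι)
    (h : One u v) : One (CTree.node c (Function.update s j u)) (CTree.node c' (Function.update s j v)) := by
  simpa using One.node c c' (Function.update s j u) j v (by simpa using h)

lemma One.setRoot [Nonempty ι] (x : C) {t u : CTree C ι n} (h : One t u) : One t (setRoot x u) := by
  cases h with
  | leaf c c' => exact One.leaf c x
  | node c c' s j u h => exact One.node c x s j u h

/-- The two colorings differ only along two downward paths. -/
def Two (t u : CTree C ι n) : Prop := ∃ v, One t v ∧ One v u

lemma Two.symm (h : Two t u) : Two u t := by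
  obtain ⟨v, h1, h2⟩ := h; exact ⟨v, h2.symm, h1.symm⟩

lemma One.two [Nonempty ι] (h : One t u) : Two t u := ⟨t, One.refl t, h⟩

/-! ### Missing colors and recoloring chains. -/

variable [Fintype C] [DecidableEq C] [Fintype ι]

/-- The colors that are missing at the lower vertex of an edge of color `c` whose children have the
colors `f`. -/
def free (c : C) (f : ι → C) : Finset C := Finset.univ \ insert c (Finset.univ.image f)

lemma mem_free {c x : C} {f : ι → C} : x ∈ free c f ↔ x ≠ c ∧ ∀ i, x ≠ f i := by
  simp only [free, Finset.mem_sdiff, Finset.mem_univ, Finset.mem_insert, Finset.mem_image,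
    true_and, not_or, not_exists]
  exact and_congr Iff.rfl (forall_congr' fun i => ⟨fun h h' => h h'.symm, fun h h' => h h'.symm⟩)

/-- The `d` children and the parent edge use `d + 1` of the `d + 3` colors. The two missing colors
give each chain a binary choice per level, and this is the source of the doubly exponential bounds.
-/
lemma card_free (hC : Fintype.card C = Fintype.card ι + 3) {c : C} {f : ι → C}
    (hf : Function.Injective f) (hc : ∀ i, f i ≠ c) : (free c f).card = 2 := by
  rw [free, Finset.card_sdiff_of_subset (Finset.subset_univ _), Finset.card_insert_of_notMem,
    Finset.card_image_of_injective _ hf, Finset.card_univ, Finset.card_univ, hC]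
  · omega
  · simpa using hc

lemma fits_of_mem_free {c x : C} {s : ι → CTree C ι n} (h : x ∈ free c (fun j => root (s j)))
    (j : ι) : Fits c s j x :=
  ⟨(mem_free.1 h).1, fun i _ => (mem_free.1 h).2 i⟩

/-- The root cannot be recolored by `x` through chains that avoid the leaf level. -/
def Bad : {n : ℕ} → CTree C ι n → C → Prop
  | _, leaf _, _ => True
  | _, node c s, x => ∃ j, root (s j) = x ∧ ∀ d ∈ free c (fun i => root (s i)), Bad (s j) d

/-- At most one child blocks `x`. It is moved to a missing color `d` after the same procedure has
made `d` available one level down. The hanging edge itself is not recolored, so the walk can be run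
inside any surrounding coloring. The last clause of the tag says that the leaves are touched only if
no choice of missing colors avoids them. -/
lemma exists_shift [Nonempty ι] (hC : Fintype.card C = Fintype.card ι + 3) :
    ∀ {n : ℕ} (t : CTree C ι n) (x : C), Proper t → x ≠ root t →
      ∃ u, Proper u ∧ root u = root t ∧ Proper (setRoot x u) ∧ One t u ∧
        Walk (fun m y z => (root y = root t ∧ One t y) ∧ (root z = root t ∧ One t z) ∧
          (m = n → Bad t x)) t u
  | _, .leaf c, x, _, _ =>
    ⟨.leaf c, trivial, rfl, trivial, One.refl _, Walk.refl _ _⟩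
  | n + 1, .node c s, x, ht, hx => by
    by_cases hj : ∃ j, root (s j) = x
    swap
    · push Not at hj
      exact ⟨.node c s, ht, rfl, ⟨hj, ht.2.1, ht.2.2⟩, One.refl _, Walk.refl _ _⟩
    obtain ⟨j, hj⟩ := hj
    have hne : (free c (fun i => root (s i))).Nonempty := by
      rw [← Finset.card_pos, card_free hC ht.2.1 ht.1]; norm_num
    -- If some missing color gives a chain that stops above the leaves, it is taken; otherwise the
    -- tree is bad for `x` and any missing color will do.
    obtain ⟨d, hd, hbad⟩ : ∃ d ∈ free c (fun i => root (s i)),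
        (Bad (s j) d → Bad (.node c s) x) := by
      by_cases hB : Bad (.node c s) x
      · obtain ⟨d, hd⟩ := hne
        exact ⟨d, hd, fun _ => hB⟩
      · have : ¬ ∀ d ∈ free c (fun i => root (s i)), Bad (s j) d := fun h => hB ⟨j, hj, h⟩
        push Not at this
        obtain ⟨d, hd, hd'⟩ := this
        exact ⟨d, hd, fun h => absurd h hd'⟩
    have hdf := fits_of_mem_free hd j
    obtain ⟨u, hu, hur, hux, huo, huw⟩ := exists_shift hC (s j) d (ht.2.2 j)
      (fun h => (mem_free.1 hd).2 j h)
    have hctx := ht.ctx j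
    have hfit := ht.fits j
    have hfit' : Fits c s j (root u) := by rw [hur]; exact hfit
    have hp1 := hctx.proper hu hfit'
    have hp2 : Proper (node c (Function.update s j (setRoot d u))) :=
      hctx.proper hux (by simpa using hdf)
    refine ⟨.node c (Function.update s j (setRoot d u)), hp2, rfl, ?_, ?_, ?_⟩
    · refine ⟨fun i => ?_, hp2.2.1, hp2.2.2⟩
      by_cases hij : i = j
      · subst hij
        simp only [Function.update_self, root_setRoot]
        rintro rfl
        exact (mem_free.1 hd).2 i hj.symm
      · simp only [ne_eq, hij, not_false_eq_true, Function.update_of_ne]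
        intro h
        exact hij (ht.2.1 (h.trans hj.symm))
    · exact One.node c c s j _ (huo.setRoot d)
    · have h1 := huw.lift_kid (P' := fun m y z => (root y = root (node c s) ∧ One (node c s) y) ∧
        (root z = root (node c s) ∧ One (node c s) z) ∧ (m = n + 1 → Bad (node c s) x)) hctx (by
          rintro m y z ⟨⟨hy1, hy2⟩, ⟨hz1, hz2⟩, hm⟩
          refine ⟨by rw [hy1]; exact hfit, by rw [hz1]; exact hfit, ⟨rfl, One.node c c s j _ hy2⟩,
            ⟨rfl, One.node c c s j _ hz2⟩, fun h => hbad (hm (by omega))⟩)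
      rw [Function.update_eq_self] at h1
      refine h1.trans (Walk.single hp1 hp2 ((Recolor.root u d ?_).kid_update c s j)
        ⟨⟨rfl, One.node c c s j _ huo⟩, ⟨rfl, One.node c c s j _ (huo.setRoot d)⟩, ?_⟩)
      · rw [hur]; exact fun h => (mem_free.1 hd).2 j h
      -- The final recoloring is at level 1, which is the leaf level only when the child is a leaf;
      -- and a leaf is bad for every color.
      · intro h
        have h0 : n = 0 := by omega
        subst h0
        apply hbad
        rw [eq_leaf (s j)]
        trivial

/-- Interchange `a` and `b` along the alternating path that starts at the hanging edge. -/
def altFlip (a b : C) : {n : ℕ} → CTree C ι n → CTree C ι n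
  | _, leaf c => leaf (Equiv.swap a b c)
  | _, node c s => node (Equiv.swap a b c)
      (fun j => if root (s j) = a ∨ root (s j) = b then altFlip a b (s j) else s j)

end CTree

end TreeEdgeColoring

/-! ### The canonical walk that flips an alternating path. -/

namespace TreeEdgeColoring
namespace CTree

variable {C ι : Type} {n : ℕ} [DecidableEq ι] [Fintype C] [DecidableEq C] [Fintype ι]

/-- An element of `S`, or `x` when `S` is empty. -/
def pick (S : Finset C) (x : C) : C := if h : S.Nonempty then h.choose else x

lemma pick_mem {S : Finset C} (h : S.Nonempty) (x : C) : pick S x ∈ S := by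
  rw [pick, dif_pos h]; exact h.choose_spec

/-- The color at which the child edge on the alternating path is parked. -/
def parkColor (a : C) (f : ι → C) : C := pick (free a f) a

/-- The color given to the child edge that blocks the parking color. -/
def chainColor (a b : C) (f : ι → C) : C := pick ((free b f).erase a) a

lemma parkColor_mem (hC : Fintype.card C = Fintype.card ι + 3) {a : C} {f : ι → C}
    (hf : Function.Injective f) (ha : ∀ i, f i ≠ a) : parkColor a f ∈ free a f :=
  pick_mem (by rw [← Finset.card_pos, card_free hC hf ha]; norm_num) _

/-- One of the two missing colors survives the removal of `a`. Avoiding `a` keeps the detour from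
creating a second edge of the path's color. -/
lemma chainColor_mem (hC : Fintype.card C = Fintype.card ι + 3) (a : C) {b : C} {f : ι → C}
    (hf : Function.Injective f) (hb : ∀ i, f i ≠ b) : chainColor a b f ∈ (free b f).erase a := by
  refine pick_mem ?_ _
  have h1 := Finset.pred_card_le_card_erase (s := free b f) (a := a)
  rw [card_free hC hf hb] at h1
  rw [← Finset.card_pos]; omega

/-- Starting the interchange along the alternating path may touch the leaf level. -/
inductive StartBad (a b : C) : {n : ℕ} → CTree C ι n → Prop
  | zero (t : CTree C ι 0) : StartBad a b t
  | one (t : CTree C ι 1) : StartBad a b t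
  | step {n : ℕ} (s : ι → CTree C ι (n + 1)) (s' : ι → CTree C ι n) (j h : ι)
      (hj : s j = node b s') (hh : root (s' h) = parkColor a (fun i => root (s i)))
      (hb : Bad (s' h) (chainColor a b (fun i => root (s' i)))) : StartBad a b (node a s)

/-- The subtree below the second edge of the alternating path after the hanging edge. -/
inductive Next (a b : C) : {n : ℕ} → CTree C ι (n + 2) → CTree C ι n → Prop
  | mk {n : ℕ} (s : ι → CTree C ι (n + 1)) (s' : ι → CTree C ι n) (j i : ι)
      (hj : s j = node b s') (hi : root (s' i) = a) : Next a b (node a s) (s' i)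

/-- The moves around the edges `2 i`, `2 i + 1`, `2 i + 2` of the alternating path may touch the
leaf level. -/
inductive WindowBad (a b : C) : ℕ → {n : ℕ} → CTree C ι n → Prop
  | start {n : ℕ} {t : CTree C ι n} (h : StartBad a b t) : WindowBad a b 0 t
  | next {n : ℕ} {t : CTree C ι (n + 2)} {u : CTree C ι n} (h : Next a b t u)
      (hu : StartBad a b u) : WindowBad a b 0 t
  | succ {i n : ℕ} {t : CTree C ι (n + 2)} {u : CTree C ι n} (h : Next a b t u)
      (hu : WindowBad a b i u) : WindowBad a b (i + 1) t

/-- `u` arises from `t` by interchanging `a` and `b` on the first `2 i` edges of the alternating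
path, and changing colors along at most two downward paths below. -/
inductive Window (a b : C) : ℕ → {n : ℕ} → CTree C ι n → CTree C ι n → Prop
  | zero {n : ℕ} {t u : CTree C ι n} (h : Two t u) : Window a b 0 t u
  | succ {i n : ℕ} (s : ι → CTree C ι (n + 1)) (s' : ι → CTree C ι n) (j k : ι)
      (u : CTree C ι n) (hj : s j = node b s') (hk : root (s' k) = a) (hu : root u = b)
      (h : Window a b i (s' k) u) :
      Window a b (i + 1) (node a s)
        (node b (Function.update s j (node a (Function.update s' k u))))

/-- Reversing the flip exchanges the roles of `a` and `b`. One count of windows thus bounds both the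
origins of a given coloring and the colorings reached from a given origin. -/
lemma Window.symm {a b : C} {i : ℕ} {t u : CTree C ι n} (h : Window a b i t u) :
    Window b a i u t := by
  induction h with
  | zero h => exact .zero h.symm
  | succ s s' j k u hj hk hu h ih =>
    have := Window.succ (a := b) (b := a) (Function.update s j (node a (Function.update s' k u)))
      (Function.update s' k u) j k (s' k) (by simp) (by simpa using hu) hk (by simpa using ih)
    simpa [← hj] using this

lemma exists_shift_root [Nonempty ι] (hC : Fintype.card C = Fintype.card ι + 3)
    (t : CTree C ι n) (x : C) (ht : Proper t) (hx : x ≠ root t) :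
    ∃ u, Proper u ∧ root u = x ∧ One t u ∧
      Walk (fun m y z => ((root y = root t ∨ root y = x) ∧ One t y) ∧
        ((root z = root t ∨ root z = x) ∧ One t z) ∧ (m = n → Bad t x)) t u := by
  obtain ⟨u, hu, hur, hux, huo, huw⟩ := exists_shift hC t x ht hx
  refine ⟨setRoot x u, hux, root_setRoot _ _, huo.setRoot x, ?_⟩
  refine (huw.mono (P' := fun m y z => ((root y = root t ∨ root y = x) ∧ One t y) ∧
    ((root z = root t ∨ root z = x) ∧ One t z) ∧ (m = n → Bad t x))
    (fun m y z ⟨⟨h1, h2⟩, ⟨h3, h4⟩, h5⟩ => ⟨⟨.inl h1, h2⟩, ⟨.inl h3, h4⟩, h5⟩)).trans ?_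
  refine Walk.single hu hux (Recolor.root u x (by rwa [hur])) ⟨⟨.inl hur, huo⟩,
    ⟨.inr (root_setRoot _ _), huo.setRoot x⟩, ?_⟩
  rintro rfl
  rw [eq_leaf t]; trivial

/-- Clears the color `c` from the children of an edge of color `b`, so that the edge itself can be
parked at `c`: the one child of color `c` is moved to the detour color by a chain. The final clause
lets the same chain be replayed when the upper edge has color `a` or `b` and the path child (of
color `a`) has been replaced by another tree with root color `a` or `b`. This is needed because the
clearing is undone only after the path child has changed. -/
lemma exists_park [Nonempty ι] (hC : Fintype.card C = Fintype.card ι + 3) {a b c : C}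
    {s : ι → CTree C ι n} (hs : Proper (node b s)) (hca : c ≠ a) (hcb : c ≠ b) :
    ∃ s' : ι → CTree C ι n, Proper (node b s') ∧ (∀ i, root (s' i) ≠ c) ∧
      (∀ i, root (s i) = a → s' i = s i) ∧ (∀ i, root (s i) ≠ a → root (s' i) ≠ a) ∧
      (∃ h u, One (s h) u ∧ s' = Function.update s h u) ∧
      ∀ (y : C) (r : ι → CTree C ι n), (y = a ∨ y = b) → Proper (node y r) →
        (∀ i, root (s i) ≠ a → r i = s i) →
        (∀ i, root (s i) = a → root (r i) = a ∨ root (r i) = b) →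
        ∀ P' : ℕ → CTree C ι (n + 1) → CTree C ι (n + 1) → Prop,
          (∀ m h v v', root (s h) ≠ a → One (s h) v → One (s h) v' →
            (m = n → ∃ k, root (s k) = c ∧ Bad (s k) (chainColor a b (fun i => root (s i)))) →
            P' (m + 1) (node y (Function.update r h v)) (node y (Function.update r h v'))) →
          Walk P' (node y r) (node y (fun i => if root (s i) = a then r i else s' i)) := by
  by_cases hh : ∃ h, root (s h) = c
  swap
  · push Not at hh
    obtain ⟨h0⟩ := ‹Nonempty ι›
    refine ⟨s, hs, hh, fun _ _ => rfl, fun _ h => h, ⟨h0, s h0, One.refl _, by simp⟩, ?_⟩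
    intro y r _ _ hr _ P' _
    have : (fun i => if root (s i) = a then r i else s i) = r := by
      funext i
      split_ifs with hi
      · rfl
      · exact (hr i hi).symm
    rw [this]
    exact Walk.refl _ _
  obtain ⟨h, hh⟩ := hh
  set d := chainColor a b (fun i => root (s i)) with hd
  have hdm : d ∈ (free b (fun i => root (s i))).erase a := chainColor_mem hC a hs.2.1 hs.1
  rw [Finset.mem_erase, mem_free] at hdm
  obtain ⟨hda, hdb, hdf⟩ := hdm
  obtain ⟨u, hu, hur, huo, huw⟩ := exists_shift_root hC (s h) d (hs.2.2 h) (hdf h)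
  have hha : root (s h) ≠ a := by rw [hh]; exact hca
  refine ⟨Function.update s h u, (hs.ctx h).proper hu ⟨by rwa [hur], fun i _ => by
    rw [hur]; exact hdf i⟩, ?_, ?_, ?_, ⟨h, u, huo, rfl⟩, ?_⟩
  · intro i
    by_cases hi : i = h
    · subst hi
      simp only [Function.update_self, hur]
      rw [← hh]; exact hdf i
    · simp only [ne_eq, hi, not_false_eq_true, Function.update_of_ne]
      rw [← hh]; exact fun he => hi (hs.2.1 he)
  · intro i hi
    have : i ≠ h := by rintro rfl; exact hha hi
    simp [this]
  · intro i hi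
    by_cases hih : i = h
    · subst hih; simpa [hur] using hda
    · simpa [hih] using hi
  · intro y r hy hr hrs hra P' hP'
    have hrh : r h = s h := hrs h hha
    -- During the chain the blocking child has only the colors `c` and `d`. Both differ from `a` and
    -- `b`, so neither the upper edge nor the modified path child can conflict with it.
    have hfit : ∀ x, (x = root (s h) ∨ x = d) → Fits y r h x := by
      intro x hx
      have hxa : x ≠ a := by rcases hx with rfl | rfl <;> assumption
      have hxb : x ≠ b := by
        rcases hx with rfl | rfl
        · rwa [hh]
        · assumption
      refine ⟨by rcases hy with rfl | rfl <;> assumption, fun i hi => ?_⟩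
      by_cases hia : root (s i) = a
      · rcases hra i hia with h1 | h1 <;> rw [h1] <;> assumption
      · rw [hrs i hia]
        rcases hx with rfl | rfl
        · exact fun he => hi (hs.2.1 he).symm
        · exact hdf i
    have h1 := huw.lift_kid (P' := P') (hr.ctx h) (by
      rintro m v v' ⟨⟨h1, h2⟩, ⟨h3, h4⟩, h5⟩
      exact ⟨hfit _ h1, hfit _ h3, hP' m h v v' hha h2 h4 (fun hm => ⟨h, hh, h5 hm⟩)⟩)
    rw [← hrh, Function.update_eq_self] at h1
    convert h1 using 2
    funext i
    by_cases hih : i = h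
    · subst hih; simp [hha]
    · by_cases hia : root (s i) = a
      · simp [hia, hih]
      · simp [hia, hih, hrs i hia]

lemma altFlip_node_of_forall {a b : C} {s : ι → CTree C ι n}
    (hs : Proper (node a s)) (hb : ∀ j, root (s j) ≠ b) : altFlip a b (node a s) = node b s := by
  simp only [altFlip, Equiv.swap_apply_left]
  congr 1
  funext j
  simp [hs.1 j, hb j]

lemma altFlip_node {a b : C} {s : ι → CTree C ι n}
    (hs : Proper (node a s)) {j : ι} (hj : root (s j) = b) :
    altFlip a b (node a s) = node b (Function.update s j (altFlip a b (s j))) := by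
  simp only [altFlip, Equiv.swap_apply_left]
  congr 1
  funext i
  by_cases hij : i = j
  · subst hij; simp [hj]
  · have : root (s i) ≠ b := fun h => hij (hs.2.1 (h.trans hj.symm))
    simp [hs.1 i, this, hij]

lemma altFlip_comm (a b : C) : ∀ {n : ℕ} (t : CTree C ι n), altFlip a b t = altFlip b a t
  | _, .leaf c => by simp [altFlip, Equiv.swap_comm]
  | _, .node c s => by
    simp only [altFlip, Equiv.swap_comm a b]
    congr 1
    funext j
    rw [altFlip_comm a b (s j)]
    simp only [or_comm]

/-- The tag of the moves that prepare the recoloring of the hanging edge. -/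
def StartTag (a b : C) (t : CTree C ι n) (m : ℕ) (u v : CTree C ι n) : Prop :=
  ((root u = a ∨ root u = b) ∧ One t u) ∧ ((root v = a ∨ root v = b) ∧ One t v) ∧
    (m = n → StartBad a b t)

/-- The tag of the moves after the recoloring of the hanging edge. -/
def FlipTag (a b : C) (t : CTree C ι n) (m : ℕ) (u v : CTree C ι n) : Prop :=
  root u = b ∧ root v = b ∧ (m = n → ∃ i, WindowBad a b i t ∧ Window a b i t u ∧ Window a b i t v)

lemma FlipTag.of_lt {a b : C} {t u v : CTree C ι n} {m : ℕ} (hu : root u = b) (hv : root v = b)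
    (hm : m < n) : FlipTag a b t m u v := ⟨hu, hv, fun h => absurd h hm.ne⟩

lemma FlipTag.of_two {a b : C} {t u v : CTree C ι n} {m : ℕ} (hu : root u = b) (hv : root v = b)
    (hm : m = n → WindowBad a b 0 t) (htu : Two t u) (htv : Two t v) : FlipTag a b t m u v :=
  ⟨hu, hv, fun h => ⟨0, hm h, .zero htu, .zero htv⟩⟩

/-- The properties of the two halves of a canonical walk. -/
def HasFlipWalk (a b : C) (t : CTree C ι n) : Prop :=
  ∃ mid : CTree C ι n, Proper mid ∧ root mid = b ∧ One t mid ∧ Walk (StartTag a b t) t mid ∧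
    Walk (FlipTag a b t) mid (altFlip a b t)

lemma hasFlipWalk_of_forall [Nonempty ι] {a b : C} (hab : a ≠ b) {s : ι → CTree C ι n}
    (hs : Proper (node a s)) (hb : ∀ j, root (s j) ≠ b) : HasFlipWalk a b (node a s) := by
  have hp : Proper (node b s) := ⟨hb, hs.2⟩
  have h1 : One (node a s) (node b s) := (One.refl (node a s)).setRoot b
  refine ⟨node b s, hp, rfl, h1,
    Walk.single hs hp (Recolor.root (node a s) b hab.symm)
      ⟨⟨.inl rfl, One.refl _⟩, ⟨.inr rfl, h1⟩, fun h => absurd h (by omega)⟩, ?_⟩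
  rw [altFlip_node_of_forall hs hb]
  exact Walk.refl _ _

/-- The path consists of the hanging edge and one leaf edge, so there is nothing to clear: the leaf
edge waits at a missing color while the hanging edge changes. -/
lemma hasFlipWalk_one [Nonempty ι] (hC : Fintype.card C = Fintype.card ι + 3) {a b : C}
    (hab : a ≠ b) {s : ι → CTree C ι 0} (hs : Proper (node a s)) {j : ι} (hj : root (s j) = b) :
    HasFlipWalk a b (node a s) := by
  set c := parkColor a (fun i => root (s i)) with hc
  have hcm : c ∈ free a (fun i => root (s i)) := parkColor_mem hC hs.2.1 hs.1
  have hcb : c ≠ b := by rw [← hj]; exact (mem_free.1 hcm).2 j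
  have hca : c ≠ a := (mem_free.1 hcm).1
  have hsj : s j = leaf b := by rw [← hj]; exact eq_leaf _
  have hone : ∀ y u, One (node a s) (node y (Function.update s j u)) := fun y u =>
    One.node a y s j u (by rw [hsj, eq_leaf u]; exact One.leaf _ _)
  have hp1 : Proper (node a (Function.update s j (leaf c))) :=
    (hs.ctx j).proper (proper_leaf c) (fits_of_mem_free hcm j)
  have hfb := hs.fits j
  rw [hj] at hfb
  have hctx : Ctx b s j :=
    ⟨fun i hi => ⟨hs.2.2 i, (hfb.2 i hi).symm⟩, (hs.ctx j).2⟩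
  have hp2 : Proper (node b (Function.update s j (leaf c))) :=
    hctx.proper (proper_leaf c) ⟨hcb, (fits_of_mem_free hcm j).2⟩
  have hp3 : Proper (node b (Function.update s j (leaf a))) :=
    hctx.proper (proper_leaf a) ⟨hab, fun i _ => (hs.1 i).symm⟩
  refine ⟨node b (Function.update s j (leaf c)), hp2, rfl, hone _ _, ?_, ?_⟩
  · refine (Walk.single (P := StartTag a b (node a s)) hs hp1
      (Recolor.kid a s j (leaf c) (m := 0) ?_)
      ⟨⟨.inl rfl, One.refl _⟩, ⟨.inl rfl, hone _ _⟩, fun _ => .one _⟩).trans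
      (Walk.single hp1 hp2 (Recolor.root _ b hab.symm)
      ⟨⟨.inl rfl, hone _ _⟩, ⟨.inr rfl, hone _ _⟩, fun _ => .one _⟩)
    rw [hsj]; exact Recolor.root (leaf b) c hcb
  · have : altFlip a b (node a s) = node b (Function.update s j (leaf a)) := by
      rw [altFlip_node hs hj, hsj]; simp [altFlip]
    rw [this]
    exact Walk.single hp2 hp3 ((Recolor.root (leaf c : CTree C ι 0) a hca.symm).kid_update b s j)
      (.of_two rfl rfl (fun _ => .start (.one _)) (hone _ _).two (hone _ _).two)

/-- Advances the flip by two edges. The walk is split at the moment the hanging edge turns to `b`,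
because the two halves for the lower subtree are run at different times: its first half while the
edge above it is parked at `c` (where both `a` and `b` fit), its second half after that edge has
received its final color `a`. -/
lemma hasFlipWalk_step [Nonempty ι] (hC : Fintype.card C = Fintype.card ι + 3) {a b : C}
    (hab : a ≠ b) {s : ι → CTree C ι (n + 1)} (hs : Proper (node a s)) {j : ι}
    {s₁ : ι → CTree C ι n} (hj : s j = node b s₁)
    (ih : ∀ k, root (s₁ k) = a → HasFlipWalk a b (s₁ k)) :
    HasFlipWalk a b (node a s) := by
  have hjr : root (s j) = b := by rw [hj]; rfl
  obtain ⟨c, hc⟩ : ∃ c, c = parkColor a (fun i => root (s i)) := ⟨_, rfl⟩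
  have hcm : c ∈ free a (fun i => root (s i)) := hc ▸ parkColor_mem hC hs.2.1 hs.1
  have hcb : c ≠ b := by rw [← hjr]; exact (mem_free.1 hcm).2 j
  have hca : c ≠ a := (mem_free.1 hcm).1
  have hfb := hs.fits j
  rw [hjr] at hfb
  have hctxa := hs.ctx j
  have hctx : Ctx b s j :=
    ⟨fun i hi => ⟨hs.2.2 i, (hfb.2 i hi).symm⟩, (hs.ctx j).2⟩
  have hfc : Fits b s j c := ⟨hcb, (fits_of_mem_free hcm j).2⟩
  have hfa : Fits b s j a := ⟨hab, fun i _ => (hs.1 i).symm⟩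
  have hs₁ : Proper (node b s₁) := hj ▸ hs.2.2 j
  obtain ⟨s', hs', hs'c, hs'a, hs'na, ⟨h, u, hhu, hs'u⟩, hpark⟩ := exists_park (a := a) hC hs₁ hca hcb
  have hstart : (∃ k, root (s₁ k) = c ∧ Bad (s₁ k) (chainColor a b (fun i => root (s₁ i)))) →
      StartBad a b (node a s) := by
    rintro ⟨k, hk, hk'⟩
    exact .step s s₁ j k hj (hk.trans hc) hk'
  have hs'b := hs'.1
  have hpc' : Proper (node c s') := ⟨hs'c, hs'.2⟩
  have hone1 : ∀ y z, One (node y s₁) (node z s') := fun y z => by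
    rw [hs'u]; exact One.node y z s₁ h u hhu
  have hone : ∀ y x z, One x z → One (node a (Function.update s j x)) (node y (Function.update s j z)) :=
    fun y x z hz => One.kid_update a y s j hz
  have hsup : Function.update s j (node b s₁) = s := by rw [← hj]; simp
  have hone' : ∀ y z, One (node b s₁) z → One (node a s) (node y (Function.update s j z)) := by
    intro y z hz
    have := hone y _ _ hz
    rwa [hsup] at this
  have hpa : Proper (node a (Function.update s j (node b s'))) := by
    refine hctxa.proper hs' ?_
    rw [root_node]
    exact hfb
  have hpa' : Proper (node a (Function.update s j (node c s'))) :=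
    hctxa.proper hpc' (fits_of_mem_free hcm j)
  have hpm : Proper (node b (Function.update s j (node c s'))) := hctx.proper hpc' hfc
  -- First half: clear `c` below the child edge, park that edge at `c`, recolor the hanging edge
  -- from `a` to `b`.
  have hw1 : Walk (StartTag a b (node a s)) (node a s) (node b (Function.update s j (node c s'))) := by
    have h1 := (hpark b s₁ (.inr rfl) hs₁ (fun _ _ => rfl) (fun _ h => .inl h)
      (fun m y z => (root y = b ∧ One (node b s₁) y) ∧ (root z = b ∧ One (node b s₁) z) ∧
        (m = n + 1 → StartBad a b (node a s))) (by
        intro m k v v' _ hv hv' hm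
        exact ⟨⟨rfl, One.node b b s₁ k v hv⟩, ⟨rfl, One.node b b s₁ k v' hv'⟩,
          fun h => hstart (hm (by omega))⟩)).lift_kid (P' := StartTag a b (node a s)) hctxa (by
        rintro m y z ⟨⟨h1, h2⟩, ⟨h3, h4⟩, h5⟩
        refine ⟨by rw [h1]; exact hfb, by rw [h3]; exact hfb, ⟨.inl rfl, hone' _ _ h2⟩,
          ⟨.inl rfl, hone' _ _ h4⟩, fun h => h5 (by omega)⟩)
    have e1 : (fun i => if root (s₁ i) = a then s₁ i else s' i) = s' := by
      funext i
      split_ifs with hi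
      · exact (hs'a i hi).symm
      · rfl
    rw [e1, hsup] at h1
    refine (h1.trans (Walk.single hpa hpa' ((Recolor.root (node b s') c hcb).kid_update a s j)
      ⟨⟨.inl rfl, hone' _ _ (hone1 _ _)⟩, ⟨.inl rfl, hone' _ _ (hone1 _ _)⟩,
        fun h => absurd h (by omega)⟩)).trans
      (Walk.single hpa' hpm (Recolor.root _ b hab.symm)
      ⟨⟨.inl rfl, hone' _ _ (hone1 _ _)⟩, ⟨.inr rfl, hone' _ _ (hone1 _ _)⟩,
        fun h => absurd h (by omega)⟩)
  refine ⟨_, hpm, rfl, hone' _ _ (hone1 _ _), hw1, ?_⟩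
  rw [altFlip_node hs hjr, hj, altFlip_comm]
  -- If no edge of color `a` continues the path, the parked edge goes directly to `a`. The clearing
  -- chain is then undone by building it as a walk from the unshifted coloring and reversing that
  -- walk.
  by_cases hk : ∃ k, root (s₁ k) = a
  swap
  · push Not at hk
    rw [altFlip_node_of_forall hs₁ hk]
    have hpas : Proper (node a s₁) := ⟨hk, hs₁.2⟩
    have hpas' : Proper (node a s') := ⟨fun i => hs'na i (hk i), hs'.2⟩
    have h1 := (hpark a s₁ (.inl rfl) hpas (fun _ _ => rfl) (fun _ h => .inl h)
      (fun m y z => (root y = a ∧ One (node b s₁) y) ∧ (root z = a ∧ One (node b s₁) z) ∧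
        (m = n + 1 → StartBad a b (node a s))) (by
        intro m k v v' _ hv hv' hm
        exact ⟨⟨rfl, One.node b a s₁ k v hv⟩, ⟨rfl, One.node b a s₁ k v' hv'⟩,
          fun h => hstart (hm (by omega))⟩)).lift_kid (P' := FlipTag a b (node a s)) hctx (by
        rintro m y z ⟨⟨h1, h2⟩, ⟨h3, h4⟩, h5⟩
        exact ⟨by rw [h1]; exact hfa, by rw [h3]; exact hfa, .of_two rfl rfl
          (fun h => .start (h5 (by omega))) (hone' _ _ h2).two (hone' _ _ h4).two⟩)
    have e1 : (fun i => if root (s₁ i) = a then s₁ i else s' i) = s' := by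
      funext i
      simp [hk i]
    rw [e1] at h1
    have h2 := h1.symm (fun m x y ⟨h1, h2, h3⟩ => ⟨h2, h1, fun h => by
      obtain ⟨i, hi1, hi2, hi3⟩ := h3 h; exact ⟨i, hi1, hi3, hi2⟩⟩)
    refine (Walk.single hpm ?_ ((Recolor.root (node c s') a hca.symm).kid_update b s j)
      (.of_lt rfl rfl (by omega))).trans h2
    exact hctx.proper hpas' hfa
  obtain ⟨k, hk⟩ := hk
  rw [altFlip_node hs₁ hk, altFlip_comm b a]
  obtain ⟨mid, hmid, hmidr, hmido, hw2, hw3⟩ := ih k hk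
  have hs'k : s' k = s₁ k := hs'a k hk
  have hnext : Next a b (node a s) (s₁ k) := .mk s s₁ j k hj hk
  have hctxc' : Ctx c s' k := hpc'.ctx k
  have hs'ka : ∀ i, i ≠ k → a ≠ root (s' i) := fun i hi =>
    (hs'na i (fun h => hi (hs₁.2.1 (h.trans hk.symm)))).symm
  have hfita : Fits c s' k a := ⟨hca.symm, hs'ka⟩
  have hfitb : Fits c s' k b := ⟨hcb.symm, fun i _ => (hs'b i).symm⟩
  have hctxa' : Ctx a s' k := ⟨fun i hi => ⟨hs'.2.2 i, (hs'ka i hi).symm⟩, hctxc'.2⟩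
  have hctxa₁ : Ctx a s₁ k :=
    ⟨fun i hi => ⟨hs₁.2.2 i, fun h => hi (hs₁.2.1 (h.trans hk.symm))⟩, (hs₁.ctx k).2⟩
  have hfitab : Fits a s' k b := ⟨hab.symm, hfitb.2⟩
  have hfitab₁ : Fits a s₁ k b := ⟨hab.symm, fun i _ => (hs₁.1 i).symm⟩
  have hpc2 : Proper (node c (Function.update s' k mid)) :=
    hctxc'.proper hmid (by rwa [hmidr])
  have hpa2 : Proper (node a (Function.update s' k mid)) :=
    hctxa'.proper hmid (by rwa [hmidr])
  have hpa1 : Proper (node a (Function.update s₁ k mid)) :=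
    hctxa₁.proper hmid (by rwa [hmidr])
  -- The lower subtree makes its first half below the parked edge. The differences from the start
  -- lie on two downward paths, one through the clearing chain and one through the path child, so
  -- the window index is still 0; this is why `WindowBad` at 0 also admits a bad start two edges
  -- down.
  have w1 : Walk (FlipTag a b (node a s)) (node b (Function.update s j (node c s')))
      (node b (Function.update s j (node c (Function.update s' k mid)))) := by
    have h1 := (hw2.lift_kid (P' := fun m y z => (root y = c ∧ One (node c s') y) ∧
      (root z = c ∧ One (node c s') z) ∧ (m = n + 1 → StartBad a b (s₁ k))) hctxc' (by
        rintro m y z ⟨⟨h1, h2⟩, ⟨h3, h4⟩, h5⟩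
        refine ⟨by rcases h1 with h1 | h1 <;> rw [h1] <;> assumption,
          by rcases h3 with h1 | h1 <;> rw [h1] <;> assumption,
          ⟨rfl, One.node c c s' k y (by rwa [hs'k])⟩,
          ⟨rfl, One.node c c s' k z (by rwa [hs'k])⟩, fun h => h5 (by omega)⟩)).lift_kid
      (P' := FlipTag a b (node a s)) hctx (by
        rintro m y z ⟨⟨h1, h2⟩, ⟨h3, h4⟩, h5⟩
        refine ⟨by rwa [h1], by rwa [h3], .of_two rfl rfl
          (fun h => .next hnext (h5 (by omega)))
          ⟨_, hone' b _ (hone1 b c), One.kid_update b b s j h2⟩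
          ⟨_, hone' b _ (hone1 b c), One.kid_update b b s j h4⟩⟩)
    rwa [← hs'k, Function.update_eq_self] at h1
  have w2 : Walk (FlipTag a b (node a s))
      (node b (Function.update s j (node c (Function.update s' k mid))))
      (node b (Function.update s j (node a (Function.update s' k mid)))) :=
    Walk.single (hctx.proper hpc2 hfc) (hctx.proper hpa2 hfa)
      ((Recolor.root (node c (Function.update s' k mid)) a hca.symm).kid_update b s j)
      (.of_lt rfl rfl (by omega))
  -- This is the clearing chain replayed below color `a`, with the path child already changed to
  -- `mid`; it is used in reverse to restore the siblings.
  have w3 : Walk (FlipTag a b (node a s))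
      (node b (Function.update s j (node a (Function.update s₁ k mid))))
      (node b (Function.update s j (node a (Function.update s' k mid)))) := by
    have hupd : ∀ i, root (s₁ i) ≠ a → Function.update s₁ k mid i = s₁ i := by
      intro i hi
      have : i ≠ k := by rintro rfl; exact hi hk
      simp [this]
    have h1 := (hpark a (Function.update s₁ k mid) (.inl rfl) hpa1 hupd (by
        intro i hi
        have : i = k := hs₁.2.1 (hi.trans hk.symm)
        subst this
        simp [hmidr])
      (fun m y z => (root y = a ∧ One (node b (Function.update s₁ k mid)) y) ∧
        (root z = a ∧ One (node b (Function.update s₁ k mid)) z) ∧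
        (m = n + 1 → StartBad a b (node a s))) (by
        intro m i v v' hi hv hv' hm
        exact ⟨⟨rfl, One.node b a _ i v (by rwa [hupd i hi])⟩,
          ⟨rfl, One.node b a _ i v' (by rwa [hupd i hi])⟩,
          fun h => hstart (hm (by omega))⟩)).lift_kid (P' := FlipTag a b (node a s)) hctx (by
        rintro m y z ⟨⟨h1, h2⟩, ⟨h3, h4⟩, h5⟩
        have h6 : One (node b s₁) (node b (Function.update s₁ k mid)) :=
          One.node b b s₁ k mid hmido
        exact ⟨by rw [h1]; exact hfa, by rw [h3]; exact hfa, .of_two rfl rfl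
          (fun h => .start (h5 (by omega)))
          ⟨_, hone' b _ h6, One.kid_update b b s j h2⟩
          ⟨_, hone' b _ h6, One.kid_update b b s j h4⟩⟩)
    have e1 : (fun i => if root (s₁ i) = a then Function.update s₁ k mid i else s' i) =
        Function.update s' k mid := by
      funext i
      by_cases hik : i = k
      · subst hik; simp [hk]
      · have : root (s₁ i) ≠ a := fun h => hik (hs₁.2.1 (h.trans hk.symm))
        simp [hik, this]
    rwa [e1] at h1
  -- Now the first two path edges have their final colors and their surroundings are restored, so
  -- the remaining windows are those of the lower subtree with index raised by one.
  have w4 : Walk (FlipTag a b (node a s))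
      (node b (Function.update s j (node a (Function.update s₁ k mid))))
      (node b (Function.update s j (node a (Function.update s₁ k (altFlip a b (s₁ k)))))) :=
    (hw3.lift_kid (P' := fun m y z => root y = a ∧ root z = a ∧ (m = n + 1 →
      ∃ i, WindowBad a b (i + 1) (node a s) ∧
        Window a b (i + 1) (node a s) (node b (Function.update s j y)) ∧
        Window a b (i + 1) (node a s) (node b (Function.update s j z)))) hctxa₁ (by
        rintro m y z ⟨h1, h2, h3⟩
        refine ⟨by rwa [h1], by rwa [h2], rfl, rfl, fun h => ?_⟩
        obtain ⟨i, hi1, hi2, hi3⟩ := h3 (by omega)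
        exact ⟨i, .succ hnext hi1, .succ s s₁ j k y hj hk h1 hi2,
          .succ s s₁ j k z hj hk h2 hi3⟩)).lift_kid hctx (by
        rintro m y z ⟨h1, h2, h3⟩
        refine ⟨by rwa [h1], by rwa [h2], rfl, rfl, fun h => ?_⟩
        obtain ⟨i, hi⟩ := h3 (by omega)
        exact ⟨i + 1, hi⟩)
  refine w1.trans (w2.trans (Walk.trans (w3.symm ?_) w4))
  exact fun m x y ⟨h1, h2, h3⟩ => ⟨h2, h1, fun h => by
    obtain ⟨i, hi1, hi2, hi3⟩ := h3 h; exact ⟨i, hi1, hi3, hi2⟩⟩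

theorem hasFlipWalk [Nonempty ι] (hC : Fintype.card C = Fintype.card ι + 3) {a b : C}
    (hab : a ≠ b) : ∀ {n : ℕ} (t : CTree C ι n), Proper t → root t = a → HasFlipWalk a b t
  | 0, t, _, hr => by
    obtain rfl : t = leaf a := by rw [eq_leaf t, hr]
    refine ⟨leaf b, trivial, rfl, .leaf a b, Walk.single trivial trivial
      (Recolor.root (leaf a) b hab.symm) ⟨⟨.inl rfl, .leaf _ _⟩, ⟨.inr rfl, .leaf _ _⟩,
        fun _ => .zero _⟩, ?_⟩
    simp only [altFlip, Equiv.swap_apply_left]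
    exact Walk.refl _ _
  | 1, .node x s, ht, hr => by
    obtain rfl : x = a := hr
    by_cases hb : ∃ j, root (s j) = b
    · obtain ⟨j, hj⟩ := hb
      exact hasFlipWalk_one hC hab ht hj
    · push Not at hb
      exact hasFlipWalk_of_forall hab ht hb
  | n + 2, .node x s, ht, hr => by
    obtain rfl : x = a := hr
    by_cases hb : ∃ j, root (s j) = b
    · obtain ⟨j, hj⟩ := hb
      obtain ⟨s₁, hs₁⟩ := exists_eq_node (s j)
      rw [hj] at hs₁
      refine hasFlipWalk_step hC hab ht hs₁ fun k hk => hasFlipWalk hC hab (s₁ k) ?_ hk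
      have := ht.2.2 j
      rw [hs₁] at this
      exact this.2.2 k
    · push Not at hb
      exact hasFlipWalk_of_forall hab ht hb

end CTree

end TreeEdgeColoring

/-! ### Counting colorings: probabilities of bad chains and bad windows. -/

namespace TreeEdgeColoring
namespace CTree

variable {C ι : Type} {n : ℕ}

/-- The subtrees below the hanging edge. -/
def kids : {n : ℕ} → CTree C ι (n + 1) → ι → CTree C ι n
  | _, node _ s => s

@[simp] lemma kids_node (c : C) (s : ι → CTree C ι n) : kids (node c s) = s := rfl

lemma node_root_kids (t : CTree C ι (n + 1)) : node (root t) (kids t) = t := by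
  cases t; rfl

def leafEquiv : C ≃ CTree C ι 0 where
  toFun := leaf
  invFun := root
  left_inv _ := rfl
  right_inv t := (eq_leaf t).symm

def nodeEquiv : C × (ι → CTree C ι n) ≃ CTree C ι (n + 1) where
  toFun p := node p.1 p.2
  invFun t := (root t, kids t)
  left_inv _ := rfl
  right_inv t := node_root_kids t

variable [DecidableEq ι] [Fintype C] [DecidableEq C] [Fintype ι]

instance instFintype : ∀ n : ℕ, Fintype (CTree C ι n)
  | 0 => Fintype.ofEquiv C leafEquiv
  | n + 1 =>
    haveI := instFintype n
    Fintype.ofEquiv (C × (ι → CTree C ι n)) nodeEquiv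

open Classical in
/-- The proper colorings whose hanging edge has color `x`. -/
def trees (ι : Type) [DecidableEq ι] [Fintype ι] (n : ℕ) (x : C) : Finset (CTree C ι n) :=
  Finset.univ.filter (fun t => Proper t ∧ root t = x)

open Classical in
/-- The possible colors of the children of an edge of color `x`. -/
def fam (ι : Type) [DecidableEq ι] [Fintype ι] (x : C) : Finset (ι → C) :=
  Finset.univ.filter (fun f => Function.Injective f ∧ ∀ i, f i ≠ x)

open Classical in
/-- The elements of `S` with the property `P`. -/
def sift {α : Type} (S : Finset α) (P : α → Prop) : Finset α := S.filter P

lemma mem_sift {α : Type} {S : Finset α} {P : α → Prop} {x : α} : x ∈ sift S P ↔ x ∈ S ∧ P x := by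
  simp [sift]

lemma sift_subset {α : Type} {S : Finset α} {P : α → Prop} : sift S P ⊆ S :=
  fun _ h => (mem_sift.1 h).1

lemma sift_true {α : Type} (S : Finset α) : sift S (fun _ => True) = S := by
  simp [sift]

lemma sift_eq_empty_iff {α : Type} {S : Finset α} {P : α → Prop} :
    sift S P = ∅ ↔ ∀ x ∈ S, ¬ P x := by
  simp [sift, Finset.filter_eq_empty_iff]

lemma mem_trees {x : C} {t : CTree C ι n} : t ∈ trees ι n x ↔ Proper t ∧ root t = x := by
  simp [trees]

lemma mem_fam {x : C} {f : ι → C} : f ∈ fam ι x ↔ Function.Injective f ∧ ∀ i, f i ≠ x := by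
  simp [fam]

-- Once the colors `f` of the children are fixed, the subtrees range over a product set. This is the
-- conditional independence behind all the probability estimates.
open Classical in
lemma card_trees_node (x : C) (P : CTree C ι (n + 1) → Prop) :
    (sift (trees ι (n + 1) x) P).card = ∑ f ∈ fam ι x,
      (sift (Fintype.piFinset fun i => trees ι n (f i)) (fun s => P (node x s))).card := by
  rw [← Finset.card_sigma]
  refine Finset.card_nbij' (fun t => ⟨fun i => root (kids t i), kids t⟩) (fun p => node x p.2)
    ?_ ?_ ?_ ?_
  · rintro t ht
    simp only [Finset.mem_coe, mem_sift, mem_trees] at ht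
    obtain ⟨⟨hp, hr⟩, hP⟩ := ht
    obtain ⟨s, hs⟩ := exists_eq_node t
    rw [hr] at hs
    subst hs
    simp only [Finset.coe_sigma, Set.mem_sigma_iff, Finset.mem_coe, mem_fam, mem_sift,
      Fintype.mem_piFinset, mem_trees, kids_node]
    exact ⟨⟨hp.2.1, hp.1⟩, fun i => ⟨hp.2.2 i, trivial⟩, hP⟩
  · rintro ⟨f, s⟩ hp
    simp only [Finset.coe_sigma, Set.mem_sigma_iff, Finset.mem_coe, mem_fam, mem_sift,
      Fintype.mem_piFinset, mem_trees] at hp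
    obtain ⟨⟨hf, hfx⟩, hs, hP⟩ := hp
    have hfs : f = fun i => root (s i) := funext fun i => (hs i).2.symm
    subst hfs
    simp only [Finset.mem_coe, mem_sift, mem_trees]
    exact ⟨⟨⟨hfx, hf, fun i => (hs i).1⟩, rfl⟩, hP⟩
  · rintro t ht
    simp only [Finset.mem_coe, mem_sift, mem_trees] at ht
    rw [← ht.1.2]
    exact node_root_kids t
  · rintro ⟨f, s⟩ hp
    simp only [Finset.coe_sigma, Set.mem_sigma_iff, Finset.mem_coe, mem_fam, mem_sift,
      Fintype.mem_piFinset, mem_trees] at hp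
    have hfs : f = fun i => root (s i) := funext fun i => (hp.2.1 i).2.symm
    subst hfs
    rfl

open Classical in
lemma card_injective_mem (S : Finset C) :
    (Finset.univ.filter (fun f : ι → C => Function.Injective f ∧ ∀ i, f i ∈ S)).card =
      S.card.descFactorial (Fintype.card ι) := by
  have h := Fintype.card_embedding_eq (α := ι) (β := S)
  rw [Fintype.card_coe] at h
  rw [← h, ← Fintype.card_subtype]
  refine Fintype.card_congr
    { toFun := fun f => ⟨fun i => ⟨f.1 i, f.2.2 i⟩, fun i j hij => f.2.1 (congrArg Subtype.val hij)⟩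
      invFun := fun g => ⟨fun i => (g i : C), fun i j hij => g.injective (Subtype.ext hij),
        fun i => (g i).2⟩
      left_inv := fun f => rfl
      right_inv := fun g => rfl }

lemma card_fam (hC : Fintype.card C = Fintype.card ι + 3) (x : C) :
    (fam ι x).card = (Fintype.card ι + 2).descFactorial (Fintype.card ι) := by
  classical
  have := card_injective_mem (ι := ι) (Finset.univ.erase x)
  rw [Finset.card_erase_of_mem (Finset.mem_univ _), Finset.card_univ, hC] at this
  rw [fam]
  simpa using this

/-- The probability that a given color appears below an edge of another color. -/
def occ (ι : Type) [Fintype ι] : ℝ := (Fintype.card ι : ℝ) / (Fintype.card ι + 2)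

lemma occ_nonneg : 0 ≤ occ ι := by unfold occ; positivity

lemma occ_le_one : occ ι ≤ 1 := by
  unfold occ
  rw [div_le_one (by positivity)]
  linarith

-- The complement consists of the injections avoiding both `x` and `y`, which make up a fraction `2
-- / (d + 2)` of the injections avoiding `x`.
open Classical in
lemma card_fam_filter (hC : Fintype.card C = Fintype.card ι + 3) {x y : C} (hxy : y ≠ x) :
    (((fam ι x).filter (fun f => ∃ i, f i = y)).card : ℝ) = occ ι * (fam ι x).card := by
  have h1 := Finset.card_filter_add_card_filter_not (s := fam ι x) (fun f => ∃ i, f i = y)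
  have h2 : ((fam ι x).filter (fun f => ¬ ∃ i, f i = y)).card =
      (Fintype.card ι + 1).descFactorial (Fintype.card ι) := by
    have := card_injective_mem (ι := ι) ((Finset.univ.erase x).erase y)
    rw [Finset.card_erase_of_mem (by simp [hxy]), Finset.card_erase_of_mem (Finset.mem_univ _),
      Finset.card_univ, hC] at this
    rw [show Fintype.card ι + 1 = Fintype.card ι + 3 - 1 - 1 by omega, ← this]
    congr 1
    ext f
    simp only [Finset.mem_filter, mem_fam, Finset.mem_univ, true_and, Finset.mem_erase,
      not_exists, and_true]
    exact ⟨fun h => ⟨h.1.1, fun i => ⟨h.2 i, h.1.2 i⟩⟩,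
      fun h => ⟨⟨h.1, fun i => (h.2 i).2⟩, fun i => (h.2 i).1⟩⟩
  have h3 := Nat.succ_descFactorial (Fintype.card ι + 1) (Fintype.card ι)
  rw [show Fintype.card ι + 1 + 1 - Fintype.card ι = 2 by omega] at h3
  rw [h2, card_fam hC] at h1
  rw [card_fam hC]
  have h1' : (((fam ι x).filter (fun f => ∃ i, f i = y)).card : ℝ) +
      ((Fintype.card ι + 1).descFactorial (Fintype.card ι) : ℝ) =
      ((Fintype.card ι + 2).descFactorial (Fintype.card ι) : ℝ) := by exact_mod_cast h1
  have h3' : (2 : ℝ) * ((Fintype.card ι + 2).descFactorial (Fintype.card ι) : ℝ) =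
      ((Fintype.card ι : ℝ) + 2) * ((Fintype.card ι + 1).descFactorial (Fintype.card ι) : ℝ) := by
    exact_mod_cast h3
  rw [occ, div_mul_eq_mul_div, eq_div_iff (by positivity)]
  rw [← eq_sub_iff_add_eq] at h1'
  rw [h1', sub_mul, mul_comm (((Fintype.card ι + 1).descFactorial (Fintype.card ι) : ℕ) : ℝ), ← h3']
  ring

/-- The number of proper colorings with a prescribed color of the hanging edge. -/
def treeCount (d : ℕ) : ℕ → ℕ
  | 0 => 1
  | n + 1 => (d + 2).descFactorial d * treeCount d n ^ d

lemma card_trees (hC : Fintype.card C = Fintype.card ι + 3) :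
    ∀ (n : ℕ) (x : C), (trees ι n x).card = treeCount (Fintype.card ι) n
  | 0, x => by
    rw [treeCount, Finset.card_eq_one]
    refine ⟨leaf x, ?_⟩
    ext t
    rw [mem_trees, Finset.mem_singleton, eq_leaf t]
    constructor
    · rintro ⟨-, h⟩
      rw [← h]; rfl
    · intro h; rw [h]; exact ⟨trivial, rfl⟩
  | n + 1, x => by
    classical
    have h := card_trees_node (ι := ι) (n := n) x (fun _ => True)
    simp only [sift_true] at h
    rw [h, Finset.sum_congr rfl fun f _ => Fintype.card_piFinset _]
    simp only [card_trees hC n, Finset.prod_const, Finset.sum_const, Finset.card_univ,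
      smul_eq_mul, card_fam hC]
    rfl

lemma treeCount_pos (d n : ℕ) : 0 < treeCount d n := by
  induction n with
  | zero => exact Nat.one_pos
  | succ n ih =>
    exact Nat.mul_pos (Nat.descFactorial_pos.2 (by omega)) (pow_pos ih d)

-- One level of the recursion for probabilities: an event that forces the color `y` among the
-- children gains the factor `occ`, and `θ` bounds its conditional probability given the child
-- colors.
open Classical in
lemma card_trees_le (hC : Fintype.card C = Fintype.card ι + 3) (P : CTree C ι (n + 1) → Prop)
    {x y : C} (hxy : y ≠ x) (θ : ℝ)
    (hP : ∀ s, Proper (node x s) → P (node x s) → ∃ i, root (s i) = y)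
    (hθ : ∀ f ∈ fam ι x, ∀ i, f i = y →
      (((sift (Fintype.piFinset fun i => trees ι n (f i)) (fun s => P (node x s))).card : ℕ) : ℝ)
        ≤ θ * (treeCount (Fintype.card ι) n : ℝ) ^ Fintype.card ι) :
    (((sift (trees ι (n + 1) x) P).card : ℕ) : ℝ) ≤
      occ ι * θ * treeCount (Fintype.card ι) (n + 1) := by
  rw [card_trees_node]
  push_cast
  rw [← Finset.sum_filter_add_sum_filter_not (fam ι x) (fun f => ∃ i, f i = y)]
  have h0 : ∑ f ∈ (fam ι x).filter (fun f => ¬ ∃ i, f i = y),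
      (((sift (Fintype.piFinset fun i => trees ι n (f i)) (fun s => P (node x s))).card : ℕ) : ℝ) = 0 := by
    refine Finset.sum_eq_zero fun f hf => ?_
    rw [Nat.cast_eq_zero, Finset.card_eq_zero, sift_eq_empty_iff]
    intro s hs hPs
    rw [Finset.mem_filter, mem_fam] at hf
    rw [Fintype.mem_piFinset] at hs
    simp only [mem_trees] at hs
    obtain rfl : f = fun i => root (s i) := funext fun i => (hs i).2.symm
    exact hf.2 (hP s ⟨hf.1.2, hf.1.1, fun i => (hs i).1⟩ hPs)
  rw [h0, add_zero]
  calc _ ≤ ∑ f ∈ (fam ι x).filter (fun f => ∃ i, f i = y),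
        θ * (treeCount (Fintype.card ι) n : ℝ) ^ Fintype.card ι := by
        refine Finset.sum_le_sum fun f hf => ?_
        rw [Finset.mem_filter] at hf
        obtain ⟨hf, i, hi⟩ := hf
        exact hθ f hf i hi
    _ = _ := by
        rw [Finset.sum_const, nsmul_eq_mul, card_fam_filter hC hxy, card_fam hC]
        simp only [treeCount]
        push_cast
        ring

open Classical in
lemma card_pi_le (f : ι → C)
    (P : (ι → CTree C ι n) → Prop) (E : ι → CTree C ι n → Prop) (θ : ι → ℝ)
    (hP : ∀ s, (∀ i, s i ∈ trees ι n (f i)) → P s → ∀ i, E i (s i))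
    (hE : ∀ i, (((sift (trees ι n (f i)) (E i)).card : ℕ) : ℝ) ≤
      θ i * treeCount (Fintype.card ι) n) :
    (((sift (Fintype.piFinset fun i => trees ι n (f i)) P).card : ℕ) : ℝ) ≤
      (∏ i, θ i) * (treeCount (Fintype.card ι) n : ℝ) ^ Fintype.card ι := by
  have h1 : sift (Fintype.piFinset fun i => trees ι n (f i)) P ⊆
      Fintype.piFinset fun i => sift (trees ι n (f i)) (E i) := by
    intro s hs
    rw [mem_sift, Fintype.mem_piFinset] at hs
    rw [Fintype.mem_piFinset]
    exact fun i => mem_sift.2 ⟨hs.1 i, hP s hs.1 hs.2 i⟩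
  have h2 := Finset.card_le_card h1
  rw [Fintype.card_piFinset] at h2
  calc _ ≤ ((∏ i, (sift (trees ι n (f i)) (E i)).card : ℕ) : ℝ) := by exact_mod_cast h2
    _ ≤ ∏ i, (θ i * treeCount (Fintype.card ι) n) := by
      push_cast
      exact Finset.prod_le_prod (fun i _ => by positivity) (fun i _ => hE i)
    _ = _ := by
      rw [Finset.prod_mul_distrib, Finset.prod_const, Finset.card_univ]

open Classical in
lemma card_pi_le_single (hC : Fintype.card C = Fintype.card ι + 3) (f : ι → C)
    (P : (ι → CTree C ι n) → Prop) (j : ι) (E : CTree C ι n → Prop) (θ : ℝ)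
    (hP : ∀ s, (∀ i, s i ∈ trees ι n (f i)) → P s → E (s j))
    (hE : (((sift (trees ι n (f j)) E).card : ℕ) : ℝ) ≤
      θ * treeCount (Fintype.card ι) n) :
    (((sift (Fintype.piFinset fun i => trees ι n (f i)) P).card : ℕ) : ℝ) ≤
      θ * (treeCount (Fintype.card ι) n : ℝ) ^ Fintype.card ι := by
  have h := card_pi_le f P (fun i t => i = j → E t) (fun i => if i = j then θ else 1)
    (fun s hs hPs i hi => hi ▸ hP s hs hPs) (fun i => by
      by_cases hi : i = j
      · subst hi; simpa using hE
      · simp [hi, card_trees hC, sift_true])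
  rwa [Finset.prod_ite_eq' Finset.univ j (fun _ => θ), if_pos (Finset.mem_univ _)] at h

open Classical in
lemma card_sift_le (hC : Fintype.card C = Fintype.card ι + 3) (x : C) (P : CTree C ι n → Prop) :
    (((sift (trees ι n x) P).card : ℕ) : ℝ) ≤ treeCount (Fintype.card ι) n := by
  rw [← card_trees hC n x]
  exact_mod_cast Finset.card_le_card sift_subset

-- Both `y` and `z` must occur among the children, at two different children, and each of these must
-- be bad for both missing colors. The subtrees are independent, so `v (n + 1) ≤ occ * v n ^ 2`,
-- whose solution has exponent `2 ^ n - 1`. Only the occurrence of `y` is charged; that of `z` is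
-- not needed.
open Classical in
lemma card_bad_bad (hC : Fintype.card C = Fintype.card ι + 3) :
    ∀ (n : ℕ) (x y z : C), y ≠ x → z ≠ x → y ≠ z →
      (((sift (trees ι n x) (fun t => Bad t y ∧ Bad t z)).card : ℕ) : ℝ) ≤
        occ ι ^ (2 ^ n - 1) * treeCount (Fintype.card ι) n
  | 0, x, y, z, _, _, _ => by simpa using card_sift_le (n := 0) hC x _
  | n + 1, x, y, z, hyx, hzx, hyz => by
    set v := occ ι ^ (2 ^ n - 1) with hv
    have hv0 : 0 ≤ v := pow_nonneg occ_nonneg _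
    have hpow : occ ι ^ (2 ^ (n + 1) - 1) = occ ι * (v * v) := by
      rw [hv, ← pow_add, ← pow_succ']
      congr 1
      have : 1 ≤ 2 ^ n := Nat.one_le_two_pow
      rw [pow_succ]; omega
    rw [hpow]
    refine card_trees_le hC _ hyx (v * v) (fun s _ h => ?_) (fun f hf i hi => ?_)
    · obtain ⟨⟨j, hj, -⟩, -⟩ := h
      exact ⟨j, hj⟩
    rw [mem_fam] at hf
    by_cases hz : ∃ k, f k = z
    swap
    · push Not at hz
      have : sift (Fintype.piFinset fun i => trees ι n (f i)) (fun s => Bad (node x s) y ∧ Bad (node x s) z) = ∅ := by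
        rw [sift_eq_empty_iff]
        rintro s hs ⟨-, k, hk, -⟩
        rw [Fintype.mem_piFinset] at hs
        exact hz k (by rw [← hk, (mem_trees.1 (hs k)).2])
      rw [this]
      simp only [Finset.card_empty, Nat.cast_zero]
      positivity
    obtain ⟨k, hk⟩ := hz
    have hik : i ≠ k := by rintro rfl; exact hyz (hi.symm.trans hk)
    obtain ⟨d, e, hde, hfree⟩ := Finset.card_eq_two.1 (card_free hC hf.1 hf.2)
    have hd : d ∈ free x f := by simp [hfree]
    have he : e ∈ free x f := by simp [hfree]
    rw [mem_free] at hd he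
    have h := card_pi_le (n := n) f (fun s => Bad (node x s) y ∧ Bad (node x s) z)
      (fun l t => l = i ∨ l = k → Bad t d ∧ Bad t e)
      (fun l => (if l = i then v else 1) * (if l = k then v else 1)) ?_ ?_
    · rwa [Finset.prod_mul_distrib, Finset.prod_ite_eq' Finset.univ i (fun _ => v),
        Finset.prod_ite_eq' Finset.univ k (fun _ => v), if_pos (Finset.mem_univ _),
        if_pos (Finset.mem_univ _)] at h
    · rintro s hs ⟨⟨j, hj, hj'⟩, ⟨j', hj₂, hk'⟩⟩ l hl
      obtain rfl : f = fun i => root (s i) := funext fun i => (mem_trees.1 (hs i)).2.symm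
      obtain rfl : j = i := hf.1 (hj.trans hi.symm)
      obtain rfl : j' = k := hf.1 (hj₂.trans hk.symm)
      have hdm : d ∈ free x (fun i => root (s i)) := by rw [hfree]; simp
      have hem : e ∈ free x (fun i => root (s i)) := by rw [hfree]; simp
      rcases hl with rfl | rfl
      · exact ⟨hj' d hdm, hj' e hem⟩
      · exact ⟨hk' d hdm, hk' e hem⟩
    · intro l
      have ih := card_bad_bad hC n (f l) d e (hd.2 l) (he.2 l) hde
      by_cases hli : l = i
      · subst hli
        simpa [hik] using ih
      · by_cases hlk : l = k
        · subst hlk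
          simpa [hli] using ih
        · simp [hli, hlk, card_trees hC, sift_true]

-- Badness for a single color only gives one child, but that child is bad for two colors, so the
-- doubling starts one level down.
open Classical in
lemma card_bad (hC : Fintype.card C = Fintype.card ι + 3) :
    ∀ (n : ℕ) (x y : C), y ≠ x →
      (((sift (trees ι n x) (fun t => Bad t y)).card : ℕ) : ℝ) ≤
        occ ι ^ (2 ^ (n - 1) - 1) * treeCount (Fintype.card ι) n
  | 0, x, y, _ => by simpa using card_sift_le (n := 0) hC x _
  | n + 1, x, y, hyx => by
    rw [Nat.add_sub_cancel]
    set v := occ ι ^ (2 ^ n - 1) with hv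
    have hv0 : 0 ≤ v := pow_nonneg occ_nonneg _
    refine (card_trees_le hC _ hyx v (fun s _ h => ?_) (fun f hf i hi => ?_)).trans ?_
    · obtain ⟨j, hj, -⟩ := h
      exact ⟨j, hj⟩
    · rw [mem_fam] at hf
      obtain ⟨d, e, hde, hfree⟩ := Finset.card_eq_two.1 (card_free hC hf.1 hf.2)
      have hd : d ∈ free x f := by simp [hfree]
      have he : e ∈ free x f := by simp [hfree]
      rw [mem_free] at hd he
      refine card_pi_le_single hC f _ i (fun t => Bad t d ∧ Bad t e) v ?_
        (card_bad_bad hC n (f i) d e (hd.2 i) (he.2 i) hde)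
      rintro s hs ⟨j, hj, hj'⟩
      obtain rfl : f = fun i => root (s i) := funext fun i => (mem_trees.1 (hs i)).2.symm
      obtain rfl : j = i := hf.1 (hj.trans hi.symm)
      exact ⟨hj' d (by rw [hfree]; simp), hj' e (by rw [hfree]; simp)⟩
    · refine mul_le_mul_of_nonneg_right ?_ (by positivity)
      exact mul_le_of_le_one_left hv0 occ_le_one

lemma occ_mul_le {θ : ℝ} (h : 0 ≤ θ) : occ ι * θ ≤ θ := mul_le_of_le_one_left h occ_le_one

-- A bad start needs a bad subtree two levels down, whose probability has exponent `2 ^ (n - 2 - 1)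
-- - 1`. For depth at most 1 the truncated exponent is 0 and the bound is trivial.
open Classical in
lemma card_startBad (hC : Fintype.card C = Fintype.card ι + 3) {a b : C} (hab : a ≠ b) :
    ∀ n : ℕ, (((sift (trees ι n a) (fun t => StartBad a b t)).card : ℕ) : ℝ) ≤
        occ ι ^ (2 ^ (n - 3) - 1) * treeCount (Fintype.card ι) n
  | 0 => by simpa using card_sift_le (n := 0) hC a _
  | 1 => by simpa using card_sift_le (n := 1) hC a _
  | n + 2 => by
    rw [show n + 2 - 3 = n - 1 by omega]
    set v := occ ι ^ (2 ^ (n - 1) - 1) with hv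
    have hv0 : 0 ≤ v := pow_nonneg occ_nonneg _
    refine (card_trees_le hC _ hab.symm v (fun s _ h => ?_) (fun f hf i hi => ?_)).trans
      (mul_le_mul_of_nonneg_right (occ_mul_le hv0) (by positivity))
    · cases h with
      | step s s' j h hj hh hb => exact ⟨j, by rw [hj]; rfl⟩
    rw [mem_fam] at hf
    have hcm := parkColor_mem hC hf.1 hf.2
    obtain ⟨c, hc⟩ : ∃ c, c = parkColor a f := ⟨_, rfl⟩
    rw [← hc, mem_free] at hcm
    have hcb : c ≠ b := by rw [← hi]; exact hcm.2 i
    refine card_pi_le_single hC f _ i (fun t => ∃ h, root (kids t h) = c ∧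
      Bad (kids t h) (chainColor a b (fun l => root (kids t l)))) v ?_ ?_
    · rintro s hs h
      obtain rfl : f = fun i => root (s i) := funext fun i => (mem_trees.1 (hs i)).2.symm
      cases h with
      | step s s' j h hj hh hb =>
        obtain rfl : j = i := hf.1 (by simp only [hj, root_node, hi])
        rw [hj]
        exact ⟨h, by rw [hc]; exact hh, hb⟩
    · rw [hi]
      refine (card_trees_le hC _ hcb v (fun s _ h => ?_) (fun g hg k hk => ?_)).trans
        (mul_le_mul_of_nonneg_right (occ_mul_le hv0) (by positivity))
      · obtain ⟨h, hh, -⟩ := h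
        exact ⟨h, hh⟩
      rw [mem_fam] at hg
      have hdm := chainColor_mem hC a hg.1 hg.2
      obtain ⟨d, hd⟩ : ∃ d, d = chainColor a b g := ⟨_, rfl⟩
      rw [← hd, Finset.mem_erase, mem_free] at hdm
      refine card_pi_le_single hC g _ k (fun t => Bad t d) v ?_
        (card_bad hC n (g k) d (hdm.2.2 k))
      rintro s hs ⟨h, hh, hb⟩
      obtain rfl : g = fun i => root (s i) := funext fun i => (mem_trees.1 (hs i)).2.symm
      obtain rfl : h = k := hg.1 (hh.trans hk.symm)
      rw [hd]
      exact hb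

-- The path continues for two more edges only if `b` occurs below `a` and then `a` below `b`; each
-- occurrence costs a factor `occ`.
open Classical in
lemma card_next (hC : Fintype.card C = Fintype.card ι + 3) {a b : C} (hab : a ≠ b)
    (R : CTree C ι n → Prop) (θ : ℝ)
    (hR : (((sift (trees ι n a) R).card : ℕ) : ℝ) ≤ θ * treeCount (Fintype.card ι) n) :
    (((sift (trees ι (n + 2) a) (fun t => ∃ u, Next a b t u ∧ R u)).card : ℕ) : ℝ) ≤
        occ ι ^ 2 * θ * treeCount (Fintype.card ι) (n + 2) := by
  rw [sq, mul_assoc (occ ι)]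
  refine card_trees_le hC _ hab.symm _ (fun s _ h => ?_) (fun f hf i hi => ?_)
  · obtain ⟨u, h, -⟩ := h
    cases h with
    | mk s s' j k hj hk => exact ⟨j, by rw [hj]; rfl⟩
  rw [mem_fam] at hf
  refine card_pi_le_single hC f _ i (fun t => ∃ k, root (kids t k) = a ∧ R (kids t k)) _ ?_ ?_
  · rintro s hs ⟨u, h, hu⟩
    obtain rfl : f = fun i => root (s i) := funext fun i => (mem_trees.1 (hs i)).2.symm
    cases h with
    | mk s s' j k hj hk =>
      obtain rfl : j = i := hf.1 (by simp only [hj, root_node, hi])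
      rw [hj]
      exact ⟨k, hk, hu⟩
  · rw [hi]
    refine card_trees_le hC _ hab θ (fun s _ h => ?_) (fun g hg k hk => ?_)
    · obtain ⟨k, hk, -⟩ := h
      exact ⟨k, hk⟩
    rw [mem_fam] at hg
    refine card_pi_le_single hC g _ k R θ ?_ (by rwa [hk])
    rintro s hs ⟨h, hh, hb⟩
    obtain rfl : g = fun i => root (s i) := funext fun i => (mem_trees.1 (hs i)).2.symm
    obtain rfl : h = k := hg.1 (hh.trans hk.symm)
    exact hb

lemma WindowBad.le {a b : C} {i n : ℕ} {t : CTree C ι n} (h : WindowBad a b i t) : 2 * i ≤ n := by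
  induction h with
  | start h => omega
  | next h hu => omega
  | succ h hu ih => omega

-- Each unit of `i` costs two further path edges. At index 0 the union bound over a bad start here
-- and a bad start two levels down gives the factor 2, and the latter shifts the 3 of
-- `card_startBad` to 5.
open Classical in
lemma card_windowBad (hC : Fintype.card C = Fintype.card ι + 3) {a b : C} (hab : a ≠ b) :
    ∀ i n : ℕ, (((sift (trees ι n a) (fun t => WindowBad a b i t)).card : ℕ) : ℝ) ≤
        occ ι ^ (2 * i) * (2 * occ ι ^ (2 ^ (n - 2 * i - 5) - 1)) * treeCount (Fintype.card ι) n
  | 0, n => by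
    have h1 := card_startBad hC hab n
    have hmono : occ ι ^ (2 ^ (n - 3) - 1) ≤ occ ι ^ (2 ^ (n - 5) - 1) := by
      refine pow_le_pow_of_le_one occ_nonneg occ_le_one ?_
      have : 2 ^ (n - 5) ≤ 2 ^ (n - 3) := Nat.pow_le_pow_right (by norm_num) (by omega)
      omega
    have h0 : 0 ≤ occ ι ^ (2 ^ (n - 5) - 1) := pow_nonneg occ_nonneg _
    simp only [mul_zero, pow_zero, one_mul, Nat.sub_zero]
    have hZ : (0 : ℝ) ≤ treeCount (Fintype.card ι) n := by positivity
    match n with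
    | 0 => exact (card_sift_le hC a _).trans (by simp; linarith)
    | 1 => exact (card_sift_le hC a _).trans (by simp; linarith)
    | m + 2 =>
      have h2 := card_next hC hab (fun u => StartBad a b u) _ (card_startBad hC hab m)
      have h3 : sift (trees ι (m + 2) a) (fun t => WindowBad a b 0 t) ⊆
          sift (trees ι (m + 2) a) (fun t => StartBad a b t) ∪
          sift (trees ι (m + 2) a) (fun t => ∃ u, Next a b t u ∧ StartBad a b u) := by
        intro t ht
        rw [mem_sift] at ht
        rw [Finset.mem_union, mem_sift, mem_sift]
        obtain ⟨ht, hw⟩ := ht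
        cases hw with
        | start h => exact .inl ⟨ht, h⟩
        | next h hu => exact .inr ⟨ht, _, h, hu⟩
      have h4 := (Finset.card_le_card h3).trans (Finset.card_union_le _ _)
      have h4' : (((sift (trees ι (m + 2) a) (fun t => WindowBad a b 0 t)).card : ℕ) : ℝ) ≤
          (((sift (trees ι (m + 2) a) (fun t => StartBad a b t)).card : ℕ) : ℝ) +
          (((sift (trees ι (m + 2) a) (fun t => ∃ u, Next a b t u ∧ StartBad a b u)).card : ℕ) :
            ℝ) := by exact_mod_cast h4
      rw [show m + 2 - 5 = m - 3 by omega] at h0 hmono ⊢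
      have h5 : occ ι ^ 2 * occ ι ^ (2 ^ (m - 3) - 1) ≤ occ ι ^ (2 ^ (m - 3) - 1) :=
        mul_le_of_le_one_left h0 (pow_le_one₀ occ_nonneg occ_le_one)
      nlinarith [mul_le_mul_of_nonneg_right h5 hZ, mul_le_mul_of_nonneg_right hmono hZ]
  | i + 1, 0 => by
    rw [sift_eq_empty_iff.2 (fun t _ h => by have := h.le; omega)]
    simp only [Finset.card_empty, Nat.cast_zero]
    have := occ_nonneg (ι := ι)
    positivity
  | i + 1, 1 => by
    rw [sift_eq_empty_iff.2 (fun t _ h => by have := h.le; omega)]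
    simp only [Finset.card_empty, Nat.cast_zero]
    have := occ_nonneg (ι := ι)
    positivity
  | i + 1, m + 2 => by
    have h2 := card_next hC hab (fun u => WindowBad a b i u) _ (card_windowBad hC hab i m)
    have h3 : sift (trees ι (m + 2) a) (fun t => WindowBad a b (i + 1) t) ⊆
        sift (trees ι (m + 2) a) (fun t => ∃ u, Next a b t u ∧ WindowBad a b i u) := by
      intro t ht
      rw [mem_sift] at ht ⊢
      obtain ⟨ht, hw⟩ := ht
      cases hw with
      | succ h hu => exact ⟨ht, _, h, hu⟩
    refine le_trans (by exact_mod_cast Finset.card_le_card h3) (h2.trans (le_of_eq ?_))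
    rw [show m + 2 - 2 * (i + 1) = m - 2 * i by omega, show 2 * (i + 1) = 2 + 2 * i by ring,
      pow_add]
    ring

/-! ### The number of colorings in a window -/

-- At each level above the leaves one chooses the new color and the next child, at most `q ^ 2`
-- possibilities.
open Classical in
lemma card_one (hC : Fintype.card C = Fintype.card ι + 3) :
    ∀ {n : ℕ} (u : CTree C ι n), (sift Finset.univ (fun t => One t u)).card ≤
      Fintype.card C ^ (2 * (n + 1))
  | 0, u => by
    refine (Finset.card_le_univ _).trans ?_
    rw [Fintype.card_congr (leafEquiv (C := C) (ι := ι)).symm]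
    exact Nat.le_self_pow (by norm_num) _
  | n + 1, .node c s => by
    have h1 : sift Finset.univ (fun t => One t (node c s)) ⊆
        (Finset.univ : Finset (C × ι)).biUnion (fun p =>
          (sift Finset.univ (fun t => One t (s p.2))).image
            (fun t => node p.1 (Function.update s p.2 t))) := by
      intro t ht
      rw [mem_sift] at ht
      have h2 := ht.2.symm
      cases h2 with
      | node c c' s j u h =>
        rw [Finset.mem_biUnion]
        refine ⟨(c', j), Finset.mem_univ _, ?_⟩
        rw [Finset.mem_image]
        exact ⟨u, mem_sift.2 ⟨Finset.mem_univ _, h.symm⟩, rfl⟩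
    refine (Finset.card_le_card h1).trans (Finset.card_biUnion_le.trans ?_)
    refine (Finset.sum_le_sum fun p _ => Finset.card_image_le.trans (card_one hC (s p.2))).trans ?_
    rw [Finset.sum_const, smul_eq_mul, Finset.card_univ, Fintype.card_prod]
    calc Fintype.card C * Fintype.card ι * Fintype.card C ^ (2 * (n + 1))
        ≤ Fintype.card C * Fintype.card C * Fintype.card C ^ (2 * (n + 1)) := by
          gcongr; omega
      _ = Fintype.card C ^ (2 * (n + 1 + 1)) := by ring

open Classical in
lemma card_two (hC : Fintype.card C = Fintype.card ι + 3) (u : CTree C ι n) :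
    (sift Finset.univ (fun t => Two t u)).card ≤ Fintype.card C ^ (4 * (n + 1)) := by
  have h1 : sift Finset.univ (fun t => Two t u) ⊆
      (sift Finset.univ (fun t => One t u)).biUnion
        (fun v => sift Finset.univ (fun t => One t v)) := by
    intro t ht
    rw [mem_sift] at ht
    obtain ⟨-, v, h1, h2⟩ := ht
    rw [Finset.mem_biUnion]
    exact ⟨v, mem_sift.2 ⟨Finset.mem_univ _, h2⟩,
      mem_sift.2 ⟨Finset.mem_univ _, h1⟩⟩
  refine (Finset.card_le_card h1).trans (Finset.card_biUnion_le.trans ?_)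
  refine (Finset.sum_le_sum fun v _ => card_one hC v).trans ?_
  rw [Finset.sum_const, smul_eq_mul]
  refine (Nat.mul_le_mul_right _ (card_one hC u)).trans (le_of_eq ?_)
  rw [← pow_add]; ring_nf

-- The flipped initial segment costs nothing: by properness its edges are recognizable in `u` as the
-- unique children of the prescribed colors, so flipping them back leaves only the subtree of height
-- `n - 2 i` undetermined.
open Classical in
lemma card_window (hC : Fintype.card C = Fintype.card ι + 3) (a b : C) :
    ∀ (i : ℕ) {n : ℕ} (u : CTree C ι n), Proper u →
      (sift Finset.univ (fun t => Window a b i t u)).card ≤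
        Fintype.card C ^ (4 * (n - 2 * i + 1))
  | 0, n, u, _ => by
    refine le_trans (Finset.card_le_card ?_) (card_two hC u)
    intro t ht
    rw [mem_sift] at ht ⊢
    cases ht.2 with
    | zero h => exact ⟨ht.1, h⟩
  | i + 1, n, u, hu => by
    by_cases hne : (sift Finset.univ (fun t => Window a b (i + 1) t u)) = ∅
    · rw [hne]; simp
    obtain ⟨t, ht⟩ := Finset.nonempty_iff_ne_empty.2 hne
    rw [mem_sift] at ht
    cases ht.2 with
    | @succ i m s s' j k u2 hj hk hu2 h =>
      have hu' := hu.2.2 j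
      rw [Function.update_self] at hu'
      have hu2' := hu'.2.2 k
      rw [Function.update_self] at hu2'
      rw [show m + 2 - 2 * (i + 1) = m - 2 * i by omega]
      refine le_trans (Finset.card_le_card (t := (Finset.univ.filter
        (fun t => Window a b i t u2)).image (fun t => node a (Function.update s j
          (node b (Function.update s' k t))))) ?_)
        (Finset.card_image_le.trans (card_window hC a b i u2 hu2'))
      intro t' ht'
      rw [mem_sift] at ht'
      rw [Finset.mem_image]
      obtain ⟨-, hw⟩ := ht'
      obtain ⟨u₀, hu₀⟩ : ∃ u₀, u₀ = node b (Function.update s j (node a (Function.update s' k u2))) :=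
        ⟨_, rfl⟩
      rw [← hu₀] at hw
      cases hw with
      | succ r r' j' k' v hj' hk' hv h' =>
        have e1 := (congrArg kids hu₀ :)
        simp only [kids_node] at e1
        -- Both are the child of color `a` in the proper coloring `u`.
        have hjj : j' = j := by
          apply hu.2.1
          have := (congrFun e1 j').symm
          simp only [Function.update_self] at this
          simp only [this, root_node, Function.update_self]
        subst hjj
        have e2 := congrFun e1 j'
        simp only [Function.update_self, node.injEq, true_and] at e2
        have hkk : k' = k := by
          apply hu'.2.1
          have := (congrFun e2 k').symm
          simp only [Function.update_self] at this
          simp only [this, Function.update_self, hu2, hv]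
        subst hkk
        have e3 := congrFun e2 k'
        simp only [Function.update_self] at e3
        subst e3
        refine ⟨r' k', mem_sift.2 ⟨Finset.mem_univ _, h'⟩, ?_⟩
        congr 1
        funext l
        by_cases hl : l = j'
        · subst hl
          rw [Function.update_self, hj']
          congr 1
          funext l'
          by_cases hl' : l' = k'
          · subst hl'; simp
          · have := congrFun e2 l'
            simp only [ne_eq, hl', not_false_eq_true, Function.update_of_ne] at this ⊢
            exact this.symm
        · have := congrFun e1 l
          simp only [ne_eq, hl, not_false_eq_true, Function.update_of_ne] at this ⊢
          exact this.symm

end CTree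

end TreeEdgeColoring

/-! ### Connectivity of the set of proper colorings. -/

namespace TreeEdgeColoring
namespace CTree

variable {C ι κ : Type} {n : ℕ} [DecidableEq ι] [Fintype C] [DecidableEq C] [Fintype ι]
  [DecidableEq κ] [Fintype κ]

/-- Proper colorings of a family of trees whose hanging edges share a vertex, and have no colors in
`D`. -/
def ForestProper (D : Finset C) (F : κ → CTree C ι n) : Prop :=
  Function.Injective (fun i => root (F i)) ∧ (∀ i, root (F i) ∉ D) ∧ ∀ i, Proper (F i)

/-- One edge of the family is recolored. -/
def ForestMove (D : Finset C) (F F' : κ → CTree C ι n) : Prop :=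
  ForestProper D F ∧ ForestProper D F' ∧
    ∃ i u m, F' = Function.update F i u ∧ Recolor m (F i) u

lemma ForestProper.update {D : Finset C} {F : κ → CTree C ι n} (h : ForestProper D F) {i : κ}
    {u : CTree C ι n} (hu : Proper u) (hD : root u ∉ D) (hi : ∀ j, j ≠ i → root u ≠ root (F j)) :
    ForestProper D (Function.update F i u) := by
  refine ⟨fun j k hjk => ?_, fun j => ?_, fun j => ?_⟩
  · by_cases hj : j = i <;> by_cases hk : k = i
    · rw [hj, hk]
    · subst hj
      simp only [Function.update_self, ne_eq, hk, not_false_eq_true, Function.update_of_ne] at hjk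
      exact absurd hjk (hi k hk)
    · subst hk
      simp only [Function.update_self, ne_eq, hj, not_false_eq_true, Function.update_of_ne] at hjk
      exact absurd hjk.symm (hi j hj)
    · simp only [ne_eq, hj, hk, not_false_eq_true, Function.update_of_ne] at hjk
      exact h.1 hjk
  · by_cases hj : j = i
    · subst hj; simpa using hD
    · simpa [hj] using h.2.1 j
  · by_cases hj : j = i
    · subst hj; simpa using hu
    · simpa [hj] using h.2.2 j

/-- While a walk keeps the root color of its tree, the other members of the family cannot be
violated. -/
lemma Walk.lift_forest {P : ℕ → CTree C ι n → CTree C ι n → Prop} {D : Finset C}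
    {F : κ → CTree C ι n} {i : κ} {u v : CTree C ι n} (hw : Walk P u v) (h : ForestProper D F)
    (hP : ∀ m x y, P m x y → root x = root (F i) ∧ root y = root (F i)) :
    Relation.ReflTransGen (ForestMove D) (Function.update F i u) (Function.update F i v) := by
  have key : ∀ x, Proper x → root x = root (F i) → ForestProper D (Function.update F i x) :=
    fun x hx hr => h.update hx (by rw [hr]; exact h.2.1 i)
      (fun j hj => by rw [hr]; exact fun e => hj (h.1 e).symm)
  refine Relation.ReflTransGen.lift (r := Move P) (p := ForestMove D)
    (fun x => Function.update F i x) ?_ _ _ hw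
  rintro x y ⟨hx, hy, m, hr, hp⟩
  obtain ⟨h1, h2⟩ := hP m x y hp
  exact ⟨key x hx h1, key y hy h2, i, y, m, by simp, by simpa using hr⟩

lemma exists_forest_setRoot [Nonempty ι] (hC : Fintype.card C = Fintype.card ι + 3)
    {D : Finset C} {F : κ → CTree C ι n} (h : ForestProper D F) (i : κ) {x : C} (hx : x ∉ D)
    (hF : ∀ j, x ≠ root (F j)) :
    ∃ u, root u = x ∧ ForestProper D (Function.update F i u) ∧
      Relation.ReflTransGen (ForestMove D) F (Function.update F i u) := by
  obtain ⟨u, hu, hur, hux, -, hw⟩ := exists_shift hC (F i) x (h.2.2 i) (hF i)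
  have h1 := hw.lift_forest (i := i) h (fun m y z hyz => ⟨hyz.1.1, hyz.2.1.1⟩)
  rw [Function.update_eq_self] at h1
  have hp1 : ForestProper D (Function.update F i u) :=
    h.update hu (by rw [hur]; exact h.2.1 i) (fun j hj => by rw [hur]; exact fun e => hj (h.1 e).symm)
  have hp2 : ForestProper D (Function.update F i (setRoot x u)) :=
    h.update hux (by rwa [root_setRoot]) (fun j _ => by rw [root_setRoot]; exact hF j)
  refine ⟨setRoot x u, root_setRoot _ _, hp2, h1.tail ⟨hp1, hp2, i, setRoot x u, 0, by simp, ?_⟩⟩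
  rw [Function.update_self]
  exact Recolor.root u x (by rw [hur]; exact hF i)

/-- Root colors are corrected one at a time. If the target color of `i` is held by another tree `k`,
then `k` is first moved to a spare color, which exists by `hD`; `k` was already wrong because `g` is
injective, so the number of wrong roots still drops. -/
lemma exists_forest_roots [Nonempty ι] (hC : Fintype.card C = Fintype.card ι + 3)
    {D : Finset C} (hD : Fintype.card κ + D.card < Fintype.card C) {g : κ → C}
    (hg : Function.Injective g) (hgD : ∀ i, g i ∉ D) (N : ℕ) :
    ∀ F : κ → CTree C ι n, ForestProper D F →
      (Finset.univ.filter (fun i => root (F i) ≠ g i)).card = N →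
      ∃ F', ForestProper D F' ∧ (∀ i, root (F' i) = g i) ∧
        Relation.ReflTransGen (ForestMove D) F F' := by
  induction N using Nat.strong_induction_on with
  | _ N ih =>
  intro F hF hN
  by_cases hall : ∀ i, root (F i) = g i
  · exact ⟨F, hF, hall, .refl⟩
  push Not at hall
  obtain ⟨i, hi⟩ := hall
  by_cases hy : ∃ k, root (F k) = g i
  · obtain ⟨k, hk⟩ := hy
    have hki : k ≠ i := by rintro rfl; exact hi hk
    obtain ⟨z, hz⟩ : ∃ z, z ∉ D ∪ Finset.univ.image (fun j => root (F j)) := by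
      by_contra! hcon
      have h1 : (D ∪ Finset.univ.image (fun j => root (F j))).card = Fintype.card C := by
        rw [← Finset.card_univ]; congr 1; ext z; simp only [hcon z, Finset.mem_univ]
      have h2 := Finset.card_union_le D (Finset.univ.image (fun j => root (F j)))
      have h3 : (Finset.univ.image (fun j => root (F j))).card ≤ Fintype.card κ :=
        Finset.card_image_le
      omega
    rw [Finset.mem_union, not_or] at hz
    have hz2 : ∀ j, z ≠ root (F j) := by
      intro j hj
      exact hz.2 (Finset.mem_image.2 ⟨j, Finset.mem_univ _, hj.symm⟩)
    obtain ⟨u, hu, hpu, hwu⟩ := exists_forest_setRoot hC hF k hz.1 hz2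
    obtain ⟨v, hv, hpv, hwv⟩ := exists_forest_setRoot hC hpu i (hgD i) (fun j => by
      by_cases hjk : j = k
      · subst hjk
        rw [Function.update_self, hu, ← hk]
        exact (hz2 j).symm
      · rw [Function.update_of_ne hjk]
        exact fun e => hjk (hF.1 (e.symm.trans hk.symm)))
    suffices hlt : (Finset.univ.filter (fun j => root (Function.update (Function.update F k u) i v j)
        ≠ g j)).card < N by
      obtain ⟨F', h1, h2, h3⟩ := ih _ hlt _ hpv rfl
      exact ⟨F', h1, h2, (hwu.trans hwv).trans h3⟩
    rw [← hN]
    refine Finset.card_lt_card (Finset.ssubset_iff_of_subset ?_ |>.2 ⟨i, by simpa using hi, ?_⟩)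
    · intro j hj
      rw [Finset.mem_filter] at hj ⊢
      refine ⟨hj.1, ?_⟩
      by_cases hji : j = i
      · subst hji; exact hi
      by_cases hjk : j = k
      · subst hjk
        rw [hk]
        exact fun e => hji (hg e).symm
      · simpa [hji, hjk] using hj.2
    · simp [hv]
  · push Not at hy
    obtain ⟨v, hv, hpv, hwv⟩ := exists_forest_setRoot hC hF i (hgD i) (fun j => (hy j).symm)
    suffices hlt : (Finset.univ.filter (fun j => root (Function.update F i v j) ≠ g j)).card < N by
      obtain ⟨F', h1, h2, h3⟩ := ih _ hlt _ hpv rfl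
      exact ⟨F', h1, h2, hwv.trans h3⟩
    rw [← hN]
    refine Finset.card_lt_card (Finset.ssubset_iff_of_subset ?_ |>.2 ⟨i, by simpa using hi, ?_⟩)
    · intro j hj
      rw [Finset.mem_filter] at hj ⊢
      refine ⟨hj.1, ?_⟩
      by_cases hji : j = i
      · subst hji; exact hi
      · simpa [hji] using hj.2
    · simp [hv]

/-- The walks that keep the color of the hanging edge. -/
def Pinned (c : C) (_ : ℕ) (u v : CTree C ι n) : Prop := root u = c ∧ root v = c

/-- With equal root colors the trees do not interact and can be exchanged one after another; the set
`S` records those already exchanged. -/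
lemma forest_connected_of_roots {D : Finset C}
    (hconn : ∀ t u : CTree C ι n, Proper t → Proper u → root t = root u →
      Walk (Pinned (root t)) t u)
    {F F' : κ → CTree C ι n} (hF : ForestProper D F) (hF' : ForestProper D F')
    (hr : ∀ i, root (F i) = root (F' i)) : Relation.ReflTransGen (ForestMove D) F F' := by
  have key : ∀ S : Finset κ, Relation.ReflTransGen (ForestMove D) F
      (fun i => if i ∈ S then F' i else F i) := by
    intro S
    induction S using Finset.induction_on with
    | empty => simpa using Relation.ReflTransGen.refl
    | insert i S hi ih =>
      have hroot : ∀ j, root (if j ∈ S then F' j else F j) = root (F j) := by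
        intro j; split_ifs
        · exact (hr j).symm
        · rfl
      have hp : ForestProper D (fun i => if i ∈ S then F' i else F i) := by
        refine ⟨fun j k hjk => hF.1 ?_, fun j => ?_, fun j => ?_⟩
        · simpa only [hroot] using hjk
        · simpa only [hroot] using hF.2.1 j
        · dsimp only
          split_ifs
          · exact hF'.2.2 j
          · exact hF.2.2 j
      have h1 := (hconn (F i) (F' i) (hF.2.2 i) (hF'.2.2 i) (hr i)).lift_forest (i := i) hp
        (fun m x y hxy => by simp only [hroot]; exact hxy)
      convert ih.trans (b := fun j => if j ∈ S then F' j else F j) ?_ using 1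
      convert h1 using 1
      · funext j
        by_cases hj : j = i
        · subst hj; simp [hi]
        · simp [hj]
      · funext j
        by_cases hj : j = i
        · subst hj; simp
        · simp [hj]
  simpa using key Finset.univ

lemma forest_connected_of_trees [Nonempty ι] (hC : Fintype.card C = Fintype.card ι + 3)
    {D : Finset C} (hD : Fintype.card κ + D.card < Fintype.card C)
    (hconn : ∀ t u : CTree C ι n, Proper t → Proper u → root t = root u →
      Walk (Pinned (root t)) t u)
    {F F' : κ → CTree C ι n} (hF : ForestProper D F) (hF' : ForestProper D F') :
    Relation.ReflTransGen (ForestMove D) F F' := by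
  obtain ⟨G, hG, hr, hw⟩ := exists_forest_roots hC hD hF'.1 hF'.2.1 _ F hF rfl
  exact hw.trans (forest_connected_of_roots hconn hG hF' hr)

/-- The subtrees below the hanging edge form a family that avoids its color, so the claim reduces to
smaller trees through families. -/
theorem tree_connected [Nonempty ι] (hC : Fintype.card C = Fintype.card ι + 3) :
    ∀ {n : ℕ} (t u : CTree C ι n), Proper t → Proper u → root t = root u →
      Walk (Pinned (root t)) t u
  | 0, t, u, _, _, h => by
    rw [eq_leaf t, eq_leaf u, h]; exact Walk.refl _ _
  | n + 1, .node c s, .node c' s', ht, hu, h => by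
    obtain rfl : c = c' := h
    have conv : ∀ r : ι → CTree C ι n, ForestProper {c} r ↔ Proper (node c r) := by
      intro r
      rw [ForestProper, proper_node]
      simp only [Finset.mem_singleton]
      tauto
    have h1 := forest_connected_of_trees (D := {c}) hC (by rw [hC, Finset.card_singleton]; omega)
      (tree_connected hC (n := n)) ((conv s).2 ht) ((conv s').2 hu)
    refine Relation.ReflTransGen.lift (r := ForestMove {c}) (p := Move (Pinned c))
      (fun r => node c r) ?_ _ _ h1
    rintro r r' ⟨hr, hr', i, v, m, rfl, hm⟩
    exact ⟨(conv _).1 hr, (conv _).1 hr', m + 1, Recolor.kid c r i v hm, rfl, rfl⟩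

theorem forest_connected [Nonempty ι] (hC : Fintype.card C = Fintype.card ι + 3)
    {D : Finset C} (hD : Fintype.card κ + D.card < Fintype.card C)
    {F F' : κ → CTree C ι n} (hF : ForestProper D F) (hF' : ForestProper D F') :
    Relation.ReflTransGen (ForestMove D) F F' :=
  forest_connected_of_trees hC hD (tree_connected hC) hF hF'

end CTree

end TreeEdgeColoring

namespace TreeEdgeColoring

/-! ### Variances of uniform distributions -/

lemma prob_of_mem {X : Type} {Ω : Finset X} {x : X} (h : x ∈ Ω) : prob Ω x = 1 / (Ω.card : ℝ) := by
  simp [prob, h]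

lemma prob_of_notMem {X : Type} {Ω : Finset X} {x : X} (h : x ∉ Ω) : prob Ω x = 0 := by
  simp [prob, h]

lemma prob_nonneg {X : Type} (Ω : Finset X) (x : X) : 0 ≤ prob Ω x := by
  unfold prob; split_ifs <;> positivity

lemma mean_nonneg {X : Type} {Ω : Finset X} {f : X → ℝ} (h : ∀ x ∈ Ω, 0 ≤ f x) : 0 ≤ mean Ω f :=
  div_nonneg (Finset.sum_nonneg h) (by positivity)

lemma variance_nonneg {X : Type} (Ω : Finset X) (f : X → ℝ) : 0 ≤ variance Ω f :=
  mean_nonneg fun _ _ => sq_nonneg _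

lemma sum_prob_mul {X : Type} [Fintype X] (Ω : Finset X) (f : X → ℝ) :
    ∑ x, prob Ω x * f x = mean Ω f := by
  classical
  rw [mean, ← Finset.sum_subset (Finset.subset_univ Ω), Finset.sum_div]
  · exact Finset.sum_congr rfl fun x hx => by rw [prob_of_mem hx]; ring
  · intro x _ hx; rw [prob_of_notMem hx, zero_mul]

/-- In the form of squared differences over pairs, variances can be compared directly with sums over
recoloring steps. -/
lemma variance_eq {X : Type} (Ω : Finset X) (f : X → ℝ) :
    variance Ω f = (∑ x ∈ Ω, ∑ y ∈ Ω, (f x - f y) ^ 2) / (2 * (Ω.card : ℝ) ^ 2) := by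
  rcases Ω.eq_empty_or_nonempty with rfl | hne
  · simp [variance, mean]
  have hc : (Ω.card : ℝ) ≠ 0 := by
    rw [Nat.cast_ne_zero]; exact Finset.card_ne_zero.2 hne
  have h1 : ∑ x ∈ Ω, ∑ y ∈ Ω, (f x - f y) ^ 2 =
      2 * (Ω.card : ℝ) * ∑ x ∈ Ω, f x ^ 2 - 2 * (∑ x ∈ Ω, f x) ^ 2 := by
    have : ∀ x ∈ Ω, ∑ y ∈ Ω, (f x - f y) ^ 2 =
        (Ω.card : ℝ) * f x ^ 2 - 2 * f x * (∑ y ∈ Ω, f y) + ∑ y ∈ Ω, f y ^ 2 := by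
      intro x _
      simp only [sub_sq, Finset.sum_add_distrib, Finset.sum_sub_distrib, Finset.sum_const,
        nsmul_eq_mul, ← Finset.mul_sum]
    rw [Finset.sum_congr rfl this]
    simp only [Finset.sum_add_distrib, Finset.sum_sub_distrib, Finset.sum_const,
        nsmul_eq_mul, ← Finset.mul_sum, ← Finset.sum_mul]
    ring
  have h2 : ∑ x ∈ Ω, (f x - mean Ω f) ^ 2 =
      ∑ x ∈ Ω, f x ^ 2 - 2 * mean Ω f * ∑ x ∈ Ω, f x + Ω.card * mean Ω f ^ 2 := by
    simp only [sub_sq, Finset.sum_add_distrib, Finset.sum_sub_distrib, Finset.sum_const,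
        nsmul_eq_mul, ← Finset.mul_sum, ← Finset.sum_mul]
    ring
  rw [variance, mean, h2, h1, mean]
  field_simp
  ring

lemma variance_le_of_forall {X : Type} (Ω : Finset X) (g : X → ℝ) {M : ℝ} (hM : 0 ≤ M)
    (h : ∀ x ∈ Ω, ∀ y ∈ Ω, (g x - g y) ^ 2 ≤ 2 * M) : variance Ω g ≤ M := by
  rw [variance_eq]
  rcases Ω.eq_empty_or_nonempty with rfl | hne
  · simpa using hM
  have hc : 0 < (Ω.card : ℝ) := by exact_mod_cast hne.card_pos
  rw [div_le_iff₀ (by positivity)]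
  calc _ ≤ ∑ x ∈ Ω, ∑ y ∈ Ω, 2 * M :=
        Finset.sum_le_sum fun x hx => Finset.sum_le_sum fun y hy => h x hx y hy
    _ = _ := by simp only [Finset.sum_const, nsmul_eq_mul]; ring

variable {E : Type} {q : ℕ}

lemma mem_condSet {Ω : Finset (E → Fin q)} {S : Set E} {σ τ : E → Fin q} :
    τ ∈ condSet Ω S σ ↔ τ ∈ Ω ∧ ∀ e, e ∉ S → τ e = σ e := by
  simp [condSet]

lemma mem_pinned {Ω : Finset (E → Fin q)} {r : E} {a : Fin q} {σ : E → Fin q} :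
    σ ∈ pinned Ω r a ↔ σ ∈ Ω ∧ σ r = a := by
  simp [pinned]

lemma condSet_eq {Ω : Finset (E → Fin q)} {S : Set E} {σ τ : E → Fin q}
    (h : τ ∈ condSet Ω S σ) : condSet Ω S τ = condSet Ω S σ := by
  rw [mem_condSet] at h
  ext x
  rw [mem_condSet, mem_condSet]
  exact and_congr_right fun _ => forall₂_congr fun e he => by rw [h.2 e he]

lemma self_mem_condSet {Ω : Finset (E → Fin q)} (S : Set E) {σ : E → Fin q} (h : σ ∈ Ω) :
    σ ∈ condSet Ω S σ := mem_condSet.2 ⟨h, fun _ _ => rfl⟩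

lemma sum_condSet (Ω : Finset (E → Fin q)) (S : Set E) (F : (E → Fin q) → ℝ) :
    ∑ σ ∈ Ω, ∑ τ ∈ condSet Ω S σ, F τ = ∑ τ ∈ Ω, (condSet Ω S τ).card * F τ := by
  rw [Finset.sum_comm' (t' := Ω) (s' := fun τ => condSet Ω S τ)]
  · simp only [Finset.sum_const, nsmul_eq_mul]
  · intro σ τ
    simp only [mem_condSet]
    exact ⟨fun h => ⟨⟨h.1, fun e he => (h.2.2 e he).symm⟩, h.2.1⟩,
      fun h => ⟨h.1.1, h.2, fun e he => (h.1.2 e he).symm⟩⟩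

lemma mean_condVar (Ω : Finset (E → Fin q)) (S : Set E) (f : (E → Fin q) → ℝ) :
    mean Ω (condVar Ω S f) = (∑ σ ∈ Ω, (∑ τ ∈ condSet Ω S σ, (f σ - f τ) ^ 2) /
      (2 * (condSet Ω S σ).card)) / Ω.card := by
  rw [mean]
  congr 1
  have h1 : ∀ σ ∈ Ω, condVar Ω S f σ = ∑ τ ∈ condSet Ω S σ,
      (∑ x ∈ condSet Ω S τ, (f τ - f x) ^ 2) / (2 * ((condSet Ω S τ).card : ℝ) ^ 2) := by
    intro σ _
    rw [condVar, variance_eq, Finset.sum_div]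
    exact Finset.sum_congr rfl fun τ hτ => by rw [condSet_eq hτ]
  rw [Finset.sum_congr rfl h1, sum_condSet]
  refine Finset.sum_congr rfl fun σ hσ => ?_
  have hc : ((condSet Ω S σ).card : ℝ) ≠ 0 := by
    rw [Nat.cast_ne_zero]; exact Finset.card_ne_zero.2 ⟨σ, self_mem_condSet S hσ⟩
  field_simp

lemma mean_condVar_nonneg (Ω : Finset (E → Fin q)) (S : Set E) (f : (E → Fin q) → ℝ) :
    0 ≤ mean Ω (condVar Ω S f) := mean_nonneg fun _ _ => variance_nonneg _ _

lemma mem_condSet_diffSet {Ω : Finset (E → Fin q)} {γ γ' : E → Fin q} (h : γ' ∈ Ω) :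
    γ' ∈ condSet Ω (diffSet γ γ') γ :=
  mem_condSet.2 ⟨h, fun e he => by
    by_contra hne
    exact he fun h => hne h.symm⟩

lemma glauberRate_eq {Ω : Finset (E → Fin q)} {γ γ' : E → Fin q} (h : γ' ∈ Ω) :
    glauberRate Ω γ γ' = 1 / ((condSet Ω (diffSet γ γ') γ).card : ℝ) :=
  prob_of_mem (mem_condSet_diffSet h)

lemma glauberRate_pos {Ω : Finset (E → Fin q)} {γ γ' : E → Fin q} (h : γ' ∈ Ω) :
    0 < glauberRate Ω γ γ' := by
  rw [glauberRate_eq h]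
  have : 0 < (condSet Ω (diffSet γ γ') γ).card := Finset.card_pos.2 ⟨_, mem_condSet_diffSet h⟩
  positivity

open Classical in
/-- The pairs of elements of `Ω` that differ exactly at one edge, which lies in `T`. -/
def stepSet (Ω : Finset (E → Fin q)) (T : Set E) : Finset ((E → Fin q) × (E → Fin q)) :=
  (Ω ×ˢ Ω).filter (fun s => ∃ e ∈ T, diffSet s.1 s.2 = {e})

lemma mem_stepSet {Ω : Finset (E → Fin q)} {T : Set E} {s : (E → Fin q) × (E → Fin q)} :
    s ∈ stepSet Ω T ↔ (s.1 ∈ Ω ∧ s.2 ∈ Ω) ∧ ∃ e ∈ T, diffSet s.1 s.2 = {e} := by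
  simp [stepSet]

variable [Fintype E] [DecidableEq E]

/-- Each local variance is half the average squared difference over ordered pairs with the same
colors off `e`, whence the factor 2. -/
lemma sum_stepSet_le (Ω : Finset (E → Fin q)) (T : Set E) [DecidablePred (· ∈ T)] (f : (E → Fin q) → ℝ) :
    ∑ s ∈ stepSet Ω T, prob Ω s.1 * glauberRate Ω s.1 s.2 * (f s.1 - f s.2) ^ 2 ≤
      2 * ∑ e ∈ Finset.univ.filter (· ∈ T), mean Ω (condVar Ω {e} f) := by
  classical
  have h1 : stepSet Ω T ⊆ (Finset.univ.filter (· ∈ T)).biUnion (fun e =>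
      stepSet Ω {e}) := by
    intro s hs
    rw [mem_stepSet] at hs
    obtain ⟨hs, e, he, hd⟩ := hs
    rw [Finset.mem_biUnion]
    exact ⟨e, by simpa using he, mem_stepSet.2 ⟨hs, e, rfl, hd⟩⟩
  have hnn : ∀ s : (E → Fin q) × (E → Fin q),
      0 ≤ prob Ω s.1 * glauberRate Ω s.1 s.2 * (f s.1 - f s.2) ^ 2 := fun s =>
    mul_nonneg (mul_nonneg (prob_nonneg _ _) (prob_nonneg _ _)) (sq_nonneg _)
  refine (Finset.sum_le_sum_of_subset_of_nonneg h1 fun s _ _ => hnn s).trans ?_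
  rw [Finset.sum_biUnion (by
    intro e _ e' _ hee
    rw [Function.onFun, Finset.disjoint_left]
    intro s hs hs'
    rw [mem_stepSet] at hs hs'
    obtain ⟨-, x, rfl, hx⟩ := hs
    obtain ⟨-, y, rfl, hy⟩ := hs'
    exact hee (Set.singleton_injective (hx.symm.trans hy)))]
  rw [Finset.mul_sum]
  refine Finset.sum_le_sum fun e _ => ?_
  rw [mean_condVar]
  have h2 : stepSet Ω {e} ⊆ (Ω.sigma fun σ => condSet Ω {e} σ).image (fun p => (p.1, p.2)) := by
    intro s hs
    rw [mem_stepSet] at hs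
    obtain ⟨⟨hs1, hs2⟩, e', he', hd⟩ := hs
    obtain rfl : e' = e := he'
    rw [Finset.mem_image]
    refine ⟨⟨s.1, s.2⟩, Finset.mem_sigma.2 ⟨hs1, ?_⟩, rfl⟩
    rw [← hd]
    exact mem_condSet_diffSet hs2
  calc ∑ s ∈ stepSet Ω {e}, prob Ω s.1 * glauberRate Ω s.1 s.2 * (f s.1 - f s.2) ^ 2
      = ∑ s ∈ stepSet Ω {e}, (f s.1 - f s.2) ^ 2 / ((condSet Ω {e} s.1).card * Ω.card) := by
        refine Finset.sum_congr rfl fun s hs => ?_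
        rw [mem_stepSet] at hs
        obtain ⟨⟨hs1, hs2⟩, e', he', hd⟩ := hs
        obtain rfl : e' = e := he'
        rw [prob_of_mem hs1, glauberRate_eq hs2, hd]
        rw [div_mul_div_comm, one_mul, div_mul_eq_mul_div, one_mul, mul_comm (Ω.card : ℝ)]
    _ ≤ ∑ s ∈ (Ω.sigma fun σ => condSet Ω {e} σ).image (fun p => (p.1, p.2)),
          (f s.1 - f s.2) ^ 2 / ((condSet Ω {e} s.1).card * Ω.card) :=
        Finset.sum_le_sum_of_subset_of_nonneg h2 fun s _ _ => by positivity
    _ = ∑ σ ∈ Ω, ∑ τ ∈ condSet Ω {e} σ,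
          (f σ - f τ) ^ 2 / ((condSet Ω {e} σ).card * Ω.card) := by
        rw [Finset.sum_image, Finset.sum_sigma]
        rintro ⟨a, b⟩ _ ⟨c, d⟩ _ h
        simp only [Prod.mk.injEq] at h
        obtain ⟨rfl, rfl⟩ := h
        rfl
    _ = _ := by
        rw [Finset.sum_div, Finset.mul_sum]
        refine Finset.sum_congr rfl fun σ _ => ?_
        rw [← Finset.sum_div]
        rw [div_div, mul_div_assoc', mul_assoc, mul_div_mul_left _ _ (two_ne_zero)]

/-! ### Loop-free lists from walks -/

/-- When the new head already occurs in the list, everything before that occurrence is a loop and is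
cut off. -/
lemma exists_nodup_chain {X : Type} {r : X → X → Prop} {x y : X} (h : Relation.ReflTransGen r x y) :
    ∃ l : List X, l.head? = some x ∧ l.getLast? = some y ∧ l.Nodup ∧ l.IsChain r := by
  induction h using Relation.ReflTransGen.head_induction_on with
  | refl => exact ⟨[y], by simp⟩
  | @head a c hac _ ih =>
    obtain ⟨l, h1, h2, h3, h4⟩ := ih
    by_cases ha : a ∈ l
    · obtain ⟨l₁, l₂, rfl⟩ := List.append_of_mem ha
      refine ⟨a :: l₂, rfl, ?_, ?_, ?_⟩
      · rw [← h2]; simp [List.getLast?_append, List.getLast?_cons]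
      · exact (List.nodup_append.1 h3).2.1
      · exact (List.isChain_append.1 h4).2.1
    · refine ⟨a :: l, rfl, ?_, List.nodup_cons.2 ⟨ha, h3⟩, ?_⟩
      · cases l with
        | nil => simp at h1
        | cons b l => simpa using h2
      · cases l with
        | nil => simp at h1
        | cons b l =>
          simp only [List.head?_cons, Option.some.injEq] at h1
          subst h1
          exact List.isChain_cons_cons.2 ⟨hac, h4⟩

lemma abs_sub_le_of_isChain {X : Type} {r : X → X → Prop} {f : X → ℝ} {δ : ℝ}
    (hr : ∀ x y, r x y → |f x - f y| ≤ δ) :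
    ∀ (l : List X) {x y : X}, l.head? = some x → l.getLast? = some y → l.IsChain r →
      |f x - f y| ≤ l.length * δ - δ
  | [], x, y, h, _, _ => by simp at h
  | [a], x, y, h, h', _ => by
    simp only [List.head?_cons, Option.some.injEq, List.getLast?_singleton] at h h'
    subst h; subst h'; simp
  | a :: b :: l, x, y, h, h', hc => by
    simp only [List.head?_cons, Option.some.injEq] at h
    subst h
    rw [List.isChain_cons_cons] at hc
    have ih := abs_sub_le_of_isChain hr (b :: l) (x := b) (y := y) rfl (by simpa using h') hc.2
    have h1 := hr _ _ hc.1
    have h2 := abs_sub_le (f a) (f b) (f y)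
    simp only [List.length_cons, Nat.cast_add, Nat.cast_one] at ih ⊢
    linarith

/-- A step has weight at least `1 / |Ω| ^ 2` in the Dirichlet form, which bounds the change of `f`
along it. A simple path has at most `|Ω|` vertices, so the squared difference of any two values is
at most `2 |Ω| ^ 4` times the sum of local variances. -/
lemma approxTensorization_of_connected (Ω : Finset (E → Fin q)) {K : ℝ}
    (hK : (Ω.card : ℝ) ^ 4 ≤ K)
    (hconn : ∀ σ ∈ Ω, ∀ τ ∈ Ω, Relation.ReflTransGen
      (fun γ γ' => γ ∈ Ω ∧ γ' ∈ Ω ∧ ∃ e, diffSet γ γ' = {e}) σ τ) :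
    ApproxTensorization Ω (fun _ => K) := by
  classical
  intro f
  rw [← Finset.mul_sum]
  obtain ⟨D, hD⟩ : ∃ D, D = ∑ e, mean Ω (condVar Ω {e} f) := ⟨_, rfl⟩
  have hD0 : 0 ≤ D := hD ▸ Finset.sum_nonneg fun e _ => mean_condVar_nonneg _ _ _
  rw [← hD]
  have hstep : ∀ γ γ', γ ∈ Ω ∧ γ' ∈ Ω ∧ (∃ e, diffSet γ γ' = {e}) →
      |f γ - f γ'| ≤ √(2 * (Ω.card : ℝ) ^ 2 * D) := by
    rintro γ γ' ⟨hγ, hγ', e, he⟩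
    have h1 := sum_stepSet_le Ω Set.univ f
    simp only [Set.mem_univ, Finset.filter_true, ← hD] at h1
    have h2 := Finset.single_le_sum (f := fun s : (E → Fin q) × (E → Fin q) =>
      prob Ω s.1 * glauberRate Ω s.1 s.2 * (f s.1 - f s.2) ^ 2) (fun s _ =>
        mul_nonneg (mul_nonneg (prob_nonneg _ _) (prob_nonneg _ _)) (sq_nonneg _))
      (mem_stepSet.2 ⟨⟨hγ, hγ'⟩, e, Set.mem_univ e, he⟩ : (γ, γ') ∈ stepSet Ω Set.univ)
    simp only at h2
    rw [prob_of_mem hγ, glauberRate_eq hγ'] at h2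
    have hc1 : 0 < (Ω.card : ℝ) := by exact_mod_cast Finset.card_pos.2 ⟨_, hγ⟩
    have hc2 : 0 < ((condSet Ω (diffSet γ γ') γ).card : ℝ) := by
      exact_mod_cast Finset.card_pos.2 ⟨_, mem_condSet_diffSet hγ'⟩
    have hc3 : ((condSet Ω (diffSet γ γ') γ).card : ℝ) ≤ Ω.card := by
      exact_mod_cast Finset.card_le_card fun x hx => (mem_condSet.1 hx).1
    apply Real.abs_le_sqrt
    have h3 := h2.trans h1
    rw [div_mul_div_comm, one_mul, div_mul_eq_mul_div, one_mul, div_le_iff₀ (by positivity)] at h3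
    calc _ ≤ _ := h3
      _ ≤ 2 * D * (Ω.card * Ω.card) := by gcongr
      _ = _ := by ring
  refine (variance_le_of_forall Ω f (M := (Ω.card : ℝ) ^ 4 * D) (by positivity) ?_).trans
    (mul_le_mul_of_nonneg_right hK hD0)
  intro σ hσ τ hτ
  obtain ⟨l, h1, h2, h3, h4⟩ := exists_nodup_chain (hconn σ hσ τ hτ)
  have hl : l.length ≤ Ω.card := by
    rw [← List.toFinset_card_of_nodup h3]
    refine Finset.card_le_card fun x hx => ?_
    rw [List.mem_toFinset] at hx
    obtain ⟨l₁, l₂, rfl⟩ := List.append_of_mem hx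
    cases l₂ with
    | cons y l₂ =>
      have h5 := (List.isChain_append.1 h4).2.1
      rw [List.isChain_cons_cons] at h5
      exact h5.1.1
    | nil =>
      have : x = τ := by simpa using h2
      rw [this]; exact hτ
  have h5 := abs_sub_le_of_isChain hstep l h1 h2 h4
  have hs := Real.sqrt_nonneg (2 * (Ω.card : ℝ) ^ 2 * D)
  have h6 : |f σ - f τ| ≤ Ω.card * √(2 * (Ω.card : ℝ) ^ 2 * D) := by
    have : (l.length : ℝ) ≤ Ω.card := by exact_mod_cast hl
    nlinarith
  calc (f σ - f τ) ^ 2 = |f σ - f τ| ^ 2 := (sq_abs _).symm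
    _ ≤ (Ω.card * √(2 * (Ω.card : ℝ) ^ 2 * D)) ^ 2 := by gcongr
    _ = _ := by rw [mul_pow, Real.sq_sqrt (by positivity)]; ring

/-! ### Root-tensorization from canonical paths -/

open Classical in
/-- The indicator of the event that the list makes the step from `γ` to `γ'`. -/
def stepInd {X : Type} (l : List X) (γ γ' : X) : ℝ := if [γ, γ'] <:+: l then 1 else 0

lemma stepInd_nonneg {X : Type} (l : List X) (γ γ' : X) : 0 ≤ stepInd l γ γ' := by
  unfold stepInd; split_ifs <;> norm_num

lemma stepProb_eq {X : Type} [Fintype X] (C : X → X → ℝ) (Γ : X → X → List X) (γ γ' : X) :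
    stepProb C Γ γ γ' = ∑ σ, ∑ τ, C σ τ * stepInd (Γ σ τ) γ γ' := by
  unfold stepProb stepInd
  refine Finset.sum_congr rfl fun σ _ => Finset.sum_congr rfl fun τ _ => ?_
  by_cases h : [γ, γ'] <:+: Γ σ τ <;> simp [h]

lemma stepProb_nonneg {X : Type} [Fintype X] {C : X → X → ℝ} (hC : ∀ σ τ, 0 ≤ C σ τ)
    (Γ : X → X → List X) (γ γ' : X) : 0 ≤ stepProb C Γ γ γ' := by
  rw [stepProb_eq]
  exact Finset.sum_nonneg fun σ _ => Finset.sum_nonneg fun τ _ =>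
    mul_nonneg (hC σ τ) (stepInd_nonneg _ _ _)

lemma pairCongestion_eq (Ω : Finset (E → Fin q)) (T : Set E)
    (C : (E → Fin q) → (E → Fin q) → ℝ) (Γ : (E → Fin q) → (E → Fin q) → List (E → Fin q)) :
    pairCongestion Ω T C Γ =
      ∑ s ∈ stepSet Ω T, stepProb C Γ s.1 s.2 ^ 2 / (prob Ω s.1 * glauberRate Ω s.1 s.2) := by
  unfold pairCongestion
  exact Finset.sum_congr (by ext s; simp [mem_stepSet]) fun _ _ => rfl

lemma pairCongestion_nonneg (Ω : Finset (E → Fin q)) (T : Set E)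
    (C : (E → Fin q) → (E → Fin q) → ℝ) (Γ : (E → Fin q) → (E → Fin q) → List (E → Fin q)) :
    0 ≤ pairCongestion Ω T C Γ :=
  Finset.sum_nonneg fun _ _ => div_nonneg (sq_nonneg _) (mul_nonneg (prob_nonneg _ _)
    (prob_nonneg _ _))

/-- Telescoping. On a loop-free list every step occurs only once, so the 0–1 indicator counts it
correctly. -/
lemma abs_sub_le_sum_infix {X : Type} {f : X → ℝ} {S : Finset (X × X)} :
    ∀ (l : List X) {x y : X}, l.head? = some x → l.getLast? = some y → l.Nodup →
      l.IsChain (fun γ γ' => (γ, γ') ∈ S) →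
      |f x - f y| ≤ ∑ s ∈ S, stepInd l s.1 s.2 * |f s.1 - f s.2|
  | [], x, y, h, _, _, _ => by simp at h
  | [a], x, y, h, h', _, _ => by
    simp only [List.head?_cons, Option.some.injEq, List.getLast?_singleton] at h h'
    subst h; subst h'
    simp only [sub_self, abs_zero]
    exact Finset.sum_nonneg fun s _ => mul_nonneg (stepInd_nonneg _ _ _) (abs_nonneg _)
  | a :: b :: l, x, y, h, h', hn, hc => by
    classical
    simp only [List.head?_cons, Option.some.injEq] at h
    subst h
    rw [List.isChain_cons_cons] at hc
    have ih := abs_sub_le_sum_infix (f := f) (S := S) (b :: l) (x := b) (y := y) rfl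
      (by simpa using h') (List.nodup_cons.1 hn).2 hc.2
    have h1 : |f a - f b| = ∑ s ∈ S, if s = (a, b) then |f s.1 - f s.2| else 0 := by
      rw [Finset.sum_ite_eq' S (a, b), if_pos hc.1]
    refine (abs_sub_le (f a) (f b) (f y)).trans ((add_le_add h1.le ih).trans ?_)
    rw [← Finset.sum_add_distrib]
    refine Finset.sum_le_sum fun s _ => ?_
    by_cases hs : s = (a, b)
    · subst hs
      -- The step just removed cannot recur, since `a` does not appear again.
      have h2 : ¬ [a, b] <:+: b :: l := fun h =>
        (List.nodup_cons.1 hn).1 (h.subset (by simp))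
      have h3 : [a, b] <:+: a :: b :: l := ⟨[], l, rfl⟩
      simp [stepInd, h2, h3]
    · rw [if_neg hs, zero_add]
      refine mul_le_mul_of_nonneg_right ?_ (abs_nonneg _)
      by_cases h2 : [s.1, s.2] <:+: b :: l
      · have h3 : [s.1, s.2] <:+: a :: b :: l := h2.trans ⟨[a], [], by simp⟩
        simp [stepInd, h2, h3]
      · have : stepInd (b :: l) s.1 s.2 = 0 := by simp [stepInd, h2]
        rw [this]; exact stepInd_nonneg _ _ _

lemma abs_mean_sub_mean_le {Ω Ω₁ Ω₂ : Finset (E → Fin q)} {C : (E → Fin q) → (E → Fin q) → ℝ}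
    {Γ : (E → Fin q) → (E → Fin q) → List (E → Fin q)} (hC : IsCoupling Ω₁ Ω₂ C)
    (hΓ : ∀ σ τ, C σ τ ≠ 0 → IsSimplePath Ω σ τ (Γ σ τ)) (f : (E → Fin q) → ℝ) :
    |mean Ω₁ f - mean Ω₂ f| ≤ ∑ s ∈ stepSet Ω Set.univ, stepProb C Γ s.1 s.2 * |f s.1 - f s.2| := by
  have h1 : mean Ω₁ f - mean Ω₂ f = ∑ σ, ∑ τ, C σ τ * (f σ - f τ) := by
    simp only [mul_sub, Finset.sum_sub_distrib]
    rw [← sum_prob_mul, ← sum_prob_mul]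
    congr 1
    · exact Finset.sum_congr rfl fun σ _ => by rw [← hC.2.1 σ, Finset.sum_mul]
    · rw [Finset.sum_comm]
      exact Finset.sum_congr rfl fun σ _ => by rw [← hC.2.2 σ, Finset.sum_mul]
  rw [h1]
  calc _ ≤ ∑ σ, ∑ τ, C σ τ * |f σ - f τ| := by
        refine (Finset.abs_sum_le_sum_abs _ _).trans (Finset.sum_le_sum fun σ _ =>
          (Finset.abs_sum_le_sum_abs _ _).trans (Finset.sum_le_sum fun τ _ => ?_))
        rw [abs_mul, abs_of_nonneg (hC.1 σ τ)]
    _ ≤ ∑ σ, ∑ τ, C σ τ * ∑ s ∈ stepSet Ω Set.univ,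
          stepInd (Γ σ τ) s.1 s.2 * |f s.1 - f s.2| := by
        refine Finset.sum_le_sum fun σ _ => Finset.sum_le_sum fun τ _ => ?_
        by_cases h0 : C σ τ = 0
        · simp [h0]
        refine mul_le_mul_of_nonneg_left ?_ (hC.1 σ τ)
        obtain ⟨h1, h2, h3, h4, h5⟩ := hΓ σ τ h0
        refine abs_sub_le_sum_infix _ h1 h2 h3 (h5.imp_of_mem_imp fun γ γ' hγ hγ' hd => ?_)
        obtain ⟨e, he⟩ := Set.ncard_eq_one.1 hd
        exact mem_stepSet.2 ⟨⟨h4 γ hγ, h4 γ' hγ'⟩, e, Set.mem_univ e, he⟩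
    _ = _ := by
        simp only [stepProb_eq, Finset.sum_mul, Finset.mul_sum]
        rw [Finset.sum_congr rfl fun σ _ => Finset.sum_comm, Finset.sum_comm]
        refine Finset.sum_congr rfl fun s _ => Finset.sum_congr rfl fun σ _ =>
          Finset.sum_congr rfl fun τ _ => by ring

/-- Cauchy–Schwarz with the weights `μ(γ) Q(γ, γ')`. This is why the step probability is squared in
the definition of congestion. -/
lemma sq_sum_stepSet_le (Ω : Finset (E → Fin q)) (T : Set E)
    (C : (E → Fin q) → (E → Fin q) → ℝ) (Γ : (E → Fin q) → (E → Fin q) → List (E → Fin q))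
    (f : (E → Fin q) → ℝ) :
    (∑ s ∈ stepSet Ω T, stepProb C Γ s.1 s.2 * |f s.1 - f s.2|) ^ 2 ≤
      pairCongestion Ω T C Γ *
        ∑ s ∈ stepSet Ω T, prob Ω s.1 * glauberRate Ω s.1 s.2 * (f s.1 - f s.2) ^ 2 := by
  rw [pairCongestion_eq]
  refine Finset.sum_sq_le_sum_mul_sum_of_sq_le_mul _
    (fun s _ => div_nonneg (sq_nonneg _) (mul_nonneg (prob_nonneg _ _) (prob_nonneg _ _)))
    (fun s _ => mul_nonneg (mul_nonneg (prob_nonneg _ _) (prob_nonneg _ _)) (sq_nonneg _))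
    (fun s hs => le_of_eq ?_)
  rw [mem_stepSet] at hs
  have h1 := glauberRate_pos (γ := s.1) hs.1.2
  have h2 : 0 < prob Ω s.1 := by
    rw [prob_of_mem hs.1.1]
    have : 0 < Ω.card := Finset.card_pos.2 ⟨_, hs.1.1⟩
    positivity
  rw [mul_pow, sq_abs]
  field_simp

-- A second Cauchy–Schwarz, over the `l + 1` levels, produces the factor `l + 1`.
open Classical in
lemma sq_mean_sub_mean_le {Ω Ω₁ Ω₂ : Finset (E → Fin q)} {C : (E → Fin q) → (E → Fin q) → ℝ}
    {Γ : (E → Fin q) → (E → Fin q) → List (E → Fin q)} (hC : IsCoupling Ω₁ Ω₂ C)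
    (hΓ : ∀ σ τ, C σ τ ≠ 0 → IsSimplePath Ω σ τ (Γ σ τ)) (lv : E → ℕ) (l : ℕ)
    (hlv : ∀ e, lv e ≤ l) {ξ : ℕ → ℝ} (hξ : ∀ t, t ≤ l → pairCongestion Ω {e | lv e = t} C Γ ≤ ξ t)
    (f : (E → Fin q) → ℝ) :
    (mean Ω₁ f - mean Ω₂ f) ^ 2 ≤
      2 * ∑ e, ((l + 1) * ξ (lv e)) * mean Ω (condVar Ω {e} f) := by
  have h1 := abs_mean_sub_mean_le hC hΓ f
  have h2 : stepSet Ω Set.univ ⊆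
      (Finset.range (l + 1)).biUnion (fun t => stepSet Ω {e | lv e = t}) := by
    intro s hs
    rw [mem_stepSet] at hs
    obtain ⟨hs, e, -, he⟩ := hs
    rw [Finset.mem_biUnion]
    exact ⟨lv e, Finset.mem_range.2 (Nat.lt_succ_of_le (hlv e)), mem_stepSet.2 ⟨hs, e, rfl, he⟩⟩
  have hnn : ∀ s : (E → Fin q) × (E → Fin q), 0 ≤ stepProb C Γ s.1 s.2 * |f s.1 - f s.2| :=
    fun s => mul_nonneg (stepProb_nonneg hC.1 _ _ _) (abs_nonneg _)
  have h3 := h1.trans (Finset.sum_le_sum_of_subset_of_nonneg h2 fun s _ _ => hnn s)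
  rw [Finset.sum_biUnion (by
    intro t _ t' _ htt
    rw [Function.onFun, Finset.disjoint_left]
    intro s hs hs'
    rw [mem_stepSet] at hs hs'
    obtain ⟨-, x, rfl, hx⟩ := hs
    obtain ⟨-, y, rfl, hy⟩ := hs'
    exact htt (by rw [Set.singleton_injective (hx.symm.trans hy)]))] at h3
  have h4 : (mean Ω₁ f - mean Ω₂ f) ^ 2 ≤ (∑ t ∈ Finset.range (l + 1),
      ∑ s ∈ stepSet Ω {e | lv e = t}, stepProb C Γ s.1 s.2 * |f s.1 - f s.2|) ^ 2 := by
    rw [← sq_abs]; gcongr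
  refine h4.trans ((sq_sum_le_card_mul_sum_sq).trans ?_)
  rw [Finset.card_range]
  calc _ ≤ ((l + 1 : ℕ) : ℝ) * ∑ t ∈ Finset.range (l + 1), ξ t * (2 * ∑ e ∈ Finset.univ.filter
          (· ∈ {e | lv e = t}), mean Ω (condVar Ω {e} f)) := by
        refine mul_le_mul_of_nonneg_left (Finset.sum_le_sum fun t ht => ?_) (by positivity)
        have h5 := hξ t (Nat.lt_succ_iff.1 (Finset.mem_range.1 ht))
        refine (sq_sum_stepSet_le Ω _ C Γ f).trans (mul_le_mul h5 (sum_stepSet_le Ω _ f) ?_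
          ((pairCongestion_nonneg _ _ _ _).trans h5))
        exact Finset.sum_nonneg fun s _ =>
          mul_nonneg (mul_nonneg (prob_nonneg _ _) (prob_nonneg _ _)) (sq_nonneg _)
    _ = 2 * ∑ t ∈ Finset.range (l + 1), ∑ e ∈ Finset.univ.filter (fun e => lv e = t),
          ((l + 1) * ξ (lv e)) * mean Ω (condVar Ω {e} f) := by
        rw [Finset.mul_sum, Finset.mul_sum]
        refine Finset.sum_congr rfl fun t _ => ?_
        have : ∑ e ∈ Finset.univ.filter (fun e => lv e = t),
            ((l + 1) * ξ (lv e)) * mean Ω (condVar Ω {e} f) =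
            ∑ e ∈ Finset.univ.filter (fun e => lv e = t),
            ((l + 1) * ξ t) * mean Ω (condVar Ω {e} f) :=
          Finset.sum_congr rfl fun e he => by rw [(Finset.mem_filter.1 he).2]
        rw [this, ← Finset.mul_sum]
        simp only [Set.mem_ofPred_eq]
        push_cast
        ring
    _ = _ := by
        rw [Finset.sum_fiberwise_of_maps_to]
        exact fun e _ => Finset.mem_range.2 (Nat.lt_succ_of_le (hlv e))

lemma condMean_compl_singleton {Ω : Finset (E → Fin q)} (r : E) (f : (E → Fin q) → ℝ)
    (σ : E → Fin q) : condMean Ω {r}ᶜ f σ = mean (pinned Ω r (σ r)) f := by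
  have : condSet Ω {r}ᶜ σ = pinned Ω r (σ r) := by
    ext τ
    rw [mem_condSet, mem_pinned]
    simp
  rw [condMean, this]

/-- The conditional mean depends only on the color of `r`, so its variance is controlled by the
largest squared difference of means between two root colors; the 2 there cancels against the one in
`variance_le_of_forall`. -/
theorem rootTensorization_of_paths {Ω : Finset (E → Fin q)} {r : E} {R : Set (Fin q)}
    (hR : ∀ σ ∈ Ω, σ r ∈ R) {C : Fin q → Fin q → (E → Fin q) → (E → Fin q) → ℝ}
    {Γ : (E → Fin q) → (E → Fin q) → List (E → Fin q)}
    (hC : ∀ a ∈ R, ∀ b ∈ R, a ≠ b → IsCoupling (pinned Ω r a) (pinned Ω r b) (C a b))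
    (hΓ : ∀ a ∈ R, ∀ b ∈ R, a ≠ b → ∀ σ τ, C a b σ τ ≠ 0 → IsSimplePath Ω σ τ (Γ σ τ))
    (lv : E → ℕ) (l : ℕ) (hlv : ∀ e, lv e ≤ l) {ξ : ℕ → ℝ} (hξ0 : ∀ t, 0 ≤ ξ t)
    (hξ : ∀ a ∈ R, ∀ b ∈ R, a ≠ b → ∀ t, t ≤ l →
      pairCongestion Ω {e | lv e = t} (C a b) Γ ≤ ξ t) :
    ApproxRootTensorization Ω r (fun e => (l + 1) * ξ (lv e)) := by
  intro f
  have h0 : 0 ≤ ∑ e, ((l + 1) * ξ (lv e)) * mean Ω (condVar Ω {e} f) :=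
    Finset.sum_nonneg fun e _ => mul_nonneg (mul_nonneg (by positivity) (hξ0 _))
      (mean_condVar_nonneg _ _ _)
  refine variance_le_of_forall Ω _ h0 fun σ hσ τ hτ => ?_
  rw [condMean_compl_singleton, condMean_compl_singleton]
  by_cases h : σ r = τ r
  · rw [h, sub_self]
    simpa using h0
  · exact sq_mean_sub_mean_le (hC _ (hR σ hσ) _ (hR τ hτ) h) (hΓ _ (hR σ hσ) _ (hR τ hτ) h) lv l hlv
      (hξ _ (hR σ hσ) _ (hR τ hτ) h) f

end TreeEdgeColoring

namespace TreeEdgeColoring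

open CTree (sift mem_sift)

/-! ### Flip couplings -/

section Flip

variable {E : Type} {q : ℕ} {G : SimpleGraph E} {a b : Fin q} {r : E} {σ : E → Fin q}

lemma flip_of_mem {e : E} (h : e ∈ altPath G a b r σ) :
    flip G a b r σ e = Equiv.swap a b (σ e) := by
  simp [flip, h]

lemma flip_of_notMem {e : E} (h : e ∉ altPath G a b r σ) : flip G a b r σ e = σ e := by
  simp [flip, h]

lemma color_of_mem_altPath (hr : σ r = a) {e : E} (h : e ∈ altPath G a b r σ) :
    σ e = a ∨ σ e = b := by
  cases h with
  | refl => exact .inl hr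
  | tail _ h => exact h.2.2

lemma mem_altPath_of_adj {e f : E} (he : e ∈ altPath G a b r σ) (hef : G.Adj e f)
    (hce : σ e = a ∨ σ e = b) (hcf : σ f = a ∨ σ f = b) : f ∈ altPath G a b r σ :=
  Relation.ReflTransGen.tail he ⟨hef, hce, hcf⟩

lemma swap_mem_iff {x : Fin q} :
    (Equiv.swap a b x = b ∨ Equiv.swap a b x = a) ↔ (x = a ∨ x = b) := by
  rw [Equiv.swap_apply_eq_iff, Equiv.swap_apply_eq_iff, Equiv.swap_apply_left,
    Equiv.swap_apply_right]

lemma flip_color_iff (e : E) :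
    (flip G a b r σ e = b ∨ flip G a b r σ e = a) ↔ (σ e = a ∨ σ e = b) := by
  by_cases h : e ∈ altPath G a b r σ
  · rw [flip_of_mem h, swap_mem_iff]
  · rw [flip_of_notMem h, or_comm]

/-- The flip preserves the set of edges with color `a` or `b`, and the path depends on nothing else.
Hence flips in the two directions are mutually inverse. -/
lemma altPath_flip : altPath G b a r (flip G a b r σ) = altPath G a b r σ := by
  unfold altPath
  simp only [flip_color_iff]

lemma flip_flip : flip G b a r (flip G a b r σ) = σ := by
  funext e
  by_cases h : e ∈ altPath G a b r σ
  · rw [flip_of_mem (by rwa [altPath_flip]), flip_of_mem h, Equiv.swap_comm b a,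
      Equiv.swap_apply_self]
  · rw [flip_of_notMem (by rwa [altPath_flip]), flip_of_notMem h]

variable [Fintype E] [DecidableEq E] {L : E → Set (Fin q)}

lemma mem_colorings : σ ∈ colorings G L ↔ (∀ e, σ e ∈ L e) ∧ ∀ e f, G.Adj e f → σ e ≠ σ f := by
  simp [colorings]

/-- A conflict could only arise between an edge of the path and a neighbor off it. That neighbor
would have color `a` or `b` and hence belong to the path. -/
lemma flip_mem (hL : ∀ e, e ≠ r → L e = Set.univ) (hb : b ∈ L r)
    (h : σ ∈ pinned (colorings G L) r a) : flip G a b r σ ∈ pinned (colorings G L) r b := by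
  rw [mem_pinned, mem_colorings] at h ⊢
  obtain ⟨⟨-, hσ⟩, hr⟩ := h
  have hrr : flip G a b r σ r = b := by
    rw [flip_of_mem Relation.ReflTransGen.refl, hr, Equiv.swap_apply_left]
  have key : ∀ e f, G.Adj e f → e ∈ altPath G a b r σ → f ∉ altPath G a b r σ →
      flip G a b r σ e ≠ flip G a b r σ f := by
    intro e f hef he hf heq
    have hc := color_of_mem_altPath hr he
    refine hf (mem_altPath_of_adj he hef hc ?_)
    rw [← flip_color_iff (G := G) (r := r), ← heq, flip_color_iff]
    exact hc
  refine ⟨⟨fun e => ?_, fun e f hef => ?_⟩, hrr⟩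
  · by_cases he : e = r
    · rw [he, hrr]; exact hb
    · rw [hL e he]; trivial
  · by_cases he : e ∈ altPath G a b r σ <;> by_cases hf : f ∈ altPath G a b r σ
    · rw [flip_of_mem he, flip_of_mem hf]
      exact fun h => hσ e f hef ((Equiv.swap a b).injective h)
    · exact key e f hef he hf
    · exact (key f e hef.symm hf he).symm
    · rw [flip_of_notMem he, flip_of_notMem hf]
      exact hσ e f hef

end Flip

/-! ### Couplings given by a bijection -/

section MapCoupling

variable {X : Type}

open Classical in
/-- The law of `(σ, φ σ)` for uniform `σ ∈ Ω₁`. -/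
def mapCoupling (Ω₁ : Finset X) (φ : X → X) (σ τ : X) : ℝ := if τ = φ σ then prob Ω₁ σ else 0

variable [Fintype X] {Ω₁ Ω₂ : Finset X} {φ ψ : X → X}

lemma isCoupling_mapCoupling (hφ : ∀ σ ∈ Ω₁, φ σ ∈ Ω₂) (hψ : ∀ σ ∈ Ω₂, ψ σ ∈ Ω₁)
    (h1 : ∀ σ, ψ (φ σ) = σ) (h2 : ∀ σ, φ (ψ σ) = σ) :
    IsCoupling Ω₁ Ω₂ (mapCoupling Ω₁ φ) := by
  classical
  refine ⟨fun σ τ => ?_, fun σ => ?_, fun τ => ?_⟩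
  · unfold mapCoupling; split_ifs
    · exact prob_nonneg _ _
    · exact le_rfl
  · simp [mapCoupling]
  · have : ∀ σ, mapCoupling Ω₁ φ σ τ = if σ = ψ τ then prob Ω₁ (ψ τ) else 0 := by
      intro σ
      by_cases h : σ = ψ τ
      · subst h; simp [mapCoupling, h2]
      · have h' : τ ≠ φ σ := by rintro rfl; exact h (h1 σ).symm
        simp [mapCoupling, h, h']
    simp only [this, Finset.sum_ite_eq', Finset.mem_univ, if_true]
    have hcard : Ω₁.card = Ω₂.card :=
      Finset.card_nbij' φ ψ hφ hψ (fun σ _ => h1 σ) (fun σ _ => h2 σ)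
    by_cases hτ : τ ∈ Ω₂
    · rw [prob_of_mem hτ, prob_of_mem (hψ τ hτ), hcard]
    · have : ψ τ ∉ Ω₁ := fun h => hτ (by have := hφ _ h; rwa [h2] at this)
      rw [prob_of_notMem hτ, prob_of_notMem this]

lemma stepProb_mapCoupling (Γ : X → X → List X) (γ γ' : X) :
    stepProb (mapCoupling Ω₁ φ) Γ γ γ' =
      (∑ σ ∈ Ω₁, stepInd (Γ σ (φ σ)) γ γ') / Ω₁.card := by
  classical
  rw [stepProb_eq]
  have h1 : ∀ σ, ∑ τ, mapCoupling Ω₁ φ σ τ * stepInd (Γ σ τ) γ γ' =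
      prob Ω₁ σ * stepInd (Γ σ (φ σ)) γ γ' := by
    intro σ
    simp [mapCoupling, ite_mul]
  rw [Finset.sum_congr rfl fun σ _ => h1 σ, sum_prob_mul, mean]

lemma stepProb_le_one {C : X → X → ℝ} (hC : IsCoupling Ω₁ Ω₂ C) (Γ : X → X → List X) (γ γ' : X) :
    stepProb C Γ γ γ' ≤ 1 := by
  rw [stepProb_eq]
  calc _ ≤ ∑ σ, ∑ τ, C σ τ := by
        refine Finset.sum_le_sum fun σ _ => Finset.sum_le_sum fun τ _ =>
          mul_le_of_le_one_right (hC.1 σ τ) ?_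
        unfold stepInd; split_ifs <;> norm_num
    _ = ∑ σ, prob Ω₁ σ * 1 := Finset.sum_congr rfl fun σ _ => by rw [hC.2.1 σ, mul_one]
    _ ≤ 1 := by
        rw [sum_prob_mul, mean]
        simp only [Finset.sum_const, nsmul_eq_mul, mul_one]
        exact div_self_le_one _

end MapCoupling

/-! ### Bounds on the congestion -/

section Congestion

variable {E : Type} {q : ℕ} [Fintype E] [DecidableEq E] {Ω Ω₁ Ω₂ : Finset (E → Fin q)}

lemma card_condSet_pos {T : Set E} {s : (E → Fin q) × (E → Fin q)} (hs : s ∈ stepSet Ω T) :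
    0 < (condSet Ω (diffSet s.1 s.2) s.1).card :=
  Finset.card_pos.2 ⟨_, mem_condSet_diffSet (mem_stepSet.1 hs).1.2⟩

lemma card_condSet_le {T : Set E} {s : (E → Fin q) × (E → Fin q)} (hs : s ∈ stepSet Ω T) :
    (condSet Ω (diffSet s.1 s.2) s.1).card ≤ q := by
  obtain ⟨-, e, -, he⟩ := mem_stepSet.1 hs
  rw [he]
  refine (Finset.card_le_card_of_injOn (fun τ => τ e) (fun _ _ => Finset.mem_univ _) ?_).trans
    (by rw [Finset.card_univ, Fintype.card_fin])
  intro τ hτ τ' hτ' h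
  rw [Finset.mem_coe, mem_condSet] at hτ hτ'
  funext x
  by_cases hx : x = e
  · subst hx; exact h
  · rw [hτ.2 x hx, hτ'.2 x hx]

lemma step_term_eq {T : Set E} {s : (E → Fin q) × (E → Fin q)} (hs : s ∈ stepSet Ω T) (p : ℝ) :
    p ^ 2 / (prob Ω s.1 * glauberRate Ω s.1 s.2) =
      p ^ 2 * (Ω.card * (condSet Ω (diffSet s.1 s.2) s.1).card) := by
  have h := (mem_stepSet.1 hs).1
  rw [prob_of_mem h.1, glauberRate_eq h.2]
  have h1 : (Ω.card : ℝ) ≠ 0 := Nat.cast_ne_zero.2 (Finset.card_ne_zero.2 ⟨_, h.1⟩)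
  have h2 : ((condSet Ω (diffSet s.1 s.2) s.1).card : ℝ) ≠ 0 :=
    Nat.cast_ne_zero.2 (card_condSet_pos hs).ne'
  field_simp

lemma pairCongestion_le_card_pow {C : (E → Fin q) → (E → Fin q) → ℝ} (hC : IsCoupling Ω₁ Ω₂ C)
    (T : Set E) (Γ : (E → Fin q) → (E → Fin q) → List (E → Fin q)) :
    pairCongestion Ω T C Γ ≤ (Ω.card : ℝ) ^ 4 := by
  classical
  rw [pairCongestion_eq]
  calc _ ≤ ∑ s ∈ stepSet Ω T, (Ω.card : ℝ) ^ 2 := by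
        refine Finset.sum_le_sum fun s hs => ?_
        rw [step_term_eq hs]
        have h1 := stepProb_nonneg hC.1 Γ s.1 s.2
        have h2 := stepProb_le_one hC Γ s.1 s.2
        have h3 : ((condSet Ω (diffSet s.1 s.2) s.1).card : ℝ) ≤ Ω.card := by
          exact_mod_cast Finset.card_le_card fun x hx => (mem_condSet.1 hx).1
        calc _ ≤ 1 ^ 2 * ((Ω.card : ℝ) * Ω.card) := by gcongr
          _ = _ := by ring
    _ = ((stepSet Ω T).card : ℝ) * (Ω.card : ℝ) ^ 2 := by rw [Finset.sum_const, nsmul_eq_mul]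
    _ ≤ ((Ω ×ˢ Ω).card : ℝ) * (Ω.card : ℝ) ^ 2 := by
        gcongr
        exact fun s hs => Finset.mem_product.2 (mem_stepSet.1 hs).1
    _ = _ := by rw [Finset.card_product]; push_cast; ring

lemma card_sift_eq_sum {α : Type} (S : Finset α) (P : α → Prop) [DecidablePred P] :
    ((sift S P).card : ℝ) = ∑ x ∈ S, if P x then 1 else 0 := by
  rw [Finset.sum_boole]
  congr 2
  ext x; simp [mem_sift]

/-- Let `N i s` be the number of origins `σ` with `B i σ` and both endpoints of `s` in window `i` of
`σ`. One factor `K i` comes from `N i s ≤ K i`, which turns the square into a first power. Two more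
come from summing over `s`, since each origin has at most `K i ^ 2` pairs of colorings in its
window. The factor `q ^ 2` accounts for the heat-bath rate and for the ratio of `Ω` to `Ω₁`. -/
theorem pairCongestion_mapCoupling_le {φ : (E → Fin q) → (E → Fin q)} {T : Set E}
    {Γ : (E → Fin q) → (E → Fin q) → List (E → Fin q)} {m : ℕ}
    {B : ℕ → (E → Fin q) → Prop} {W : ℕ → (E → Fin q) → (E → Fin q) → Prop} {K : ℕ → ℕ}
    {β : ℕ → ℝ} (hne : Ω₁.Nonempty)
    (hstep : ∀ σ ∈ Ω₁, ∀ γ ∈ Ω, ∀ γ' ∈ Ω, [γ, γ'] <:+: Γ σ (φ σ) →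
      (∃ e ∈ T, diffSet γ γ' = {e}) → ∃ i < m, B i σ ∧ W i σ γ ∧ W i σ γ')
    (hK₁ : ∀ i, ∀ γ ∈ Ω, (sift Ω₁ (fun σ => W i σ γ)).card ≤ K i)
    (hK₂ : ∀ i, ∀ σ ∈ Ω₁, (sift Ω (fun γ => W i σ γ)).card ≤ K i)
    (hβ : ∀ i, ((sift Ω₁ (B i)).card : ℝ) ≤ β i * Ω₁.card)
    (hΩ : Ω.card ≤ q * Ω₁.card) :
    pairCongestion Ω T (mapCoupling Ω₁ φ) Γ ≤
      q ^ 2 * m * ∑ i ∈ Finset.range m, (K i : ℝ) ^ 3 * β i := by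
  classical
  have hZ : 0 < (Ω₁.card : ℝ) := by exact_mod_cast hne.card_pos
  obtain ⟨P, hP⟩ : ∃ P : ℕ → (E → Fin q) × (E → Fin q) → (E → Fin q) → Prop,
      P = fun i s σ => B i σ ∧ W i σ s.1 ∧ W i σ s.2 := ⟨_, rfl⟩
  obtain ⟨N, hN⟩ : ∃ N : ℕ → (E → Fin q) × (E → Fin q) → ℝ,
      N = fun i s => ((sift Ω₁ (P i s)).card : ℝ) := ⟨_, rfl⟩
  have hN0 : ∀ i s, 0 ≤ N i s := fun i s => by rw [hN]; positivity
  have hsum : ∀ s ∈ stepSet Ω T, ∑ σ ∈ Ω₁, stepInd (Γ σ (φ σ)) s.1 s.2 ≤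
      ∑ i ∈ Finset.range m, N i s := by
    intro s hs
    rw [mem_stepSet] at hs
    rw [hN]
    simp only [card_sift_eq_sum]
    rw [Finset.sum_comm]
    refine Finset.sum_le_sum fun σ hσ => ?_
    have h0 : ∀ i ∈ Finset.range m, (0 : ℝ) ≤ if P i s σ then 1 else 0 := fun i _ => by
      split_ifs <;> norm_num
    by_cases hin : [s.1, s.2] <:+: Γ σ (φ σ)
    · obtain ⟨i, hi, hPi⟩ := hstep σ hσ s.1 hs.1.1 s.2 hs.1.2 hin hs.2
      have h1 := Finset.single_le_sum h0 (Finset.mem_range.2 hi)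
      rw [if_pos (by rw [hP]; exact hPi)] at h1
      refine le_trans ?_ h1
      unfold stepInd; split_ifs <;> norm_num
    · have : stepInd (Γ σ (φ σ)) s.1 s.2 = 0 := by simp [stepInd, hin]
      rw [this]
      exact Finset.sum_nonneg h0
  have hNK : ∀ i, ∀ s ∈ stepSet Ω T, N i s ^ 2 ≤ K i * N i s := by
    intro i s hs
    rw [sq]
    refine mul_le_mul_of_nonneg_right ?_ (hN0 i s)
    have h1 := hK₁ i s.1 (mem_stepSet.1 hs).1.1
    rw [hN]
    have h2 : sift Ω₁ (P i s) ⊆ sift Ω₁ (fun σ => W i σ s.1) := by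
      intro σ hσ
      rw [mem_sift, hP] at hσ
      exact mem_sift.2 ⟨hσ.1, hσ.2.2.1⟩
    dsimp only
    exact_mod_cast (Finset.card_le_card h2).trans h1
  have hNsum : ∀ i, ∑ s ∈ stepSet Ω T, N i s ≤ (K i : ℝ) ^ 2 * (β i * Ω₁.card) := by
    intro i
    calc ∑ s ∈ stepSet Ω T, N i s ≤ ∑ s ∈ Ω ×ˢ Ω, N i s :=
          Finset.sum_le_sum_of_subset_of_nonneg
            (fun s hs => Finset.mem_product.2 (mem_stepSet.1 hs).1) (fun s _ _ => hN0 i s)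
      _ = ∑ σ ∈ Ω₁, ∑ s ∈ Ω ×ˢ Ω, if P i s σ then (1 : ℝ) else 0 := by
          rw [hN]
          simp only [card_sift_eq_sum]
          rw [Finset.sum_comm]
      _ ≤ ∑ σ ∈ Ω₁, if B i σ then (K i : ℝ) ^ 2 else 0 := by
          refine Finset.sum_le_sum fun σ hσ => ?_
          by_cases hB : B i σ
          · rw [if_pos hB, ← card_sift_eq_sum]
            have h2 : sift (Ω ×ˢ Ω) (fun s => P i s σ) ⊆
                sift Ω (fun γ => W i σ γ) ×ˢ sift Ω (fun γ => W i σ γ) := by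
              intro s hs
              rw [mem_sift, hP, Finset.mem_product] at hs
              exact Finset.mem_product.2 ⟨mem_sift.2 ⟨hs.1.1, hs.2.2.1⟩,
                mem_sift.2 ⟨hs.1.2, hs.2.2.2⟩⟩
            have h3 := Finset.card_le_card h2
            rw [Finset.card_product] at h3
            have h4 := hK₂ i σ hσ
            rw [sq]
            exact_mod_cast h3.trans (Nat.mul_le_mul h4 h4)
          · rw [if_neg hB]
            refine (Finset.sum_eq_zero fun s _ => if_neg ?_).le
            rw [hP]
            exact fun h => hB h.1
      _ = (K i : ℝ) ^ 2 * (sift Ω₁ (B i)).card := by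
          rw [card_sift_eq_sum, Finset.mul_sum]
          exact Finset.sum_congr rfl fun σ _ => by split_ifs <;> simp
      _ ≤ _ := mul_le_mul_of_nonneg_left (hβ i) (by positivity)
  rw [pairCongestion_eq]
  calc _ ≤ ∑ s ∈ stepSet Ω T, (q ^ 2 * m / Ω₁.card) * ∑ i ∈ Finset.range m, K i * N i s := by
        refine Finset.sum_le_sum fun s hs => ?_
        rw [step_term_eq hs, stepProb_mapCoupling]
        have h1 := hsum s hs
        have h0 : 0 ≤ ∑ σ ∈ Ω₁, stepInd (Γ σ (φ σ)) s.1 s.2 :=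
          Finset.sum_nonneg fun σ _ => stepInd_nonneg _ _ _
        have h2 : ((condSet Ω (diffSet s.1 s.2) s.1).card : ℝ) ≤ q := by
          exact_mod_cast card_condSet_le hs
        have h3 : (Ω.card : ℝ) ≤ q * Ω₁.card := by exact_mod_cast hΩ
        -- Cauchy–Schwarz over the `m` window indices.
        have h4 : (∑ i ∈ Finset.range m, N i s) ^ 2 ≤ m * ∑ i ∈ Finset.range m, K i * N i s := by
          refine (sq_sum_le_card_mul_sum_sq).trans ?_
          rw [Finset.card_range]
          exact mul_le_mul_of_nonneg_left (Finset.sum_le_sum fun i _ => hNK i s hs) (by positivity)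
        calc _ ≤ ((∑ i ∈ Finset.range m, N i s) / Ω₁.card) ^ 2 * ((q * Ω₁.card) * q) := by gcongr
          _ = q ^ 2 / Ω₁.card * (∑ i ∈ Finset.range m, N i s) ^ 2 := by field_simp
          _ ≤ q ^ 2 / Ω₁.card * (m * ∑ i ∈ Finset.range m, K i * N i s) := by gcongr
          _ = _ := by ring
    _ = (q ^ 2 * m / Ω₁.card) * ∑ i ∈ Finset.range m, K i * ∑ s ∈ stepSet Ω T, N i s := by
        rw [← Finset.mul_sum, Finset.sum_comm]
        simp only [Finset.mul_sum]
    _ ≤ (q ^ 2 * m / Ω₁.card) * ∑ i ∈ Finset.range m, K i * ((K i : ℝ) ^ 2 * (β i * Ω₁.card)) := by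
        gcongr with i _
        exact hNsum i
    _ = _ := by
        rw [Finset.mul_sum, Finset.mul_sum]
        refine Finset.sum_congr rfl fun i _ => ?_
        field_simp

end Congestion

end TreeEdgeColoring

namespace TreeEdgeColoring
namespace CTree

/-! ### Colorings as functions on words -/

section Words

variable {C ι : Type} {n : ℕ}

/-- The color of the edge at the end of a path of child labels, read from the root. -/
def get : {n : ℕ} → CTree C ι n → List ι → C
  | _, leaf c, _ => c
  | _, node c _, [] => c
  | _, node _ s, j :: p => get (s j) p

/-- The tree with prescribed colors. -/
def ofFun : (n : ℕ) → (List ι → C) → CTree C ι n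
  | 0, g => leaf (g [])
  | n + 1, g => node (g []) (fun j => ofFun n (fun p => g (j :: p)))

@[simp] lemma get_nil (t : CTree C ι n) : get t [] = root t := by
  cases t <;> rfl

@[simp] lemma get_node_cons (c : C) (s : ι → CTree C ι n) (j : ι) (p : List ι) :
    get (node c s) (j :: p) = get (s j) p := rfl

lemma get_ofFun : ∀ (n : ℕ) (g : List ι → C) (p : List ι), p.length ≤ n → get (ofFun n g) p = g p
  | 0, g, p, hp => by
    obtain rfl : p = [] := List.length_eq_zero_iff.1 (by omega)
    rfl
  | n + 1, g, [], _ => rfl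
  | n + 1, g, j :: p, hp => get_ofFun n _ p (by simpa using hp)

lemma ofFun_congr : ∀ (n : ℕ) {g g' : List ι → C} (_ : ∀ p, p.length ≤ n → g p = g' p),
    ofFun n g = ofFun n g'
  | 0, g, g', h => by simp [ofFun, h [] (by simp)]
  | n + 1, g, g', h => by
    simp only [ofFun, h [] (by simp)]
    congr 1
    funext j
    exact ofFun_congr n fun p hp => h (j :: p) (by simpa using hp)

lemma ofFun_get : ∀ {n : ℕ} (t : CTree C ι n), ofFun n (get t) = t
  | _, .leaf c => rfl
  | _, .node c s => by
    simp only [ofFun, get_nil, root_node, get_node_cons]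
    congr 1
    funext j
    exact ofFun_get (s j)

lemma proper_iff : ∀ {n : ℕ} (t : CTree C ι n), Proper t ↔
    (∀ p j, p.length < n → get t (p ++ [j]) ≠ get t p) ∧
      ∀ p j j', p.length < n → get t (p ++ [j]) = get t (p ++ [j']) → j = j'
  | _, .leaf c => by simp
  | n + 1, .node c s => by
    have ih := fun j => proper_iff (s j)
    rw [proper_node]
    constructor
    · rintro ⟨h1, h2, h3⟩
      refine ⟨fun p j hp => ?_, fun p j j' hp => ?_⟩
      · cases p with
        | nil => simpa using h1 j
        | cons i p => exact ((ih i).1 (h3 i)).1 p j (by simpa using hp)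
      · cases p with
        | nil => exact fun h => h2 (by simpa using h)
        | cons i p => exact ((ih i).1 (h3 i)).2 p j j' (by simpa using hp)
    · rintro ⟨h1, h2⟩
      refine ⟨fun j => by simpa using h1 [] j (by simp), fun j j' h => h2 [] j j' (by simp)
        (by simpa using h), fun i => (ih i).2 ⟨fun p j hp => ?_, fun p j j' hp => ?_⟩⟩
      · exact h1 (i :: p) j (by simpa using hp)
      · exact h2 (i :: p) j j' (by simpa using hp)

lemma Recolor.exists_path [DecidableEq ι] {m : ℕ} {t u : CTree C ι n} (h : Recolor m t u) :
    ∃ p : List ι, p.length = m ∧ m ≤ n ∧ ∀ p', p'.length ≤ n → (get t p' ≠ get u p' ↔ p' = p) := by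
  induction h with
  | root t x h =>
    refine ⟨[], rfl, Nat.zero_le _, fun p' hp' => ?_⟩
    cases t with
    | leaf c =>
      obtain rfl : p' = [] := List.length_eq_zero_iff.1 (by omega)
      simpa using h.symm
    | node c s =>
      cases p' with
      | nil => simpa using h.symm
      | cons j p' => simp
  | kid c s j u h ih =>
    obtain ⟨p, hp, hm, hd⟩ := ih
    refine ⟨j :: p, by simp [hp], by omega, fun p' hp' => ?_⟩
    cases p' with
    | nil => simp
    | cons i p' =>
      by_cases hij : i = j
      · subst hij
        simpa using hd p' (by simpa using hp')
      · simp [hij]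

/-- An edge is recolored exactly when every edge from the root down to it has color `a` or `b`. This
prefix condition is what matches the reachability definition of the alternating path. -/
lemma get_altFlip [DecidableEq C] {a b : C} : ∀ {n : ℕ} (t : CTree C ι n) (p : List ι),
    (root t = a ∨ root t = b) → p.length ≤ n →
    ((∀ v, v <+: p → get t v = a ∨ get t v = b) → get (altFlip a b t) p = Equiv.swap a b (get t p)) ∧
    ((¬ ∀ v, v <+: p → get t v = a ∨ get t v = b) → get (altFlip a b t) p = get t p)
  | _, .leaf c, p, hr, hp => by
    obtain rfl : p = [] := List.length_eq_zero_iff.1 (by omega)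
    simp [altFlip]
    tauto
  | _, .node c s, [], hr, hp => by
    simp [altFlip]
    tauto
  | _, .node c s, j :: p, hr, hp => by
    have hpre : (∀ v, v <+: j :: p → get (node c s) v = a ∨ get (node c s) v = b) ↔
        ∀ v, v <+: p → get (s j) v = a ∨ get (s j) v = b := by
      constructor
      · exact fun h v hv => h (j :: v) (by simpa using hv)
      · intro h v hv
        cases v with
        | nil => simpa using hr
        | cons i v =>
          rw [List.cons_prefix_cons] at hv
          obtain ⟨rfl, hv⟩ := hv
          exact h v hv
    rw [hpre]
    simp only [altFlip, get_node_cons]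
    by_cases hj : root (s j) = a ∨ root (s j) = b
    · rw [if_pos hj]
      exact get_altFlip (s j) p hj (by simpa using hp)
    · rw [if_neg hj]
      refine ⟨fun h => absurd (by simpa using h [] List.nil_prefix) hj, fun _ => rfl⟩

end Words

end CTree

open CTree

/-! ### The tree with a hanging edge -/

section Star

variable {Δ k q : ℕ}

/-- The upper endpoint of the edge `w`. -/
def upper {ι : Type} : List ι → Option (List ι)
  | [] => none
  | _ :: w => some w

lemma mem_starEnds (e : StarEdge Δ k) (v : Option (List (Fin (Δ - 1)))) :
    v ∈ starEnds Δ k e ↔ v = some e.1 ∨ v = upper e.1 := by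
  obtain ⟨_ | ⟨c, w⟩, h⟩ := e
  · simp [starEnds, upper, or_comm]
  · simp [starEnds, upper, or_comm]

lemma starLine_adj (e f : StarEdge Δ k) : (starLine Δ k).Adj e f ↔
    (∃ c, f.1 = c :: e.1) ∨ (∃ c, e.1 = c :: f.1) ∨
      ∃ w c c', c ≠ c' ∧ e.1 = c :: w ∧ f.1 = c' :: w := by
  have h0 : (starLine Δ k).Adj e f ↔ e ≠ f ∧ ∃ v, v ∈ starEnds Δ k e ∧ v ∈ starEnds Δ k f := Iff.rfl
  rw [h0]
  simp only [mem_starEnds, ne_eq, Subtype.ext_iff]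
  obtain ⟨e, he⟩ := e
  obtain ⟨f, hf⟩ := f
  simp only
  cases e with
  | nil =>
    cases f with
    | nil => simp
    | cons c' w' => simp [upper]
  | cons c w =>
    cases f with
    | nil => simp [upper]
    | cons c' w' =>
      simp only [upper, List.cons.injEq]
      constructor
      · rintro ⟨hne, v, rfl | rfl, hv | hv⟩
        · simp only [Option.some.injEq, List.cons.injEq] at hv; exact absurd hv hne
        · simp only [Option.some.injEq] at hv; exact .inl ⟨c', rfl, hv.symm⟩
        · simp only [Option.some.injEq] at hv; exact .inr (.inl ⟨c, rfl, hv⟩)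
        · simp only [Option.some.injEq] at hv
          subst hv
          exact .inr (.inr ⟨w, c, c', fun h => hne ⟨h, rfl⟩, ⟨rfl, rfl⟩, rfl, rfl⟩)
      · rintro (⟨x, rfl, rfl⟩ | ⟨x, rfl, rfl⟩ | ⟨x, y, z, hne, ⟨rfl, rfl⟩, rfl, rfl⟩)
        · exact ⟨fun h => by simpa using congrArg List.length h.2, _, .inl rfl, .inr rfl⟩
        · exact ⟨fun h => by simpa using congrArg List.length h.2, _, .inr rfl, .inl rfl⟩
        · exact ⟨fun h => hne h.1, _, .inr rfl, .inr rfl⟩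

/-- The coloring of the edges of the tree with a hanging edge. -/
def toStar (t : CTree (Fin q) (Fin (Δ - 1)) k) : StarEdge Δ k → Fin q := fun e => get t e.1.reverse

/-- The colored tree of a coloring. -/
def ofStar (σ : StarEdge Δ k → Fin q) : CTree (Fin q) (Fin (Δ - 1)) k :=
  ofFun k (fun p => if h : p.length ≤ k then σ ⟨p.reverse, by simpa using h⟩ else σ (starRoot Δ k))

lemma toStar_ofStar (σ : StarEdge Δ k → Fin q) : toStar (ofStar σ) = σ := by
  funext e
  have he : e.1.reverse.length ≤ k := by simpa using e.2
  rw [toStar, ofStar, get_ofFun _ _ _ he, dif_pos he]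
  congr 1
  exact Subtype.ext (List.reverse_reverse _)

lemma ofStar_toStar (t : CTree (Fin q) (Fin (Δ - 1)) k) : ofStar (toStar t) = t := by
  conv_rhs => rw [← ofFun_get t]
  refine ofFun_congr k fun p hp => ?_
  rw [dif_pos hp, toStar, List.reverse_reverse]

lemma ofStar_injective : Function.Injective (ofStar : (StarEdge Δ k → Fin q) → _) :=
  Function.LeftInverse.injective toStar_ofStar

lemma toStar_root (t : CTree (Fin q) (Fin (Δ - 1)) k) : toStar t (starRoot Δ k) = root t := by
  simp [toStar, starRoot]

lemma root_ofStar (σ : StarEdge Δ k → Fin q) : root (ofStar σ) = σ (starRoot Δ k) := by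
  rw [← toStar_root, toStar_ofStar]

lemma toStar_mem_colorings {L : StarEdge Δ k → Set (Fin q)} {t : CTree (Fin q) (Fin (Δ - 1)) k} :
    toStar t ∈ colorings (starLine Δ k) L ↔ (∀ e, toStar t e ∈ L e) ∧ Proper t := by
  rw [mem_colorings]
  refine and_congr_right fun _ => ?_
  rw [proper_iff]
  constructor
  · intro h
    refine ⟨fun p j hp => ?_, fun p j j' hp heq => ?_⟩
    · have := h ⟨j :: p.reverse, by simpa using hp⟩ ⟨p.reverse, by simpa using hp.le⟩
        ((starLine_adj _ _).2 (.inr (.inl ⟨j, rfl⟩)))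
      simpa [toStar] using this
    · by_contra hne
      have := h ⟨j :: p.reverse, by simpa using hp⟩ ⟨j' :: p.reverse, by simpa using hp⟩
        ((starLine_adj _ _).2 (.inr (.inr ⟨_, j, j', hne, rfl, rfl⟩)))
      exact this (by simpa [toStar] using heq)
  · rintro ⟨h1, h2⟩ e f hef
    obtain ⟨e, he⟩ := e
    obtain ⟨f, hf⟩ := f
    rw [starLine_adj] at hef
    simp only [toStar]
    rcases hef with ⟨c, hc⟩ | ⟨c, hc⟩ | ⟨w, c, c', hne, hc, hc'⟩
    · simp only at hc
      subst hc
      rw [List.reverse_cons]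
      exact (h1 _ c (by simp at hf ⊢; omega)).symm
    · simp only at hc
      subst hc
      rw [List.reverse_cons]
      exact h1 _ c (by simp at he ⊢; omega)
    · simp only at hc hc'
      subst hc hc'
      rw [List.reverse_cons, List.reverse_cons]
      exact fun h => hne (h2 _ c c' (by simp at he ⊢; omega) h)

lemma toStar_mem_starColorings {t : CTree (Fin q) (Fin (Δ - 1)) k} :
    toStar t ∈ starColorings Δ q k ↔ Proper t ∧ root t ∈ rootList Δ q := by
  rw [starColorings, toStar_mem_colorings, and_comm]
  refine and_congr_right fun _ => ?_
  simp [toStar_root]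

lemma toStar_mem_starPinnedColorings {t : CTree (Fin q) (Fin (Δ - 1)) k} :
    toStar t ∈ starPinnedColorings Δ q k ↔ Proper t ∧ (root t).val = 0 := by
  rw [starPinnedColorings, toStar_mem_colorings, and_comm]
  refine and_congr_right fun _ => ?_
  simp [toStar_root]

lemma mem_starColorings {σ : StarEdge Δ k → Fin q} :
    σ ∈ starColorings Δ q k ↔ Proper (ofStar σ) ∧ σ (starRoot Δ k) ∈ rootList Δ q := by
  conv_lhs => rw [← toStar_ofStar σ]
  rw [toStar_mem_starColorings, root_ofStar]

lemma diffSet_toStar {m : ℕ} {t u : CTree (Fin q) (Fin (Δ - 1)) k} (h : Recolor m t u) :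
    ∃ e : StarEdge Δ k, starLevel e = m ∧ diffSet (toStar t) (toStar u) = {e} := by
  obtain ⟨p, hp, hm, hd⟩ := h.exists_path
  refine ⟨⟨p.reverse, by simpa [hp] using hm⟩, by simpa [starLevel] using hp, ?_⟩
  ext e
  rw [diffSet, Set.mem_ofPred_eq, toStar, toStar, hd _ (by simpa using e.2), Set.mem_singleton_iff,
    Subtype.ext_iff]
  exact List.reverse_eq_iff

/-- The connected set containing `r` can only grow downward: two siblings and their parent edge
would be three mutually adjacent edges sharing two colors. Edge labels list the lowest child first,
so prefixes of a root-to-edge path become suffixes of the label. -/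
lemma mem_altPath_iff {a b : Fin q} {t : CTree (Fin q) (Fin (Δ - 1)) k} (ht : Proper t)
    (hr : root t = a) (e : StarEdge Δ k) :
    e ∈ altPath (starLine Δ k) a b (starRoot Δ k) (toStar t) ↔
      ∀ v, v <:+ e.1 → get t v.reverse = a ∨ get t v.reverse = b := by
  have hprop : ∀ e f, (starLine Δ k).Adj e f → toStar t e ≠ toStar t f := by
    have : toStar t ∈ colorings (starLine Δ k) (fun _ => Set.univ) :=
      toStar_mem_colorings.2 ⟨fun _ => trivial, ht⟩
    exact (mem_colorings.1 this).2
  constructor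
  · intro h
    induction h with
    | refl =>
      intro v hv
      simp only [starRoot, List.suffix_nil] at hv
      subst hv
      exact .inl (by simpa using hr)
    | @tail x y _ hxy ih =>
      obtain ⟨hadj, hx, hy⟩ := hxy
      intro v hv
      rw [starLine_adj] at hadj
      rcases hadj with ⟨c, hc⟩ | ⟨c, hc⟩ | ⟨w, c, c', hne, hc, hc'⟩
      · rw [hc, List.suffix_cons_iff] at hv
        rcases hv with rfl | hv
        · rw [← hc]; exact hy
        · exact ih v hv
      · exact ih v (hv.trans (by rw [hc]; exact List.suffix_cons _ _))
      · exfalso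
        have hw : w.length ≤ k := by
          have := x.2
          rw [hc] at this
          simp at this; omega
        have h1 : toStar t ⟨w, hw⟩ = a ∨ toStar t ⟨w, hw⟩ = b := ih w (by rw [hc]; exact List.suffix_cons _ _)
        have h2 := hprop x ⟨w, hw⟩ ((starLine_adj _ _).2 (.inr (.inl ⟨c, hc⟩)))
        have h3 := hprop y ⟨w, hw⟩ ((starLine_adj _ _).2 (.inr (.inl ⟨c', hc'⟩)))
        have h4 := hprop x y ((starLine_adj _ _).2 (.inr (.inr ⟨w, c, c', hne, hc, hc'⟩)))
        rcases hx with hx | hx <;> rcases hy with hy | hy <;> rcases h1 with h1 | h1 <;>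
          rw [hx] at h2 h4 <;> rw [hy] at h3 h4 <;> rw [h1] at h2 h3 <;> simp_all
  · obtain ⟨w, hw⟩ := e
    simp only
    induction w with
    | nil => intro _; exact Relation.ReflTransGen.refl
    | cons c w ih =>
      intro h
      have hw' : w.length ≤ k := by simp at hw; omega
      have h1 := ih hw' (fun v hv => h v (hv.trans (List.suffix_cons _ _)))
      exact mem_altPath_of_adj h1 ((starLine_adj _ _).2 (.inl ⟨c, rfl⟩))
        (h w (List.suffix_cons _ _)) (h (c :: w) List.suffix_rfl)

lemma flip_toStar {a b : Fin q} {t : CTree (Fin q) (Fin (Δ - 1)) k} (ht : Proper t)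
    (hr : root t = a) :
    flip (starLine Δ k) a b (starRoot Δ k) (toStar t) = toStar (altFlip a b t) := by
  funext e
  have hget := get_altFlip (a := a) (b := b) t e.1.reverse (.inl hr) (by simpa using e.2)
  have hiff : (∀ v, v <+: e.1.reverse → get t v = a ∨ get t v = b) ↔
      e ∈ altPath (starLine Δ k) a b (starRoot Δ k) (toStar t) := by
    rw [mem_altPath_iff ht hr]
    constructor
    · intro h v hv
      exact h v.reverse (List.reverse_prefix.2 hv)
    · intro h v hv
      have := h v.reverse (by rw [← List.reverse_prefix, List.reverse_reverse]; exact hv)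
      rwa [List.reverse_reverse] at this
  rw [hiff] at hget
  by_cases h : e ∈ altPath (starLine Δ k) a b (starRoot Δ k) (toStar t)
  · rw [flip_of_mem h]
    exact (hget.1 h).symm
  · rw [flip_of_notMem h]
    exact (hget.2 h).symm

end Star

end TreeEdgeColoring

namespace TreeEdgeColoring

open CTree

/-! ### Counting edges and colorings -/

section Card

variable {Δ k q : ℕ}

/-- A word of length at most `k` is encoded by its letters at the first `k` positions, with `none`
past its end. -/
lemma card_words_le {ι : Type} [Fintype ι] {p : List ι → Prop} [Fintype {w // p w}]
    (hp : ∀ w, p w → w.length ≤ k) :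
    Fintype.card {w // p w} ≤ (Fintype.card ι + 1) ^ k := by
  classical
  have h : Fintype.card (Fin k → Option ι) = (Fintype.card ι + 1) ^ k := by simp
  rw [← h]
  refine Fintype.card_le_of_injective (fun w i => w.1[i.1]?) ?_
  intro w w' hww
  apply Subtype.ext
  apply List.ext_getElem?
  intro i
  by_cases hi : i < k
  · exact congrFun hww ⟨i, hi⟩
  · rw [List.getElem?_eq_none ((hp _ w.2).trans (by omega)),
      List.getElem?_eq_none ((hp _ w'.2).trans (by omega))]

lemma card_starEdge_le (hΔ : 2 ≤ Δ) : Fintype.card (StarEdge Δ k) ≤ Δ ^ k := by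
  have h := card_words_le (k := k) (ι := Fin (Δ - 1)) (p := fun w => w.length ≤ k) (fun w hw => hw)
  rwa [Fintype.card_fin, Nat.sub_add_cancel (by omega)] at h

lemma card_regEdge_le (hΔ : 2 ≤ Δ) : Fintype.card (RegEdge Δ k) ≤ Δ ^ (k + 1) := by
  classical
  let _ : Fintype {w : List (Fin (Δ - 1)) // w.length < k} :=
    (List.finite_length_lt (Fin (Δ - 1)) k).fintype
  have h := card_words_le (k := k) (ι := Fin (Δ - 1)) (p := fun w => w.length < k)
    (fun w hw => hw.le)
  rw [Fintype.card_fin, Nat.sub_add_cancel (by omega)] at h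
  have h2 : Fintype.card (RegEdge Δ k) =
      Δ * Fintype.card {w : List (Fin (Δ - 1)) // w.length < k} :=
    (Fintype.card_congr (Equiv.refl _)).trans ((Fintype.card_prod (Fin Δ) _).trans
      (by rw [Fintype.card_fin]))
  rw [h2, pow_succ']
  exact Nat.mul_le_mul_left _ h

lemma card_colorings_le {E : Type} [Fintype E] (Ω : Finset (E → Fin q)) {N : ℕ} (hq : 0 < q)
    (hE : Fintype.card E ≤ N) : (Ω.card : ℝ) ≤ (q : ℝ) ^ N := by
  classical
  have h1 : Ω.card ≤ q ^ N := by
    refine (Finset.card_le_univ _).trans ?_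
    rw [Fintype.card_fun, Fintype.card_fin]
    exact Nat.pow_le_pow_right hq hE
  exact_mod_cast h1

lemma card_fin_eq (hΔ : 2 ≤ Δ) : Fintype.card (Fin (Δ + 2)) = Fintype.card (Fin (Δ - 1)) + 3 := by
  simp only [Fintype.card_fin]; omega

lemma nonempty_fin_pred (hΔ : 2 ≤ Δ) : Nonempty (Fin (Δ - 1)) := ⟨⟨0, by omega⟩⟩

lemma ofStar_mem_trees {a : Fin q} {σ : StarEdge Δ k → Fin q}
    (h : σ ∈ pinned (starColorings Δ q k) (starRoot Δ k) a) : ofStar σ ∈ trees _ k a := by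
  rw [mem_pinned, mem_starColorings] at h
  exact mem_trees.2 ⟨h.1.1, by rw [root_ofStar, h.2]⟩

lemma card_pinned (hΔ : 2 ≤ Δ) {a : Fin (Δ + 2)} (ha : a ∈ rootList Δ (Δ + 2)) :
    (pinned (starColorings Δ (Δ + 2) k) (starRoot Δ k) a).card = treeCount (Δ - 1) k := by
  rw [← Fintype.card_fin (Δ - 1), ← card_trees (card_fin_eq hΔ) k a]
  refine Finset.card_nbij' ofStar toStar (fun σ h => ofStar_mem_trees h) (fun t ht => ?_)
    (fun σ _ => toStar_ofStar σ) (fun t _ => ofStar_toStar t)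
  rw [Finset.mem_coe, mem_trees] at ht
  rw [Finset.mem_coe, mem_pinned, toStar_mem_starColorings, toStar_root, ht.2]
  exact ⟨⟨ht.1, ha⟩, rfl⟩

lemma card_starColorings_le (hΔ : 2 ≤ Δ) :
    (starColorings Δ (Δ + 2) k).card ≤ (Δ + 2) * treeCount (Δ - 1) k := by
  classical
  have h1 : starColorings Δ (Δ + 2) k ⊆ (Finset.univ.filter (· ∈ rootList Δ (Δ + 2))).biUnion
      (fun a => pinned (starColorings Δ (Δ + 2) k) (starRoot Δ k) a) := by
    intro σ hσ
    rw [Finset.mem_biUnion]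
    exact ⟨σ (starRoot Δ k), by simpa using (mem_starColorings.1 hσ).2, mem_pinned.2 ⟨hσ, rfl⟩⟩
  refine (Finset.card_le_card h1).trans (Finset.card_biUnion_le.trans ?_)
  rw [Finset.sum_congr rfl fun a ha => card_pinned hΔ (by simpa using ha), Finset.sum_const,
    smul_eq_mul]
  refine Nat.mul_le_mul_right _ ((Finset.card_le_univ _).trans ?_)
  rw [Fintype.card_fin]

end Card

/-! ### Canonical paths -/

section Paths

variable {Δ k : ℕ}

/-- The moves of the canonical path of `σ`. -/
def FlipStep (q : ℕ) (a b : Fin q) (σ γ γ' : StarEdge Δ k → Fin q) : Prop :=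
  γ ∈ starColorings Δ q k ∧ γ' ∈ starColorings Δ q k ∧ ∃ e, diffSet γ γ' = {e} ∧
    (starLevel e = k → ∃ i, WindowBad a b i (ofStar σ) ∧ Window a b i (ofStar σ) (ofStar γ) ∧
      Window a b i (ofStar σ) (ofStar γ'))

/-- Both halves of the tree walk are transported to edge colorings. A leaf touch in the preparatory
half belongs to window 0, because only one downward path has changed so far. -/
lemma flipStep_walk (hΔ : 2 ≤ Δ) {a b : Fin (Δ + 2)} (ha : a ∈ rootList Δ (Δ + 2))
    (hb : b ∈ rootList Δ (Δ + 2)) (hab : a ≠ b) {σ : StarEdge Δ k → Fin (Δ + 2)}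
    (hσ : σ ∈ pinned (starColorings Δ (Δ + 2) k) (starRoot Δ k) a) :
    Relation.ReflTransGen (FlipStep (Δ + 2) a b σ) σ
      (flip (starLine Δ k) a b (starRoot Δ k) σ) := by
  have := nonempty_fin_pred hΔ
  obtain ⟨hp, hr⟩ := mem_trees.1 (ofStar_mem_trees hσ)
  obtain ⟨mid, -, -, -, hw1, hw2⟩ := hasFlipWalk (card_fin_eq hΔ) hab (ofStar σ) hp hr
  obtain ⟨P, hP⟩ : ∃ P : ℕ → CTree (Fin (Δ + 2)) (Fin (Δ - 1)) k →
      CTree (Fin (Δ + 2)) (Fin (Δ - 1)) k → Prop, P = fun m u v =>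
      (root u = a ∨ root u = b) ∧ (root v = a ∨ root v = b) ∧ (m = k → ∃ i,
        WindowBad a b i (ofStar σ) ∧ Window a b i (ofStar σ) u ∧ Window a b i (ofStar σ) v) :=
    ⟨_, rfl⟩
  have h1 : Walk P (ofStar σ) (altFlip a b (ofStar σ)) := by
    refine (hw1.mono ?_).trans (hw2.mono ?_)
    · rintro m u v ⟨⟨h1, h2⟩, ⟨h3, h4⟩, h5⟩
      rw [hP]
      exact ⟨h1, h3, fun h => ⟨0, .start (h5 h), .zero h2.two, .zero h4.two⟩⟩
    · rintro m u v ⟨h1, h2, h3⟩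
      rw [hP]
      exact ⟨.inr h1, .inr h2, h3⟩
  have h2 := Relation.ReflTransGen.lift (r := Move P) (p := FlipStep (Δ + 2) a b σ) toStar (by
    rintro u v ⟨hu, hv, m, hr, hPm⟩
    rw [hP] at hPm
    obtain ⟨h1, h2, h3⟩ := hPm
    obtain ⟨e, he, hd⟩ := diffSet_toStar hr
    refine ⟨toStar_mem_starColorings.2 ⟨hu, ?_⟩, toStar_mem_starColorings.2 ⟨hv, ?_⟩, e, hd, ?_⟩
    · rcases h1 with h | h <;> rwa [h]
    · rcases h2 with h | h <;> rwa [h]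
    · rw [ofStar_toStar, ofStar_toStar, he]
      exact h3) _ _ h1
  simp only [Function.onFun] at h2
  rw [← flip_toStar hp hr, toStar_ofStar] at h2
  exact h2

/-- A loop-free list of moves from `σ` to `τ`, tagged by the colors of the hanging edge. -/
def IsFlipPath (q : ℕ) (σ τ : StarEdge Δ k → Fin q) (l : List (StarEdge Δ k → Fin q)) : Prop :=
  l.head? = some σ ∧ l.getLast? = some τ ∧ l.Nodup ∧
    l.IsChain (FlipStep q (σ (starRoot Δ k)) (τ (starRoot Δ k)) σ)

open Classical in
/-- The canonical paths. -/
def flipPath (Δ q k : ℕ) : PathFamily Δ q k := fun σ τ =>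
  if h : ∃ l, IsFlipPath q σ τ l then h.choose else []

lemma isFlipPath_flipPath (hΔ : 2 ≤ Δ) {a b : Fin (Δ + 2)} (ha : a ∈ rootList Δ (Δ + 2))
    (hb : b ∈ rootList Δ (Δ + 2)) (hab : a ≠ b) {σ : StarEdge Δ k → Fin (Δ + 2)}
    (hσ : σ ∈ pinned (starColorings Δ (Δ + 2) k) (starRoot Δ k) a) :
    IsFlipPath (Δ + 2) σ (flip (starLine Δ k) a b (starRoot Δ k) σ)
      (flipPath Δ (Δ + 2) k σ (flip (starLine Δ k) a b (starRoot Δ k) σ)) := by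
  have hr := (mem_pinned.1 hσ).2
  have hr' : flip (starLine Δ k) a b (starRoot Δ k) σ (starRoot Δ k) = b := by
    rw [flip_of_mem Relation.ReflTransGen.refl, hr, Equiv.swap_apply_left]
  have h : ∃ l, IsFlipPath (Δ + 2) σ (flip (starLine Δ k) a b (starRoot Δ k) σ) l := by
    obtain ⟨l, h1, h2, h3, h4⟩ := exists_nodup_chain (flipStep_walk hΔ ha hb hab hσ)
    refine ⟨l, h1, h2, h3, ?_⟩
    rw [hr, hr']
    exact h4
  rw [flipPath, dif_pos h]
  exact h.choose_spec

lemma flipCoupling_eq (Δ q k : ℕ) (a b : Fin q) : flipCoupling Δ q k a b =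
    mapCoupling (pinned (starColorings Δ q k) (starRoot Δ k) a)
      (flip (starLine Δ k) a b (starRoot Δ k)) := by
  funext σ τ
  unfold flipCoupling mapCoupling
  by_cases h : τ = flip (starLine Δ k) a b (starRoot Δ k) σ <;> simp [h]

theorem isCouplingSet_flipCoupling (Δ q k : ℕ) : IsCouplingSet Δ q k (flipCoupling Δ q k) := by
  intro a ha b hb _
  rw [flipCoupling_eq]
  have hL : ∀ e, e ≠ starRoot Δ k →
      {c : Fin q | e = starRoot Δ k → c ∈ rootList Δ q} = Set.univ := by
    intro e he
    ext c
    simp [he]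
  exact isCoupling_mapCoupling (fun σ hσ => flip_mem hL (fun _ => hb) hσ)
    (fun σ hσ => flip_mem hL (fun _ => ha) hσ) (fun σ => flip_flip) (fun σ => flip_flip)

lemma mem_of_isChain {X : Type} {r : X → X → Prop} {Ω : Set X} (hr : ∀ x y, r x y → y ∈ Ω) :
    ∀ (l : List X) {x : X}, l.head? = some x → x ∈ Ω → l.IsChain r → ∀ y ∈ l, y ∈ Ω
  | [], _, _, _, _, y, hy => by simp at hy
  | [a], x, h, hx, _, y, hy => by
    simp only [List.head?_cons, Option.some.injEq] at h
    rw [List.mem_singleton] at hy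
    rwa [hy, h]
  | a :: b :: l, x, h, hx, hc, y, hy => by
    simp only [List.head?_cons, Option.some.injEq] at h
    rw [List.isChain_cons_cons] at hc
    rw [List.mem_cons] at hy
    rcases hy with rfl | hy
    · rwa [h]
    · exact mem_of_isChain hr (b :: l) rfl (hr _ _ hc.1) hc.2 y hy

theorem isCanonicalPaths_flipPath (hΔ : 2 ≤ Δ) :
    IsCanonicalPaths Δ (Δ + 2) k (flipCoupling Δ (Δ + 2) k) (flipPath Δ (Δ + 2) k) := by
  intro a ha b hb hab σ τ hne
  rw [flipCoupling_eq] at hne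
  have hτ : τ = flip (starLine Δ k) a b (starRoot Δ k) σ := by
    by_contra h
    exact hne (by simp [mapCoupling, h])
  subst hτ
  have hσ : σ ∈ pinned (starColorings Δ (Δ + 2) k) (starRoot Δ k) a := by
    by_contra h
    exact hne (by simp [mapCoupling, prob_of_notMem h])
  obtain ⟨h1, h2, h3, h4⟩ := isFlipPath_flipPath hΔ ha hb hab hσ
  refine ⟨h1, h2, h3, fun γ hγ => ?_, h4.imp fun γ γ' h => ?_⟩
  · exact mem_of_isChain (Ω := {γ | γ ∈ starColorings Δ (Δ + 2) k}) (fun x y h => h.2.1) _ h1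
      (mem_pinned.1 hσ).1 h4 γ hγ
  · obtain ⟨-, -, e, he, -⟩ := h
    exact Set.ncard_eq_one.2 ⟨e, he⟩

/-- The bound on the probability of touching the leaf level around the edge `2 i` of the
alternating path. -/
def windowProb (Δ k i : ℕ) : ℝ :=
  if 2 * i ≤ k then occ (Fin (Δ - 1)) ^ (2 * i) *
    (2 * occ (Fin (Δ - 1)) ^ (2 ^ (k - 2 * i - 5) - 1)) else 0

/-- Every leaf step of a canonical path is charged to one of at most `k + 1` window indices.
`card_window` supplies the multiplicities in both directions, the second through `Window.symm`, and
`card_windowBad` the probabilities. -/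
theorem leaf_congestion_le (hΔ : 2 ≤ Δ) {a b : Fin (Δ + 2)} (ha : a ∈ rootList Δ (Δ + 2))
    (hb : b ∈ rootList Δ (Δ + 2)) (hab : a ≠ b) :
    pairCongestion (starColorings Δ (Δ + 2) k) {e | starLevel e = k}
      (flipCoupling Δ (Δ + 2) k a b) (flipPath Δ (Δ + 2) k) ≤
      ((Δ + 2 : ℕ) : ℝ) ^ 2 * ((k + 1 : ℕ) : ℝ) * ∑ i ∈ Finset.range (k + 1),
        (((Δ + 2) ^ (4 * (k - 2 * i + 1)) : ℕ) : ℝ) ^ 3 * windowProb Δ k i := by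
  classical
  have hC := card_fin_eq hΔ
  have hK : ∀ (i : ℕ) (S : Finset (StarEdge Δ k → Fin (Δ + 2)))
      (u : CTree (Fin (Δ + 2)) (Fin (Δ - 1)) k) (x y : Fin (Δ + 2)), Proper u →
      (sift S (fun σ => Window x y i (ofStar σ) u)).card ≤ (Δ + 2) ^ (4 * (k - 2 * i + 1)) := by
    intro i S u x y hu
    have h1 := card_window hC x y i u hu
    rw [Fintype.card_fin] at h1
    refine (Finset.card_le_card_of_injOn ofStar (fun σ hσ => ?_) ofStar_injective.injOn).trans h1
    rw [Finset.mem_coe, mem_sift] at hσ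
    exact mem_sift.2 ⟨Finset.mem_univ _, hσ.2⟩
  have hZ := card_pinned (k := k) hΔ ha
  rw [flipCoupling_eq]
  refine pairCongestion_mapCoupling_le (B := fun i σ => WindowBad a b i (ofStar σ))
    (W := fun i σ γ => Window a b i (ofStar σ) (ofStar γ)) ?_ ?_ ?_ ?_ ?_ ?_
  · rw [← Finset.card_pos, hZ]; exact treeCount_pos _ _
  · rintro σ hσ γ hγ γ' hγ' hin ⟨e, he, hd⟩
    obtain ⟨-, -, -, h4⟩ := isFlipPath_flipPath hΔ ha hb hab hσ
    have h5 := List.isChain_pair.1 (h4.infix hin)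
    rw [(mem_pinned.1 hσ).2, flip_of_mem Relation.ReflTransGen.refl, (mem_pinned.1 hσ).2,
      Equiv.swap_apply_left] at h5
    obtain ⟨-, -, e', hd', h6⟩ := h5
    obtain rfl : e' = e := Set.singleton_injective (hd'.symm.trans hd)
    obtain ⟨i, h7, h8⟩ := h6 he
    exact ⟨i, by have := h7.le; omega, h7, h8⟩
  · intro i γ hγ
    exact hK i _ _ a b (mem_starColorings.1 hγ).1
  · intro i σ hσ
    refine le_trans (Finset.card_le_card fun γ hγ => ?_) (hK i (starColorings Δ (Δ + 2) k)
      (ofStar σ) b a (mem_starColorings.1 (mem_pinned.1 hσ).1).1)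
    rw [mem_sift] at hγ ⊢
    exact ⟨hγ.1, hγ.2.symm⟩
  · intro i
    unfold windowProb
    split_ifs with hi
    · have h1 := card_windowBad (ι := Fin (Δ - 1)) hC hab i k
      rw [Fintype.card_fin] at h1
      rw [hZ]
      refine le_trans ?_ h1
      have h2 := Finset.card_le_card_of_injOn (s := sift (pinned (starColorings Δ (Δ + 2) k)
        (starRoot Δ k) a) (fun σ => WindowBad a b i (ofStar σ)))
        (t := sift (trees (Fin (Δ - 1)) k a) (fun t => WindowBad a b i t)) ofStar
        (fun σ hσ => by
          rw [Finset.mem_coe, mem_sift] at hσ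
          exact mem_sift.2 ⟨ofStar_mem_trees hσ.1, hσ.2⟩) ofStar_injective.injOn
      exact_mod_cast h2
    · rw [zero_mul, sift_eq_empty_iff.2]
      · simp
      · intro σ _ h
        exact hi h.le
  · rw [hZ]; exact card_starColorings_le hΔ

end Paths

/-! ### Connectivity -/

section Connectivity

variable {Δ k q : ℕ}

lemma starPinned_connected (hΔ : 2 ≤ Δ) {σ τ : StarEdge Δ k → Fin (Δ + 2)}
    (hσ : σ ∈ starPinnedColorings Δ (Δ + 2) k) (hτ : τ ∈ starPinnedColorings Δ (Δ + 2) k) :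
    Relation.ReflTransGen (fun γ γ' => γ ∈ starPinnedColorings Δ (Δ + 2) k ∧
      γ' ∈ starPinnedColorings Δ (Δ + 2) k ∧ ∃ e, diffSet γ γ' = {e}) σ τ := by
  have := nonempty_fin_pred hΔ
  rw [← toStar_ofStar σ, toStar_mem_starPinnedColorings] at hσ
  rw [← toStar_ofStar τ, toStar_mem_starPinnedColorings] at hτ
  have h1 := tree_connected (card_fin_eq hΔ) _ _ hσ.1 hτ.1 (Fin.ext (hσ.2.trans hτ.2.symm))
  have h2 := Relation.ReflTransGen.lift (r := Move (Pinned (root (ofStar σ))))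
    (p := fun γ γ' => γ ∈ starPinnedColorings Δ (Δ + 2) k ∧
      γ' ∈ starPinnedColorings Δ (Δ + 2) k ∧ ∃ e, diffSet γ γ' = {e}) toStar (by
    rintro u v ⟨hu, hv, m, hr, hu', hv'⟩
    obtain ⟨e, -, hd⟩ := diffSet_toStar hr
    exact ⟨toStar_mem_starPinnedColorings.2 ⟨hu, by rw [hu']; exact hσ.2⟩,
      toStar_mem_starPinnedColorings.2 ⟨hv, by rw [hv']; exact hσ.2⟩, e, hd⟩) _ _ h1
  simpa only [Function.onFun, toStar_ofStar] using h2

/-- The coloring of the edges of the regular tree. -/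
def toReg (F : Fin Δ → CTree (Fin q) (Fin (Δ - 1)) k) : RegEdge Δ (k + 1) → Fin q :=
  fun e => get (F e.1) e.2.1.reverse

/-- The family of colored trees of a coloring of the regular tree. -/
def ofReg (σ : RegEdge Δ (k + 1) → Fin q) (i : Fin Δ) : CTree (Fin q) (Fin (Δ - 1)) k :=
  ofStar (fun e => σ (i, ⟨e.1, Nat.lt_succ_of_le e.2⟩))

lemma toReg_ofReg (σ : RegEdge Δ (k + 1) → Fin q) : toReg (ofReg σ) = σ := by
  funext ⟨i, w, hw⟩
  exact congrFun (toStar_ofStar (fun e : StarEdge Δ k => σ (i, ⟨e.1, Nat.lt_succ_of_le e.2⟩)))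
    ⟨w, Nat.le_of_lt_succ hw⟩

lemma mem_regEnds (e : RegEdge Δ k) (v : Option (Fin Δ × List (Fin (Δ - 1)))) :
    v ∈ regEnds Δ k e ↔ v = some (e.1, e.2.1) ∨ v = (upper e.2.1).map (fun w => (e.1, w)) := by
  obtain ⟨i, _ | ⟨c, w⟩, h⟩ := e
  · simp [regEnds, upper, or_comm]
  · simp [regEnds, upper, or_comm]

lemma regLine_adj (e f : RegEdge Δ (k + 1)) : (regLine Δ (k + 1)).Adj e f ↔
    (e.1 = f.1 ∧ (starLine Δ k).Adj ⟨e.2.1, Nat.le_of_lt_succ e.2.2⟩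
      ⟨f.2.1, Nat.le_of_lt_succ f.2.2⟩) ∨ (e.1 ≠ f.1 ∧ e.2.1 = [] ∧ f.2.1 = []) := by
  have h0 : (regLine Δ (k + 1)).Adj e f ↔
    e ≠ f ∧ ∃ v, v ∈ regEnds Δ (k + 1) e ∧ v ∈ regEnds Δ (k + 1) f := Iff.rfl
  have h1 : ∀ e f : StarEdge Δ k, (starLine Δ k).Adj e f ↔
    e ≠ f ∧ ∃ v, v ∈ starEnds Δ k e ∧ v ∈ starEnds Δ k f := fun _ _ => Iff.rfl
  rw [h0, h1]
  simp only [mem_regEnds, mem_starEnds, ne_eq, Subtype.ext_iff, Prod.ext_iff]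
  obtain ⟨i, w, hw⟩ := e
  obtain ⟨j, v, hv⟩ := f
  simp only
  by_cases hij : i = j
  · subst hij
    cases w <;> cases v <;> simp [upper]
  · cases w <;> cases v <;> simp [upper, hij]

/-- The regular tree is treated as `Δ` trees whose hanging edges share a vertex, with no forbidden
color. -/
lemma toReg_mem {F : Fin Δ → CTree (Fin q) (Fin (Δ - 1)) k} :
    toReg F ∈ regColorings Δ q (k + 1) ↔ ForestProper ∅ F := by
  have hstar : ∀ i, Proper (F i) ↔
      ∀ e f : StarEdge Δ k, (starLine Δ k).Adj e f → toStar (F i) e ≠ toStar (F i) f := by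
    intro i
    have := toStar_mem_colorings (L := fun _ => Set.univ) (t := F i)
    rw [mem_colorings] at this
    simpa using this.symm
  rw [regColorings, mem_colorings, ForestProper]
  simp only [Set.mem_univ, implies_true, true_and, Finset.notMem_empty, not_false_eq_true, hstar]
  constructor
  · intro h
    refine ⟨fun i j hij => ?_, fun i e f hef => ?_⟩
    · by_contra hne
      refine h (i, ⟨[], Nat.succ_pos k⟩) (j, ⟨[], Nat.succ_pos k⟩)
        ((regLine_adj _ _).2 (.inr ⟨hne, rfl, rfl⟩)) ?_
      simpa [toReg] using hij
    · exact h (i, ⟨e.1, Nat.lt_succ_of_le e.2⟩) (i, ⟨f.1, Nat.lt_succ_of_le f.2⟩)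
        ((regLine_adj _ _).2 (.inl ⟨rfl, hef⟩))
  · rintro ⟨h1, h2⟩ ⟨i, w, hw⟩ ⟨j, v, hv⟩ hadj
    rw [regLine_adj] at hadj
    rcases hadj with ⟨hij, hadj⟩ | ⟨hij, h3, h4⟩
    · obtain rfl : i = j := hij
      exact h2 i _ _ hadj
    · simp only at h3 h4 hij
      subst h3 h4
      intro h
      exact hij (h1 (by simpa [toReg] using h))

lemma reg_connected (hΔ : 2 ≤ Δ) {σ τ : RegEdge Δ (k + 1) → Fin (Δ + 2)}
    (hσ : σ ∈ regColorings Δ (Δ + 2) (k + 1)) (hτ : τ ∈ regColorings Δ (Δ + 2) (k + 1)) :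
    Relation.ReflTransGen (fun γ γ' => γ ∈ regColorings Δ (Δ + 2) (k + 1) ∧
      γ' ∈ regColorings Δ (Δ + 2) (k + 1) ∧ ∃ e, diffSet γ γ' = {e}) σ τ := by
  have := nonempty_fin_pred hΔ
  rw [← toReg_ofReg σ, toReg_mem] at hσ
  rw [← toReg_ofReg τ, toReg_mem] at hτ
  have h1 := forest_connected (card_fin_eq hΔ) (by simp) hσ hτ
  have h2 := Relation.ReflTransGen.lift (r := ForestMove ∅)
    (p := fun γ γ' => γ ∈ regColorings Δ (Δ + 2) (k + 1) ∧
      γ' ∈ regColorings Δ (Δ + 2) (k + 1) ∧ ∃ e, diffSet γ γ' = {e}) toReg (by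
    rintro F F' ⟨hF, hF', i, u, m, rfl, hr⟩
    obtain ⟨e, -, hd⟩ := diffSet_toStar hr
    refine ⟨toReg_mem.2 hF, toReg_mem.2 hF', (i, ⟨e.1, Nat.lt_succ_of_le e.2⟩), ?_⟩
    ext ⟨j, w, hw⟩
    have h3 := Set.ext_iff.1 hd ⟨w, Nat.le_of_lt_succ hw⟩
    simp only [diffSet, Set.mem_ofPred_eq, Set.mem_singleton_iff, toStar, Subtype.ext_iff] at h3
    simp only [diffSet, Set.mem_ofPred_eq, Set.mem_singleton_iff, toReg, Prod.ext_iff,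
      Subtype.ext_iff]
    by_cases hij : j = i
    · subst hij
      simpa using h3
    · simp [hij]) _ _ h1
  simpa only [Function.onFun, toReg_ofReg] using h2

end Connectivity

end TreeEdgeColoring

namespace TreeEdgeColoring

open CTree

/-! ### The choice of the depth -/

section Numerics

lemma sq_le_two_pow (n : ℕ) : n ^ 2 ≤ 64 * 2 ^ (n - 5) := by
  rcases le_or_gt n 5 with h | h
  · interval_cases n <;> norm_num
  · obtain ⟨m, rfl⟩ := Nat.exists_eq_add_of_lt h
    rw [show 5 + m + 1 - 5 = m + 1 by omega]
    clear h
    induction m with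
    | zero => norm_num
    | succ m ih =>
      calc (5 + (m + 1) + 1) ^ 2 ≤ 2 * (5 + m + 1) ^ 2 := by nlinarith [Nat.zero_le m, Nat.zero_le (m * m)]
        _ ≤ 2 * (64 * 2 ^ (m + 1)) := Nat.mul_le_mul_left _ ih
        _ = _ := by ring

/-- Bernoulli's inequality for `(1 + 2 / (Δ - 1)) ^ Δ`. -/
lemma occ_pow_le {Δ : ℕ} (hΔ : 2 ≤ Δ) : occ (Fin (Δ - 1)) ^ Δ ≤ 1 / 2 := by
  obtain ⟨d, rfl⟩ : ∃ d, Δ = d + 2 := ⟨Δ - 2, by omega⟩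
  have hd : (0 : ℝ) < (d : ℝ) + 1 := by positivity
  have h1 : occ (Fin (d + 2 - 1)) = ((d : ℝ) + 1) / (d + 3) := by
    rw [occ, Fintype.card_fin, show d + 2 - 1 = d + 1 by omega]
    push_cast
    ring_nf
  have h2 : (2 : ℝ) ≤ (((d : ℝ) + 3) / (d + 1)) ^ (d + 2) := by
    have h3 := one_add_mul_le_pow (a := 2 / ((d : ℝ) + 1)) (by
      have : 0 ≤ 2 / ((d : ℝ) + 1) := by positivity
      linarith) (d + 2)
    have h4 : 1 + 2 / ((d : ℝ) + 1) = ((d : ℝ) + 3) / (d + 1) := by field_simp; ring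
    rw [h4] at h3
    refine le_trans ?_ h3
    have h5 : ((d + 2 : ℕ) : ℝ) * (2 / ((d : ℝ) + 1)) = 2 + 2 / (d + 1) := by
      push_cast; field_simp; ring
    rw [h5]
    have : 0 ≤ 2 / ((d : ℝ) + 1) := by positivity
    linarith
  rw [h1, ← inv_div, inv_pow, one_div]
  exact inv_anti₀ (by norm_num) h2

/-- The square root of the depth, up to a constant. -/
def scale (Δ : ℕ) : ℕ := 1024 * Δ * Nat.log 2 Δ

/-- The depth of the tree. -/
def depth (Δ : ℕ) : ℕ := 2 * scale Δ ^ 2 + 1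

lemma one_le_log {Δ : ℕ} (hΔ : 2 ≤ Δ) : 1 ≤ Nat.log 2 Δ := Nat.log_pos (by norm_num) hΔ

lemma le_scale {Δ : ℕ} (hΔ : 2 ≤ Δ) : 2048 ≤ scale Δ := by
  have := one_le_log hΔ
  unfold scale
  nlinarith

lemma lt_two_pow_log (Δ : ℕ) : Δ < 2 ^ (Nat.log 2 Δ + 1) := Nat.lt_pow_succ_log_self (by norm_num) Δ

lemma add_two_le {Δ : ℕ} (hΔ : 2 ≤ Δ) : Δ + 2 ≤ 2 ^ (3 * Nat.log 2 Δ) := by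
  have h1 := lt_two_pow_log Δ
  have h2 := one_le_log hΔ
  calc Δ + 2 ≤ 2 * 2 ^ (Nat.log 2 Δ + 1) := by omega
    _ = 2 ^ (Nat.log 2 Δ + 2) := by ring
    _ ≤ _ := Nat.pow_le_pow_right (by norm_num) (by omega)

lemma depth_succ_le {Δ : ℕ} (hΔ : 2 ≤ Δ) : depth Δ + 1 ≤ 2 ^ (22 + 6 * Nat.log 2 Δ) := by
  have h1 := lt_two_pow_log Δ
  have h2 := one_le_log hΔ
  have hS := le_scale hΔ
  have h3 : scale Δ ≤ 2 ^ (10 + 3 * Nat.log 2 Δ) := by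
    calc scale Δ ≤ 1024 * 2 ^ (2 * Nat.log 2 Δ) * 2 ^ Nat.log 2 Δ := by
          unfold scale
          refine Nat.mul_le_mul (Nat.mul_le_mul_left _ (h1.le.trans ?_)) Nat.lt_two_pow_self.le
          exact Nat.pow_le_pow_right (by norm_num) (by omega)
      _ = _ := by rw [pow_add, show 3 * Nat.log 2 Δ = 2 * Nat.log 2 Δ + Nat.log 2 Δ by ring,
            pow_add]; norm_num; ring
  calc depth Δ + 1 ≤ 4 * scale Δ ^ 2 := by unfold depth; nlinarith
    _ ≤ 4 * (2 ^ (10 + 3 * Nat.log 2 Δ)) ^ 2 := by gcongr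
    _ = _ := by rw [← pow_mul, show 22 + 6 * Nat.log 2 Δ = 2 + (10 + 3 * Nat.log 2 Δ) * 2 by ring,
          pow_add]; norm_num

/-- Here `n` is the height remaining below the window. The term `depth Δ - n` comes from the length
of the path and `2 ^ (n - 5) - 1` from the bad chain. Replacing the exponential by a quadratic in
`n` suffices because the depth is quadratic in `scale Δ`: the left side is of order `S * n`, and `S
^ 2 + n ^ 2` dominates it. -/
lemma exponent_le {Δ n : ℕ} (hΔ : 2 ≤ Δ) (hn : n ≤ depth Δ) :
    Δ * (Nat.log 2 Δ * (128 + 36 * n)) ≤ (depth Δ - n) + (2 ^ (n - 5) - 1) := by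
  have h1 := sq_le_two_pow n
  have hS := le_scale hΔ
  have hP : 1 ≤ 2 ^ (n - 5) := Nat.one_le_two_pow
  have h2 : scale Δ = 1024 * (Δ * Nat.log 2 Δ) := by unfold scale; ring
  have h3 : depth Δ = 2 * scale Δ ^ 2 + 1 := rfl
  generalize Nat.log 2 Δ = L at *
  generalize 2 ^ (n - 5) = P at *
  rw [← mul_assoc]
  generalize Δ * L = T at *
  generalize scale Δ = S at *
  generalize depth Δ = l at *
  zify [hn, hP] at *
  have h4 : (1024 : ℤ) * (T * (128 + 36 * n)) = S * (128 + 36 * n) := by rw [h2]; ring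
  -- After multiplication by 1024, half of the first square absorbs `36 n S`, eight times the second
  -- absorbs `1024 n`, and `S ≥ 2048` covers what is left.
  nlinarith [sq_nonneg (4 * (n : ℤ) - 9 * S), sq_nonneg ((n : ℤ) - 64)]

/-- Bookkeeping of the constants: the exponent `14 + 12 n` is `12 (n + 1)` from the cubed window
count plus 2 from the factor `q ^ 2`. The cube of `depth Δ + 1` collects the number of windows, the
number of summands and the target bound; the 4 is the 2 of the union bound times the 2 of the
target. -/
lemma term_le {Δ n : ℕ} (hΔ : 2 ≤ Δ) (hn : n ≤ depth Δ) :
    4 * ((depth Δ + 1 : ℕ) : ℝ) ^ 3 * ((Δ + 2 : ℕ) : ℝ) ^ (14 + 12 * n) *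
      occ (Fin (Δ - 1)) ^ ((depth Δ - n) + (2 ^ (n - 5) - 1)) ≤ 1 := by
  have hL := one_le_log hΔ
  have h1 : 4 * (depth Δ + 1) ^ 3 * (Δ + 2) ^ (14 + 12 * n) ≤
      2 ^ (Nat.log 2 Δ * (128 + 36 * n)) := by
    calc _ ≤ 4 * (2 ^ (22 + 6 * Nat.log 2 Δ)) ^ 3 * (2 ^ (3 * Nat.log 2 Δ)) ^ (14 + 12 * n) := by
          gcongr
          · exact depth_succ_le hΔ
          · exact add_two_le hΔ
      _ = 2 ^ (2 + (22 + 6 * Nat.log 2 Δ) * 3 + 3 * Nat.log 2 Δ * (14 + 12 * n)) := by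
          rw [← pow_mul, ← pow_mul, pow_add, pow_add]
          norm_num
      _ ≤ _ := Nat.pow_le_pow_right (by norm_num) (by nlinarith)
  have h2 : occ (Fin (Δ - 1)) ^ ((depth Δ - n) + (2 ^ (n - 5) - 1)) ≤
      (1 / 2) ^ (Nat.log 2 Δ * (128 + 36 * n)) := by
    refine (pow_le_pow_of_le_one occ_nonneg occ_le_one (exponent_le hΔ hn)).trans ?_
    rw [pow_mul]
    exact pow_le_pow_left₀ (pow_nonneg occ_nonneg _) (occ_pow_le hΔ) _
  have h1' : 4 * ((depth Δ + 1 : ℕ) : ℝ) ^ 3 * ((Δ + 2 : ℕ) : ℝ) ^ (14 + 12 * n) ≤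
      2 ^ (Nat.log 2 Δ * (128 + 36 * n)) := by exact_mod_cast h1
  calc _ ≤ (2 : ℝ) ^ (Nat.log 2 Δ * (128 + 36 * n)) * (1 / 2) ^ (Nat.log 2 Δ * (128 + 36 * n)) :=
        mul_le_mul h1' h2 (pow_nonneg occ_nonneg _) (by positivity)
    _ = 1 := by rw [← mul_pow]; norm_num

lemma sum_windowProb_le {Δ : ℕ} (hΔ : 2 ≤ Δ) :
    ((Δ + 2 : ℕ) : ℝ) ^ 2 * ((depth Δ + 1 : ℕ) : ℝ) * ∑ i ∈ Finset.range (depth Δ + 1),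
      (((Δ + 2) ^ (4 * (depth Δ - 2 * i + 1)) : ℕ) : ℝ) ^ 3 * windowProb Δ (depth Δ) i ≤
      1 / (2 * ((depth Δ : ℝ) + 1)) := by
  have hl : (0 : ℝ) < ((depth Δ + 1 : ℕ) : ℝ) := by positivity
  have hq : (0 : ℝ) < ((Δ + 2 : ℕ) : ℝ) := by positivity
  have h1 : ∀ i ∈ Finset.range (depth Δ + 1),
      (((Δ + 2) ^ (4 * (depth Δ - 2 * i + 1)) : ℕ) : ℝ) ^ 3 * windowProb Δ (depth Δ) i ≤
        1 / (2 * ((depth Δ + 1 : ℕ) : ℝ) ^ 3 * ((Δ + 2 : ℕ) : ℝ) ^ 2) := by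
    intro i _
    unfold windowProb
    split_ifs with hi
    · have h2 := term_le hΔ (Nat.sub_le (depth Δ) (2 * i))
      rw [Nat.sub_sub_self hi] at h2
      rw [le_div_iff₀ (by positivity)]
      refine le_trans (le_of_eq ?_) h2
      rw [Nat.cast_pow, ← pow_mul, pow_add (occ (Fin (Δ - 1))),
        show 14 + 12 * (depth Δ - 2 * i) = 4 * (depth Δ - 2 * i + 1) * 3 + 2 by ring,
        pow_add ((Δ + 2 : ℕ) : ℝ)]
      ring
    · rw [mul_zero]; positivity
  refine (mul_le_mul_of_nonneg_left (Finset.sum_le_sum h1) (by positivity)).trans (le_of_eq ?_)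
  rw [Finset.sum_const, Finset.card_range, nsmul_eq_mul]
  have h3 : (depth Δ : ℝ) + 1 = ((depth Δ + 1 : ℕ) : ℝ) := by push_cast; rfl
  rw [h3]
  field_simp

lemma depth_le {Δ : ℕ} (hΔ : 2 ≤ Δ) :
    (depth Δ : ℝ) ≤ 3 * 1024 ^ 2 / Real.log 2 ^ 2 * ((Δ : ℝ) ^ 2 * Real.log Δ ^ 2) := by
  have h0 : 0 < Real.log 2 := Real.log_pos (by norm_num)
  have hS := le_scale hΔ
  have h1 : depth Δ ≤ 3 * scale Δ ^ 2 := by unfold depth; nlinarith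
  have h2 : (Nat.log 2 Δ : ℝ) * Real.log 2 ≤ Real.log Δ := by
    rw [← Real.log_pow]
    refine Real.log_le_log (by positivity) ?_
    exact_mod_cast Nat.pow_log_le_self 2 (by omega)
  have h3 : ((Nat.log 2 Δ : ℝ) * Real.log 2) ^ 2 ≤ Real.log Δ ^ 2 :=
    pow_le_pow_left₀ (by positivity) h2 2
  calc (depth Δ : ℝ) ≤ ((3 * scale Δ ^ 2 : ℕ) : ℝ) := by exact_mod_cast h1
    _ = 3 * 1024 ^ 2 / Real.log 2 ^ 2 * ((Δ : ℝ) ^ 2 * ((Nat.log 2 Δ : ℝ) * Real.log 2) ^ 2) := by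
      unfold scale
      push_cast
      field_simp
    _ ≤ _ := by gcongr

lemma card_pow_four_le {Δ l N m : ℕ} {x : ℝ} (hΔ : 2 ≤ Δ) (hl : 1 ≤ l) (hx : 0 ≤ x)
    (h : x ≤ ((Δ + 2 : ℕ) : ℝ) ^ N) (hN : m * N ≤ Δ ^ (l + 3)) :
    x ^ m ≤ ((Δ + 2 : ℕ) : ℝ) ^ Δ ^ (4 * l) := by
  refine (pow_le_pow_left₀ hx h m).trans ?_
  rw [← pow_mul]
  refine pow_le_pow_right₀ (by push_cast; linarith [Nat.cast_nonneg (α := ℝ) Δ]) ?_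
  rw [mul_comm]
  exact hN.trans (Nat.pow_le_pow_right (by omega) (by omega))

end Numerics

end TreeEdgeColoring

end

/-! ### Assembly of the three properties. -/

open TreeEdgeColoring in
theorem lemma3p6 :
    ∃ (A : ℝ) (B : ℕ), ∀ Δ q : ℕ, 2 ≤ Δ → q = Δ + 2 →
      ∃ ℓ : ℕ, Odd ℓ ∧ (ℓ : ℝ) ≤ A * ((Δ : ℝ) ^ 2 * Real.log Δ ^ 2) ∧
        (IsCouplingSet Δ q ℓ (flipCoupling Δ q ℓ) ∧
          ∃ Γ : PathFamily Δ q ℓ,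
            IsCanonicalPaths Δ q ℓ (flipCoupling Δ q ℓ) Γ ∧
            congestion Δ q ℓ (flipCoupling Δ q ℓ) Γ ℓ ≤ 1 / (2 * ((ℓ : ℝ) + 1)) ∧
            ∀ j : ℕ, j < ℓ →
              congestion Δ q ℓ (flipCoupling Δ q ℓ) Γ j ≤ (q : ℝ) ^ Δ ^ (B * ℓ)) ∧
        (∃ α : ℕ → ℝ, α ℓ = 1 / 2 ∧ (∀ j : ℕ, j < ℓ → α j ≤ (q : ℝ) ^ Δ ^ (B * ℓ)) ∧
          ApproxRootTensorization (starColorings Δ q ℓ) (starRoot Δ ℓ)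
            (fun e => α (starLevel e))) ∧
        (∃ γ : ℝ, γ ≤ (q : ℝ) ^ Δ ^ (B * ℓ) ∧ ∀ j : ℕ, 1 ≤ j → j ≤ ℓ →
          ApproxTensorization (regColorings Δ q j) (fun _ => γ) ∧
          ApproxTensorization (starPinnedColorings Δ q j) (fun _ => γ)) := by
  refine ⟨3 * 1024 ^ 2 / Real.log 2 ^ 2, 4, ?_⟩
  rintro Δ q hΔ rfl
  obtain ⟨l, hl⟩ : ∃ l, l = depth Δ := ⟨_, rfl⟩
  have hl1 : 1 ≤ l := by rw [hl]; unfold depth; omega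
  have hC := isCouplingSet_flipCoupling Δ (Δ + 2) l
  have hΓ := isCanonicalPaths_flipPath (k := l) hΔ
  have hq : (1 : ℝ) ≤ ((Δ + 2 : ℕ) : ℝ) := by
    push_cast; linarith [Nat.cast_nonneg (α := ℝ) Δ]
  have hleaf : ∀ a ∈ rootList Δ (Δ + 2), ∀ b ∈ rootList Δ (Δ + 2), a ≠ b →
      pairCongestion (starColorings Δ (Δ + 2) l) {e | starLevel e = l}
        (flipCoupling Δ (Δ + 2) l a b) (flipPath Δ (Δ + 2) l) ≤ 1 / (2 * ((l : ℝ) + 1)) := by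
    intro a ha b hb hab
    refine (leaf_congestion_le hΔ ha hb hab).trans ?_
    rw [hl]
    exact sum_windowProb_le hΔ
  have hpair : ∀ a ∈ rootList Δ (Δ + 2), ∀ b ∈ rootList Δ (Δ + 2), a ≠ b → ∀ t,
      pairCongestion (starColorings Δ (Δ + 2) l) {e | starLevel e = t}
        (flipCoupling Δ (Δ + 2) l a b) (flipPath Δ (Δ + 2) l) ≤
        ((starColorings Δ (Δ + 2) l).card : ℝ) ^ 4 := fun a ha b hb hab t =>
    pairCongestion_le_card_pow (hC a ha b hb hab) _ _
  have hcard := card_colorings_le (starColorings Δ (Δ + 2) l) (by omega) (card_starEdge_le hΔ)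
  have h8 : 8 ≤ Δ ^ 3 := Nat.pow_le_pow_left hΔ 3
  have hbig : ∀ m, m ≤ 8 → m * Δ ^ l ≤ Δ ^ (l + 3) := by
    intro m hm
    rw [pow_add, mul_comm]
    exact Nat.mul_le_mul_left _ (hm.trans h8)
  refine ⟨l, ?_, ?_, ⟨hC, flipPath Δ (Δ + 2) l, hΓ, ?_, ?_⟩, ?_, ?_⟩
  · rw [hl]; exact ⟨_, rfl⟩
  · rw [hl]; exact depth_le hΔ
  · exact Real.iSup_le (fun p => hleaf _ p.2.1 _ p.2.2.1 p.2.2.2) (by positivity)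
  · intro j _
    refine Real.iSup_le (fun p => (hpair _ p.2.1 _ p.2.2.1 p.2.2.2 j).trans ?_) (by positivity)
    exact card_pow_four_le hΔ hl1 (by positivity) hcard (hbig 4 (by norm_num))
  -- The factor `l + 1` from the Cauchy–Schwarz over levels cancels the leaf bound `1 / (2 (l + 1))`
  -- to give exactly `1 / 2`.
  · refine ⟨fun t => (l + 1) * if t = l then 1 / (2 * ((l : ℝ) + 1)) else
      ((starColorings Δ (Δ + 2) l).card : ℝ) ^ 4, ?_, ?_, ?_⟩
    · have : (l : ℝ) + 1 ≠ 0 := by positivity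
      simp only [if_true]
      field_simp
    · intro j hj
      simp only [if_neg hj.ne]
      have h1 : (l : ℝ) + 1 ≤ ((Δ + 2 : ℕ) : ℝ) ^ Δ ^ l := by
        have h2 : l + 1 ≤ (Δ + 2) ^ Δ ^ l := by
          have h3 : l < Δ ^ l := Nat.lt_pow_self (by omega)
          have h4 : Δ ^ l < (Δ + 2) ^ Δ ^ l := Nat.lt_pow_self (by omega)
          omega
        exact_mod_cast h2
      calc _ ≤ ((Δ + 2 : ℕ) : ℝ) ^ Δ ^ l * (((Δ + 2 : ℕ) : ℝ) ^ Δ ^ l) ^ 4 := by gcongr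
        _ = (((Δ + 2 : ℕ) : ℝ) ^ Δ ^ l) ^ 5 := by ring
        _ ≤ _ := card_pow_four_le hΔ hl1 (by positivity) le_rfl (hbig 5 (by norm_num))
    · refine rootTensorization_of_paths (R := rootList Δ (Δ + 2)) (l := l)
        (ξ := fun t => if t = l then 1 / (2 * ((l : ℝ) + 1)) else
          ((starColorings Δ (Δ + 2) l).card : ℝ) ^ 4) (fun σ hσ => (mem_starColorings.1 hσ).2)
        hC hΓ starLevel (fun e => e.2) (fun t => ?_) (fun a ha b hb hab t _ => ?_)
      · split_ifs <;> positivity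
      · split_ifs with h
        · subst h; exact hleaf a ha b hb hab
        · exact hpair a ha b hb hab t
  -- The trees of depth at most `l` have at most `Δ ^ (l + 1)` edges, the extra factor `Δ` coming
  -- from the root of the regular tree; the fourth power is the constant from connectivity.
  · refine ⟨(((Δ + 2 : ℕ) : ℝ) ^ Δ ^ (l + 1)) ^ 4, ?_, ?_⟩
    · refine card_pow_four_le hΔ hl1 (by positivity) le_rfl ?_
      rw [show l + 3 = l + 1 + 2 by ring, pow_add Δ (l + 1) 2, mul_comm]
      exact Nat.mul_le_mul_left _ (Nat.pow_le_pow_left hΔ 2)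
    · intro j hj1 hj
      obtain ⟨k, rfl⟩ : ∃ k, j = k + 1 := ⟨j - 1, by omega⟩
      have hmono : ∀ m, m ≤ l + 1 → Δ ^ m ≤ Δ ^ (l + 1) := fun m hm =>
        Nat.pow_le_pow_right (by omega) hm
      constructor
      · refine approxTensorization_of_connected _ (pow_le_pow_left₀ (by positivity)
          (card_colorings_le _ (by omega) ((card_regEdge_le hΔ).trans (hmono _ (by omega)))) 4) ?_
        exact fun σ hσ τ hτ => reg_connected hΔ hσ hτ
      · refine approxTensorization_of_connected _ (pow_le_pow_left₀ (by positivity)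
          (card_colorings_le _ (by omega) ((card_starEdge_le hΔ).trans (hmono _ (by omega)))) 4) ?_
        exact fun σ hσ τ hτ => starPinned_connected hΔ hσ hτ
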